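/- Let $\gamma>0$, $0\le\mu<\nu$, $s>1/2$, and let $\rho_0\in L^1(\mathbb R)\cap H^s(\mathbb R)$ be real-valued with $\rho_0\ge-\mu$ a.e. Set $m=\int_{\mathbb R}\rho_0\,dx$ and $T=\frac1\gamma\ln\left(\frac{2\nu}{\mu}-1\right)$, with $T=\infty$ if $\mu=0$. Let $\mathbb C_+=\{\operatorname{Im}z>0\}$, $f_0(z)=\frac1\pi\int_{\mathbb R}\frac{\rho_0(s)}{z-s}\,ds$ for $z\in\mathbb C_+$, let $Hf(x)=\frac1\pi\,\mathrm{p.v.}\!\int\frac{f(y)}{x-y}\,dy$ be the Hilbert transform, and let $\Lambda$ be the Fourier multiplier with symbol $|\xi|$. (i) There is a unique $g(z,t)$, continuous on $\mathbb C_+\times[0,T)$ and such that $g(\cdot,t)$ is holomorphic in a neighbourhood of $\overline{\mathbb C_+}$ for each $t\in(0,T)$, with $$\partial_tg+(g-i\nu)\,\partial_zg=\gamma^2z+i\nu\gamma\quad(z\in\mathbb C_+,\ 0<t<T),\qquad g(z,0)=f_0(z)-\gamma z\quad(z\in\mathbb C_+)$$ (unique as a function on $\overline{\mathbb C_+}\times(0,T)$).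 For $z\in\overline{\mathbb C_+}$, $g$ is smooth in $t\in(0,T)$, and $\partial_t^kg(\cdot,t)$ is holomorphic in a neighbourhood of $\overline{\mathbb C_+}$ for all $k\ge 0$ and $t\in(0,T)$ (for a suitable extension of $g$ across the real axis). (ii) Write $g(x,t)+\gamma x=u(x,t)-i\rho(x,t)$ for $x\in\mathbb R$, $t\in(0,T)$, with $u,\rho$ real. Then $u(\cdot,t)=H\rho(\cdot,t)$ and $\rho$ is the unique spatially analytic solution on $(0,T)$ of $$\partial_t\rho+\partial_x[\rho(H\rho-\gamma x)]=-\nu\Lambda\rho,\qquad \rho(x,0)=\rho_0(x).$$ Here a spatially analytic solution is a function $\rho\in C^1(\mathbb R\times(0,T))$ that is real analytic in $x$, has $\rho(\cdot,t)\in L^1\cap L^2$ with $\sup_{0<t\le t_1}\|\rho(\cdot,t)\|_{L^2}<\infty$ for every $t_1<T$, satisfies the equation pointwise (the principal value existing at every point and $\Lambda\rho(\cdot,t)$ being a continuous function), and has $\rho(x,t)\to\rho_0(x)$ as $t\to0^+$ for a.e. $x$. Moreover, for all $t\in(0,T)$: $\rho(x,t)\ge-\mu e^{\gamma t}$ for all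 $x$; $\partial_t^k\rho(\cdot,t)$ is real analytic for every $k\ge 0$; the total mass is conserved, $\int_{\mathbb R}\rho(x,t)\,dx=m$; and if $\rho_0\ge0$ a.e., then $\|\rho(\cdot,t)\|_{L^1}=\|\rho_0\|_{L^1}$. (iii) If $\mu=0$, the solution is global ($T=\infty$), and, with the square root of positive imaginary part, $$\lim_{t\to\infty}g(z,t)=i\nu-\sqrt{(\gamma z+i\nu)^2-\tfrac{2\gamma m}{\pi}}\qquad\text{for all }z\in\overline{\mathbb C_+},$$ and, for every $x\in\mathbb R$, $$\lim_{t\to\infty}\rho(x,t)=\frac{\sqrt{\sqrt{A^2+4\gamma^2x^2\nu^2}-A}-\sqrt2\,\nu}{\sqrt2},\qquad A=\gamma^2x^2-\nu^2-\frac{2\gamma m}{\pi}.$$ -/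

import Mathlib

open MeasureTheory Filter Topology
open scoped ContDiff FourierTransform SchwartzMap

noncomputable section

namespace CriticalHilbert

/-- The open upper half-plane. -/
def upperHalf : Set ℂ := {z | 0 < z.im}

/-- The closed upper half-plane. -/
def closedUpperHalf : Set ℂ := {z | 0 ≤ z.im}

/-- The open time interval `(0, T)`, where `T = ⊤` is allowed. -/
def times (T : EReal) : Set ℝ := {t | 0 < t ∧ (t : EReal) < T}

/-- `T = γ⁻¹ ln (2ν/μ - 1)`, understood as `T = ∞` for `μ = 0`. -/
def lifespan (γ ν μ : ℝ) : EReal :=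
  if μ = 0 then ⊤ else ((1 / γ * Real.log (2 * ν / μ - 1) : ℝ) : EReal)

/-- The (almost everywhere class of the) real function `f` belongs to the Sobolev space
`H^s(ℝ)`, `s ≥ 0`. -/
def MemHs (s : ℝ) (f : ℝ → ℝ) : Prop :=
  ∃ F : Lp ℂ 2 (volume : Measure ℝ), (F : ℝ → ℂ) =ᵐ[volume] (fun x => (f x : ℂ)) ∧
    TemperedDistribution.MemSobolev s 2 (Lp.toTemperedDistribution F)

/-- `u` is the Hilbert transform of `f`:
`u x = π⁻¹ p.v. ∫ f y / (x - y) dy`, the principal value existing at every point. -/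
def IsHilbertTransform (f u : ℝ → ℝ) : Prop :=
  ∀ x : ℝ, Tendsto
    (fun ε : ℝ => 1 / Real.pi * ∫ y in {y : ℝ | ε < |x - y|}, f y / (x - y))
    (𝓝[>] 0) (𝓝 (u x))

/-- For an integrable `f`: the tempered distribution `Λ^α f`, given by
`𝓕 (Λ^α f) (ξ) = |ξ|^α 𝓕 f (ξ)`, is the continuous function `v`. The equation is tested against
Schwartz functions, `⟨𝓕 v, φ⟩ = ⟨v, 𝓕 φ⟩`; with the kernel `exp (-2πi x ξ)` the symbol
is `|2πξ|^α`. -/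
def IsFracLaplacian (α : ℝ) (f v : ℝ → ℝ) : Prop :=
  Continuous v ∧ ∀ φ : 𝓢(ℝ, ℂ),
    Integrable (fun x : ℝ => (v x : ℂ) * 𝓕 (φ : ℝ → ℂ) x) ∧
    ∫ x : ℝ, (v x : ℂ) * 𝓕 (φ : ℝ → ℂ) x =
      ∫ ξ : ℝ, ((|2 * Real.pi * ξ| ^ α : ℝ) : ℂ) * 𝓕 (fun x : ℝ => (f x : ℂ)) ξ * φ ξ

/-- `ρ` (written `ρ t x`) is a spatially analytic solution on `(0, T)` of
`∂ₜρ + ∂ₓ[ρ (u - γ x)] = -ν Λ^α ρ`, `u = Hρ`, with initial datum `ρ₀`: a classical solution,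
real analytic in `x`, with `ρ t ∈ L¹ ∩ L²` and `‖ρ t‖_{L²}` bounded on each `(0, t₁]`,
`t₁ < T`. -/
structure IsAnalyticSolution (α γ ν : ℝ) (T : EReal) (ρ₀ : ℝ → ℝ) (ρ : ℝ → ℝ → ℝ) : Prop where
  analytic : ∀ t ∈ times T, AnalyticOnNhd ℝ (ρ t) Set.univ
  contDiff : ContDiffOn ℝ 1 (fun p : ℝ × ℝ => ρ p.1 p.2) {p | p.1 ∈ times T}
  integrable : ∀ t ∈ times T, Integrable (ρ t)
  locally_bounded : ∀ t₁ ∈ times T, ∃ C : NNReal, ∀ t : ℝ, 0 < t → t ≤ t₁ →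
    eLpNorm (ρ t) 2 volume ≤ C
  equation : ∀ t ∈ times T, ∃ u v : ℝ → ℝ,
    IsHilbertTransform (ρ t) u ∧ IsFracLaplacian α (ρ t) v ∧
    ∀ x : ℝ, DifferentiableAt ℝ (fun y => ρ t y * (u y - γ * y)) x ∧
      deriv (fun τ => ρ τ x) t + deriv (fun y => ρ t y * (u y - γ * y)) x = -ν * v x
  initial : ∀ᵐ x : ℝ, Tendsto (fun t => ρ t x) (𝓝[>] 0) (𝓝 (ρ₀ x))

/-- `f₀(z) = π⁻¹ ∫ ρ₀(s) / (z - s) ds`. -/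
def cauchyTransform (ρ₀ : ℝ → ℝ) (z : ℂ) : ℂ :=
  1 / (Real.pi : ℂ) * ∫ s : ℝ, (ρ₀ s : ℂ) / (z - s)

/-- `g` (written `g t z`) is a solution on `(0, T)`, holomorphic in a neighbourhood of the closed
upper half-plane for each `t ∈ (0, T)`, of
`∂ₜg + (g - iν) ∂_z g = γ² z + iνγ` in `ℂ₊`, `g(z, 0) = f₀(z) - γ z`. -/
structure IsBurgersSolution (γ ν : ℝ) (T : EReal) (ρ₀ : ℝ → ℝ) (g : ℝ → ℂ → ℂ) : Prop where
  holomorphic : ∀ t ∈ times T, AnalyticOnNhd ℂ (g t) closedUpperHalf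
  continuous : ContinuousOn (fun p : ℝ × ℂ => g p.1 p.2)
    {p | 0 ≤ p.1 ∧ (p.1 : EReal) < T ∧ p.2 ∈ upperHalf}
  equation : ∀ t ∈ times T, ∀ z ∈ upperHalf,
    HasDerivAt (fun τ => g τ z)
      ((γ : ℂ) ^ 2 * z + Complex.I * ν * γ - (g t z - Complex.I * ν) * deriv (g t) z) t
  initial : ∀ z ∈ upperHalf, g 0 z = cauchyTransform ρ₀ z - γ * z

/-- The density `ρ(x, t) = -Im f(x, t)`, where `f(z, t) = g(z, t) + γ z`. -/
def traceDensity (γ : ℝ) (g : ℝ → ℂ → ℂ) (t x : ℝ) : ℝ := -(g t x + γ * x).im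

/-- The velocity `u(x, t) = Re f(x, t)`, where `f(z, t) = g(z, t) + γ z`. -/
def traceVelocity (γ : ℝ) (g : ℝ → ℂ → ℂ) (t x : ℝ) : ℝ := (g t x + γ * x).re

/-- The branch of the square root on `ℂ ∖ [0, ∞)` with positive imaginary part. -/
def upperSqrt (ζ : ℂ) : ℂ := Complex.I * (-ζ) ^ (1 / 2 : ℂ)

/-- `iν - √((γ z + iν)² - 2γm/π)`, with `m` the total mass. -/
def steadyBurgers (γ ν m : ℝ) (z : ℂ) : ℂ :=
  Complex.I * ν - upperSqrt ((γ * z + Complex.I * ν) ^ 2 - (2 * γ * m / Real.pi : ℝ))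

/-- The steady density of total mass `m`. -/
def steadyDensity (γ ν m : ℝ) (x : ℝ) : ℝ :=
  let A := γ ^ 2 * x ^ 2 - ν ^ 2 - 2 * γ * m / Real.pi
  (√(√(A ^ 2 + 4 * γ ^ 2 * x ^ 2 * ν ^ 2) - A) - √2 * ν) / √2

end CriticalHilbert

end

/-! Put `f = g + γ z`. The equation becomes `∂ₜf + (f - γz - iν) ∂_z f = γ f`, and along
characteristics `Φ'' = γ² Φ + iνγ`, which is linear. Integrating, `f(z, t) = exp(γt) f₀(w)`, where
`w ∈ ℂ₊` is the starting point of the characteristic through `(z, t)`, that is, the root of `w = ζ -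
a f₀(w)` with `ζ = exp(γt) z + iν (exp(γt) - 1)/γ` and `a = (exp(2γt) - 1)/(2γ)`. The whole proof
rests on solving this equation, for real `z` as well.

Since `ρ₀ + μ ≥ 0` and constants do not contribute to `∫ ρ₀(s) / ((z - s)(w - s)) ds`, the
Cauchy-Schwarz inequality gives a Schwarz-Pick estimate for `f₀` (`norm_cauchyTransform_sub_sq_le`).
It makes `w ↦ ζ - a f₀(w)` contract hyperbolic distance as soon as `Im ζ > aμ`, so the root exists
and is unique (`root_exists`, `root_unique`). The infinitesimal estimate gives `1 + a f₀'(w) ≠ 0`,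
so the root is analytic in `(ζ, a)` (`root_analytic`). For `Im z ≥ 0` and `t > 0` the condition
holds when `μ (exp(γt) + 1) < 2ν`, that is, when `t < T`; hence `f` is holomorphic across the real
axis.

Because `s > 1/2`, the Fourier transform of `ρ₀` is integrable, so `f₀` is bounded and continuous up
to the axis. Thus `w` stays within `aM` of `ζ`, and the Poisson kernel at `w` is comparable with the
one at `exp(γt) x + ia`. This bounds `ρ` in `L¹` and `L²` by Poisson averages of `|ρ₀|`
(`poisson_foot_le`). As `f` vanishes at infinity, contour integration yields `Re f = Hρ` and `Λρ =
Re ∂ₓf`, and the imaginary part of the Burgers equation on the axis is the equation of `ρ`. Mass is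
read off from `z f(z)` as `z = iy → i∞`.

Uniqueness of `g`: high in the half-plane the explicit characteristic never leaves `ℂ₊`; Grönwall's
inequality fixes `g` there and the identity theorem does the rest (`eqOn_solg`). Uniqueness of `ρ`:
the Cauchy transform of any analytic solution solves the same Burgers problem. The quadratic term is
handled by Tricomi's identity (`cauchyTransform_hilbert_mul`), the dissipation by `Λ = ∂ₓH`, and the
initial time by weak `L²` convergence. Boundary values then recover `ρ`.

For `μ = 0`, the root tends to infinity inside a sector, so `w f₀(w) → m/π`. The root equation
becomes a quadratic equation for `f` in the limit, and the sign of an imaginary part selects the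
branch. -/

namespace CriticalHilbert

/-! ### Contour integration in the upper half-plane -/

section Contour

/-- If `z h(z) → 0` at infinity in the closed upper half-plane and `h` is holomorphic there, then
the symmetric integrals of `h` over the real line tend to zero. -/
theorem tendsto_integral_symm_of_mul_tendsto_zero {h : ℂ → ℂ}
    (hh : DifferentiableOn ℂ h closedUpperHalf)
    (hdecay : Tendsto (fun z => z * h z) (Bornology.cobounded ℂ ⊓ 𝓟 closedUpperHalf) (𝓝 0)) :
    Tendsto (fun R : ℝ => ∫ x in (-R)..R, h x) atTop (𝓝 0) := by
  rw [Metric.tendsto_atTop]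
  intro ε hε
  -- The three other sides of the rectangle `[-R, R] × [0, R]` have total length `4R`, and `‖h‖ ≤
  -- ε/(5R)` on them, which leaves `4ε/5 < ε`.
  have h1 := Metric.tendsto_nhds.mp hdecay (ε / 5) (by positivity)
  rw [eventually_inf_principal] at h1
  rw [(Metric.hasBasis_cobounded_compl_closedBall (0:ℂ)).eventually_iff] at h1
  obtain ⟨R₀, -, hR₀⟩ := h1
  refine ⟨max (R₀ + 1) 1, fun R hR => ?_⟩
  have hR1 : 1 ≤ R := le_trans (le_max_right _ _) hR
  have hR2 : R₀ < R := lt_of_lt_of_le (by linarith [le_max_left (R₀ + 1) 1]) hR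
  have key : ∀ z : ℂ, R ≤ ‖z‖ → 0 ≤ z.im → ‖h z‖ ≤ ε / 5 / R := by
    intro z hz hz'
    have := hR₀ (x := z) (by simp; linarith) hz'
    rw [dist_zero_right, norm_mul] at this
    rw [le_div_iff₀ (by linarith)]
    nlinarith [norm_nonneg (h z)]
  have hrect := Complex.integral_boundary_rect_eq_zero_of_differentiableOn h
    (⟨-R, 0⟩ : ℂ) (⟨R, R⟩ : ℂ) (hh.mono (by
      rintro z ⟨-, hz⟩
      simp only [Set.mem_preimage] at hz
      rw [Set.uIcc_of_le (by linarith)] at hz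
      exact hz.1))
  simp only at hrect
  have e1 : ‖∫ x : ℝ in (-R)..R, h (x + R * Complex.I)‖ ≤ ε / 5 / R * |R - -R| := by
    apply intervalIntegral.norm_integral_le_of_norm_le_const
    intro x _
    apply key
    · have := Complex.abs_im_le_norm (x + R * Complex.I : ℂ)
      simp at this
      exact le_trans (le_abs_self _) this
    · simp; linarith
  have e2 : ‖∫ y : ℝ in (0:ℝ)..R, h (R + y * Complex.I)‖ ≤ ε / 5 / R * |R - 0| := by
    apply intervalIntegral.norm_integral_le_of_norm_le_const
    intro y hy
    rw [Set.uIoc_of_le (by linarith)] at hy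
    apply key
    · have := Complex.abs_re_le_norm (R + y * Complex.I : ℂ)
      simp at this
      exact le_trans (le_abs_self _) this
    · simp; linarith [hy.1]
  have e3 : ‖∫ y : ℝ in (0:ℝ)..R, h ((-R : ℝ) + y * Complex.I)‖ ≤ ε / 5 / R * |R - 0| := by
    apply intervalIntegral.norm_integral_le_of_norm_le_const
    intro y hy
    rw [Set.uIoc_of_le (by linarith)] at hy
    apply key
    · have := Complex.abs_re_le_norm ((-R : ℝ) + y * Complex.I : ℂ)
      simp at this
      rw [Complex.ofReal_neg]
      exact le_trans (le_abs_self _) this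
    · simp; linarith [hy.1]
  have c1 : ε / 5 / R * |R - -R| = 2 * ε / 5 := by
    rw [abs_of_nonneg (by linarith)]; field_simp; ring
  have c2 : ε / 5 / R * |R - 0| = ε / 5 := by
    rw [abs_of_nonneg (by linarith)]; field_simp; ring
  rw [c1] at e1
  rw [c2] at e2 e3
  rw [dist_zero_right]
  simp only [Complex.ofReal_zero, zero_mul, add_zero, smul_eq_mul] at hrect
  have : ∫ x : ℝ in (-R)..R, h x = (∫ x : ℝ in (-R)..R, h (x + R * Complex.I))
      - Complex.I * (∫ y : ℝ in (0:ℝ)..R, h (R + y * Complex.I))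
      + Complex.I * (∫ y : ℝ in (0:ℝ)..R, h ((-R : ℝ) + y * Complex.I)) := by
    linear_combination hrect
  rw [this]
  calc _ ≤ 2 * ε / 5 + ε / 5 + ε / 5 := by
        refine (norm_add_le _ _).trans (add_le_add ((norm_sub_le _ _).trans (add_le_add e1 ?_)) ?_)
        · rw [norm_mul, Complex.norm_I, one_mul]; exact e2
        · rw [norm_mul, Complex.norm_I, one_mul]; exact e3
    _ < ε := by linarith

theorem integral_eq_zero_of_mul_tendsto_zero {h : ℂ → ℂ}
    (hh : DifferentiableOn ℂ h closedUpperHalf)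
    (hdecay : Tendsto (fun z => z * h z) (Bornology.cobounded ℂ ⊓ 𝓟 closedUpperHalf) (𝓝 0))
    (hint : Integrable (fun x : ℝ => h x)) : ∫ x : ℝ, h x = 0 :=
  tendsto_nhds_unique
    (intervalIntegral_tendsto_integral hint tendsto_neg_atTop_atBot tendsto_id)
    (tendsto_integral_symm_of_mul_tendsto_zero hh hdecay)

/-- A function that is holomorphic and bounded in the closed upper half-plane and integrable on the
real line has integral zero. -/
theorem integral_eq_zero_of_bounded {h : ℂ → ℂ} {B : ℝ}
    (hh : DifferentiableOn ℂ h closedUpperHalf)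
    (hB : ∀ z ∈ closedUpperHalf, ‖h z‖ ≤ B)
    (hint : Integrable (fun x : ℝ => h x)) : ∫ x : ℝ, h x = 0 := by
  have hB0 : 0 ≤ B := (norm_nonneg _).trans (hB 0 (by simp [closedUpperHalf]))
  -- the regularizing factor
  set k : ℕ → ℂ → ℂ := fun n z => (1 - Complex.I * z / (n + 1)) with hk
  have hkre : ∀ n z, 0 ≤ z.im → 1 ≤ ‖k n z‖ := by
    intro n z hz
    have : (k n z).re = 1 + z.im / (n + 1) := by
      have : k n z = 1 - Complex.I * z / ((n + 1 : ℝ) : ℂ) := by simp [hk]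
      rw [this, Complex.sub_re, Complex.div_ofReal_re]
      simp; ring
    calc 1 ≤ (k n z).re := by rw [this]; have : 0 ≤ z.im / (n + 1) := by positivity
                              linarith
      _ ≤ _ := Complex.re_le_norm _
  have hkne : ∀ n z, 0 ≤ z.im → k n z ≠ 0 := fun n z hz h0 => by
    have := hkre n z hz; rw [h0] at this; simp at this; linarith
  -- The square is what the decay hypothesis requires: one factor `k n z` absorbs `z`, the other
  -- sends the bounded function to zero. Since `1 ≤ ‖k n z‖`, the regularization is afterwards
  -- removed by dominated convergence.
  have hz : ∀ n : ℕ, ∫ x : ℝ, h x / (k n x) ^ 2 = 0 := by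
    intro n
    apply integral_eq_zero_of_mul_tendsto_zero (h := fun z => h z / (k n z) ^ 2)
    · apply hh.div
      · fun_prop
      · exact fun z hz => pow_ne_zero 2 (hkne n z hz)
    · have hkinf : Tendsto (fun z : ℂ => ‖k n z‖) (Bornology.cobounded ℂ) atTop := by
        have h1 : Tendsto (fun z : ℂ => ‖z‖ / (n + 1) - 1) (Bornology.cobounded ℂ) atTop :=
          tendsto_atTop_add_const_right _ _
            (tendsto_norm_cobounded_atTop.atTop_div_const (by positivity))
        refine tendsto_atTop_mono (fun z => ?_) h1
        have h2 := norm_sub_norm_le (Complex.I * z / (n + 1)) 1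
        have h3 : ‖Complex.I * z / ((n:ℂ) + 1)‖ = ‖z‖ / (n + 1) := by
          rw [norm_div, norm_mul, Complex.norm_I, one_mul]
          congr 1
          have : ((n:ℂ) + 1) = ((n + 1 : ℕ) : ℂ) := by push_cast; rfl
          rw [this, Complex.norm_natCast]; push_cast; rfl
        rw [h3, norm_one, norm_sub_rev] at h2
        exact h2
      have hb : Tendsto (fun z : ℂ => (n + 1) * 2 * B / ‖k n z‖) (Bornology.cobounded ℂ ⊓ 𝓟 closedUpperHalf)
          (𝓝 0) := (tendsto_const_nhds.div_atTop hkinf).mono_left inf_le_left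
      refine squeeze_zero_norm' ?_ hb
      rw [eventually_inf_principal]
      filter_upwards with z hz
      have k1 := hkre n z hz
      have hzk : ‖z‖ ≤ (n + 1) * 2 * ‖k n z‖ := by
        have h4 : z = Complex.I * ((n + 1) * (k n z - 1)) := by
          have : (n : ℂ) + 1 ≠ 0 := by exact_mod_cast Nat.succ_ne_zero n
          simp only [hk]; field_simp; ring_nf; simp
        calc ‖z‖ = ‖Complex.I * ((n + 1) * (k n z - 1))‖ := by rw [← h4]
          _ = (n + 1) * ‖k n z - 1‖ := by
            rw [norm_mul, Complex.norm_I, one_mul, norm_mul]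
            congr 1
            have : ((n:ℂ) + 1) = ((n + 1 : ℕ) : ℂ) := by push_cast; rfl
            rw [this, Complex.norm_natCast]; push_cast; rfl
          _ ≤ (n + 1) * (‖k n z‖ + 1) := by
            gcongr; exact (norm_sub_le _ _).trans (by simp)
          _ ≤ _ := by rw [mul_assoc]; gcongr; linarith
      rw [norm_mul, norm_div, norm_pow, mul_div_assoc', div_le_div_iff₀ (by positivity) (by positivity)]
      have := hB z hz
      calc ‖z‖ * ‖h z‖ * ‖k n z‖ ≤ ((n + 1) * 2 * ‖k n z‖) * B * ‖k n z‖ := by gcongr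
        _ = _ := by ring
    · refine hint.norm.mono' ?_ ?_
      · refine (hint.1.mul (f := fun x : ℝ => h x) (g := fun x : ℝ => ((k n x) ^ 2)⁻¹) ?_)
        refine Continuous.aestronglyMeasurable ?_
        apply Continuous.inv₀
        · fun_prop
        · exact fun x => pow_ne_zero 2 (hkne n x (by simp))
      · filter_upwards with x
        rw [norm_div, norm_pow]
        apply div_le_self (norm_nonneg _)
        exact one_le_pow₀ (hkre n x (by simp))
  have hlim : Tendsto (fun n : ℕ => ∫ x : ℝ, h x / (k n x) ^ 2) atTop (𝓝 (∫ x : ℝ, h x)) := by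
    apply tendsto_integral_of_dominated_convergence (fun x : ℝ => ‖h x‖)
    · intro n
      refine (hint.1.mul (f := fun x : ℝ => h x) (g := fun x : ℝ => ((k n x) ^ 2)⁻¹) ?_)
      refine Continuous.aestronglyMeasurable ?_
      apply Continuous.inv₀
      · fun_prop
      · exact fun x => pow_ne_zero 2 (hkne n x (by simp))
    · exact hint.norm
    · intro n
      filter_upwards with x
      rw [norm_div, norm_pow]
      apply div_le_self (norm_nonneg _)
      exact one_le_pow₀ (hkre n x (by simp))
    · filter_upwards with x
      have : Tendsto (fun n : ℕ => k n x) atTop (𝓝 1) := by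
        have h5 : Tendsto (fun n : ℕ => Complex.I * x * (1 / ((n : ℂ) + 1))) atTop (𝓝 (Complex.I * x * 0)) :=
          tendsto_const_nhds.mul tendsto_one_div_add_atTop_nhds_zero_nat
        have h6 := (tendsto_const_nhds (x := (1:ℂ))).sub h5
        simp only [mul_zero, sub_zero] at h6
        refine h6.congr fun n => ?_
        simp only [hk]; ring
      have h7 := (tendsto_const_nhds (x := h x)).div (this.pow 2) (by simp)
      simp only [one_pow, div_one] at h7
      exact h7
  simp only [hz] at hlim
  exact (tendsto_nhds_unique hlim tendsto_const_nhds)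

end Contour

/-! ### The kernel `1/(z - s)` and its Poisson kernel -/

section CauchyKernel

theorem im_le_norm_sub_ofReal (z : ℂ) (s : ℝ) : z.im ≤ ‖z - s‖ := by
  have := Complex.abs_im_le_norm (z - s)
  simp at this
  exact (le_abs_self _).trans this

theorem norm_sub_ofReal_pos {z : ℂ} (hz : 0 < z.im) (s : ℝ) : 0 < ‖z - s‖ :=
  hz.trans_le (im_le_norm_sub_ofReal z s)

theorem sub_ofReal_ne_zero {z : ℂ} (hz : 0 < z.im) (s : ℝ) : z - s ≠ 0 :=
  norm_pos_iff.mp (norm_sub_ofReal_pos hz s)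

theorem norm_sub_ofReal_sq (z : ℂ) (s : ℝ) : ‖z - s‖ ^ 2 = (z.re - s) ^ 2 + z.im ^ 2 := by
  rw [← Complex.normSq_eq_norm_sq, Complex.normSq_apply]; simp; ring

theorem continuous_inv_sub {z : ℂ} (hz : 0 < z.im) : Continuous fun s : ℝ => (z - s)⁻¹ :=
  (continuous_const.sub Complex.continuous_ofReal).inv₀ (sub_ofReal_ne_zero hz)

theorem norm_inv_sub_le {z : ℂ} (hz : 0 < z.im) (s : ℝ) : ‖(z - s)⁻¹‖ ≤ z.im⁻¹ := by
  rw [norm_inv]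
  exact inv_anti₀ hz (im_le_norm_sub_ofReal z s)

theorem poisson_scaling {z : ℂ} (hz : 0 < z.im) (s : ℝ) :
    z.im / ‖z - s‖ ^ 2 = z.im⁻¹ * (1 + ((s - z.re) / z.im) ^ 2)⁻¹ := by
  have h2 := norm_sub_ofReal_pos hz s
  have h1 := norm_sub_ofReal_sq z s
  have h3 : 0 < (z.re - s) ^ 2 + z.im ^ 2 := by rw [← h1]; positivity
  have h4 : 1 + ((s - z.re) / z.im) ^ 2 = ((z.re - s) ^ 2 + z.im ^ 2) / z.im ^ 2 := by
    field_simp; ring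
  rw [h1, h4, inv_div]
  field_simp

theorem integrable_poisson {z : ℂ} (hz : 0 < z.im) :
    Integrable fun s : ℝ => z.im / ‖z - s‖ ^ 2 := by
  simp_rw [poisson_scaling hz]
  exact ((integrable_inv_one_add_sq.comp_div hz.ne').comp_sub_right z.re).const_mul _

theorem integral_poisson {z : ℂ} (hz : 0 < z.im) :
    ∫ s : ℝ, z.im / ‖z - s‖ ^ 2 = Real.pi := by
  simp_rw [poisson_scaling hz]
  rw [integral_const_mul, integral_sub_right_eq_self (fun s : ℝ => (1 + (s / z.im) ^ 2)⁻¹) z.re,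
    Measure.integral_comp_div (fun s : ℝ => (1 + s ^ 2)⁻¹) z.im, integral_univ_inv_one_add_sq,
    abs_of_pos hz, smul_eq_mul]
  field_simp

theorem integrable_inv_norm_sub_sq {z : ℂ} (hz : 0 < z.im) :
    Integrable fun s : ℝ => 1 / ‖z - s‖ ^ 2 := by
  refine ((integrable_poisson hz).const_mul z.im⁻¹).congr (ae_of_all _ fun s => ?_)
  field_simp

theorem memLp_two_inv_sub {z : ℂ} (hz : 0 < z.im) : MemLp (fun s : ℝ => (z - s)⁻¹) 2 := by
  rw [memLp_two_iff_integrable_sq_norm (continuous_inv_sub hz).aestronglyMeasurable]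
  refine (integrable_inv_norm_sub_sq hz).congr (ae_of_all _ fun s => ?_)
  simp

/-- Both poles lie above the real axis, so the integrand is holomorphic below it. Conjugation moves
the poles to the lower half-plane, where they do not obstruct the contour lemma. -/
theorem integral_inv_mul_inv_eq_zero {z w : ℂ} (hz : 0 < z.im) (hw : 0 < w.im) :
    ∫ s : ℝ, (z - s)⁻¹ * (w - s)⁻¹ = 0 := by
  have key : ∫ s : ℝ, (starRingEnd ℂ z - s)⁻¹ * (starRingEnd ℂ w - s)⁻¹ = 0 := by
    have hne : ∀ {u : ℂ}, 0 < u.im → ∀ ζ : ℂ, 0 ≤ ζ.im → starRingEnd ℂ u - ζ ≠ 0 := by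
      intro u hu ζ hζ h0
      have := congrArg Complex.im h0
      simp at this
      linarith
    apply integral_eq_zero_of_mul_tendsto_zero
      (h := fun ζ => (starRingEnd ℂ z - ζ)⁻¹ * (starRingEnd ℂ w - ζ)⁻¹)
    · apply DifferentiableOn.mul
      · exact (by fun_prop : DifferentiableOn ℂ (fun ζ => starRingEnd ℂ z - ζ) _).inv
          fun ζ hζ => hne hz ζ hζ
      · exact (by fun_prop : DifferentiableOn ℂ (fun ζ => starRingEnd ℂ w - ζ) _).inv
          fun ζ hζ => hne hw ζ hζ
    · have t1 : ∀ u : ℂ, Tendsto (fun ζ : ℂ => (u - ζ)⁻¹) (Bornology.cobounded ℂ) (𝓝 0) := by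
        intro u
        refine tendsto_inv₀_cobounded.comp ?_
        have : Tendsto (fun ζ : ℂ => -(ζ - u)) (Bornology.cobounded ℂ) (Bornology.cobounded ℂ) := by
          refine tendsto_neg_cobounded.comp ?_
          exact tendsto_sub_const_cobounded u
        simpa only [neg_sub] using this
      have t2 : Tendsto (fun ζ : ℂ => ζ * (starRingEnd ℂ z - ζ)⁻¹) (Bornology.cobounded ℂ)
          (𝓝 (-1)) := by
        have h1 := ((t1 (starRingEnd ℂ z)).const_mul (starRingEnd ℂ z)).sub_const 1
        simp only [mul_zero, zero_sub] at h1
        refine h1.congr' ?_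
        have : ∀ᶠ ζ in Bornology.cobounded ℂ, ζ ≠ starRingEnd ℂ z := by
          have : Bornology.IsBounded ({starRingEnd ℂ z} : Set ℂ) := Bornology.isBounded_singleton
          exact Bornology.isBounded_def.mp this
        filter_upwards [this] with ζ hζ
        have : starRingEnd ℂ z - ζ ≠ 0 := sub_ne_zero.mpr hζ.symm
        field_simp
        ring
      have t3 := t2.mul (t1 (starRingEnd ℂ w))
      rw [mul_zero] at t3
      refine (t3.mono_left inf_le_left).congr fun ζ => ?_
      ring
    · have hz' := (memLp_two_inv_sub hz)
      have hw' := (memLp_two_inv_sub hw)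
      have := (hz'.integrable_mul hw')
      refine ((Complex.conjLIE.toContinuousLinearEquiv.integrable_comp_iff).mpr this).congr
        (ae_of_all _ fun s => ?_)
      simp
  have h2 := congrArg (starRingEnd ℂ) key
  rw [← integral_conj] at h2
  simpa using h2

end CauchyKernel

/-! ### Cauchy transform and the Schwarz-Pick estimate -/

section CauchyTransform

variable {ρ : ℝ → ℝ}

theorem integrable_mul_bounded {ρ : ℝ → ℝ} (hρ : Integrable ρ) {k : ℝ → ℂ} (hk : Continuous k)
    {B : ℝ} (hB : ∀ s, ‖k s‖ ≤ B) : Integrable fun s => (ρ s : ℂ) * k s :=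
  (hρ.ofReal (𝕜 := ℂ)).mul_bdd (c := B) hk.aestronglyMeasurable (ae_of_all _ hB)

theorem integrable_cauchy (hρ : Integrable ρ) {z : ℂ} (hz : 0 < z.im) :
    Integrable fun s : ℝ => (ρ s : ℂ) / (z - s) := by
  simp_rw [div_eq_mul_inv]
  exact integrable_mul_bounded hρ (continuous_inv_sub hz) (norm_inv_sub_le hz)

theorem norm_cauchyTransform_le_integral (ρ : ℝ → ℝ) (z : ℂ) :
    ‖cauchyTransform ρ z‖ ≤ 1 / Real.pi * ∫ s, |ρ s| / ‖z - s‖ := by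
  rw [cauchyTransform, norm_mul]
  have : ‖(1 / (Real.pi : ℂ))‖ = 1 / Real.pi := by
    rw [norm_div, norm_one, Complex.norm_real, Real.norm_of_nonneg Real.pi_pos.le]
  rw [this]
  gcongr
  refine (norm_integral_le_integral_norm _).trans (le_of_eq ?_)
  congr 1; ext s
  rw [norm_div, Complex.norm_real, Real.norm_eq_abs]

theorem norm_cauchyTransform_le (hρ : Integrable ρ) {z : ℂ} (hz : 0 < z.im) :
    ‖cauchyTransform ρ z‖ ≤ 1 / Real.pi * (∫ s, |ρ s|) / z.im := by
  refine (norm_cauchyTransform_le_integral ρ z).trans ?_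
  rw [mul_div_assoc, ← integral_div]
  refine mul_le_mul_of_nonneg_left ?_ (by positivity)
  refine integral_mono_of_nonneg (ae_of_all _ fun s => by positivity) (hρ.abs.div_const _)
    (ae_of_all _ fun s => ?_)
  have := im_le_norm_sub_ofReal z s
  simp only
  gcongr

/-- The derivative of the Cauchy transform. -/
noncomputable def cauchyDeriv (ρ : ℝ → ℝ) (z : ℂ) : ℂ :=
  -(1 / (Real.pi : ℂ) * ∫ s : ℝ, (ρ s : ℂ) * ((z - s)⁻¹ * (z - s)⁻¹))

theorem hasDerivAt_cauchyTransform (hρ : Integrable ρ) {z : ℂ} (hz : 0 < z.im) :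
    HasDerivAt (cauchyTransform ρ) (cauchyDeriv ρ z) z := by
  have hball : ∀ w ∈ Metric.ball z (z.im / 2), z.im / 2 < w.im := by
    intro w hw
    rw [Metric.mem_ball, dist_eq_norm] at hw
    have := (Complex.abs_im_le_norm (w - z))
    rw [Complex.sub_im] at this
    have := abs_lt.mp (this.trans_lt hw)
    linarith
  have h := hasDerivAt_integral_of_dominated_loc_of_deriv_le
    (F := fun (w : ℂ) (s : ℝ) => (ρ s : ℂ) / (w - s))
    (F' := fun (w : ℂ) (s : ℝ) => -((ρ s : ℂ) * ((w - s)⁻¹ * (w - s)⁻¹))) (μ := volume)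
    (bound := fun s => |ρ s| * ((z.im / 2)⁻¹ * (z.im / 2)⁻¹))
    (x₀ := z) (s := Metric.ball z (z.im / 2)) (Metric.ball_mem_nhds z (by linarith)) ?_
    (integrable_cauchy hρ hz) ?_ ?_ (hρ.abs.mul_const _) ?_
  · have h2 := h.2.const_mul (1 / (Real.pi : ℂ))
    rw [integral_neg, mul_neg] at h2
    exact h2
  · filter_upwards [Metric.ball_mem_nhds z (by linarith : 0 < z.im / 2)] with w hw
    exact (integrable_cauchy hρ (by linarith [hball w hw])).1
  · refine (integrable_mul_bounded hρ ((continuous_inv_sub hz).mul (continuous_inv_sub hz))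
      (B := z.im⁻¹ * z.im⁻¹) fun s => ?_).neg.1
    rw [Pi.mul_apply, norm_mul]
    have := norm_inv_sub_le hz s
    gcongr
  · refine ae_of_all _ fun s w hw => ?_
    have hw' := hball w hw
    rw [norm_neg, norm_mul, norm_mul, Complex.norm_real, Real.norm_eq_abs]
    have h1 := norm_inv_sub_le (z := w) (by linarith) s
    have h2 : ‖(w - s)⁻¹‖ ≤ (z.im / 2)⁻¹ := h1.trans (inv_anti₀ (by linarith) hw'.le)
    gcongr
  · refine ae_of_all _ fun s w hw => ?_
    have hw' := hball w hw
    have hne := sub_ofReal_ne_zero (z := w) (by linarith) s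
    have h1 : HasDerivAt (fun w : ℂ => w - s) 1 w := (hasDerivAt_id w).sub_const _
    have h2 := (h1.inv hne).const_mul (ρ s : ℂ)
    simp_rw [div_eq_mul_inv]
    exact h2.congr_deriv (by rw [neg_div, one_div, sq, mul_inv]; ring)

theorem isOpen_upperHalf : IsOpen upperHalf := isOpen_lt continuous_const Complex.continuous_im

theorem analyticOnNhd_cauchyTransform (hρ : Integrable ρ) :
    AnalyticOnNhd ℂ (cauchyTransform ρ) upperHalf :=
  DifferentiableOn.analyticOnNhd (fun _ hz =>
    (hasDerivAt_cauchyTransform hρ hz).differentiableAt.differentiableWithinAt) isOpen_upperHalf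

theorem integrable_mul_poisson (hρ : Integrable ρ) {z : ℂ} (hz : 0 < z.im) :
    Integrable fun s : ℝ => ρ s * (z.im / ‖z - s‖ ^ 2) := by
  refine hρ.mul_bdd (c := z.im⁻¹) (integrable_poisson hz).1 (ae_of_all _ fun s => ?_)
  have := im_le_norm_sub_ofReal z s
  have h3 := norm_sub_ofReal_pos hz s
  rw [Real.norm_of_nonneg (by positivity), div_le_iff₀ (by positivity)]
  rw [inv_mul_eq_div, le_div_iff₀ hz]
  nlinarith

theorem im_cauchyTransform (hρ : Integrable ρ) {z : ℂ} (hz : 0 < z.im) :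
    (cauchyTransform ρ z).im = -(1 / Real.pi * ∫ s, ρ s * (z.im / ‖z - s‖ ^ 2)) := by
  have h1 : (1 / (Real.pi : ℂ)) = ((1 / Real.pi : ℝ) : ℂ) := by push_cast; rfl
  rw [cauchyTransform, h1, Complex.im_ofReal_mul]
  have h2 : (∫ s : ℝ, (ρ s : ℂ) / (z - s)).im = ∫ s : ℝ, ((ρ s : ℂ) / (z - s)).im := by
    have := integral_im (integrable_cauchy hρ hz)
    simpa using this.symm
  rw [h2, ← mul_neg, ← integral_neg]
  congr 2; ext s
  rw [div_eq_mul_inv, Complex.im_ofReal_mul, Complex.inv_im, Complex.normSq_eq_norm_sq]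
  simp; ring

variable {μ : ℝ}

theorem integrable_shift_mul_poisson (hρ : Integrable ρ) (μ : ℝ) {z : ℂ} (hz : 0 < z.im) :
    Integrable fun s : ℝ => (ρ s + μ) * (z.im / ‖z - s‖ ^ 2) := by
  simp_rw [add_mul]
  exact (integrable_mul_poisson hρ hz).add ((integrable_poisson hz).const_mul μ)

theorem integral_shift_mul_poisson (hρ : Integrable ρ) (μ : ℝ) {z : ℂ} (hz : 0 < z.im) :
    ∫ s, (ρ s + μ) * (z.im / ‖z - s‖ ^ 2) = Real.pi * (μ - (cauchyTransform ρ z).im) := by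
  simp_rw [add_mul]
  rw [integral_add (integrable_mul_poisson hρ hz) ((integrable_poisson hz).const_mul μ),
    integral_const_mul, integral_poisson hz, im_cauchyTransform hρ hz]
  rw [sub_neg_eq_add, mul_add, ← mul_assoc, mul_one_div_cancel Real.pi_pos.ne', one_mul]
  ring

/-- `μ - Im f₀` is `1/π` times the Poisson integral of `ρ + μ ≥ 0`, because the Poisson kernel has
mass `π`. -/
theorem im_cauchyTransform_le (hρ : Integrable ρ) (hlow : ∀ᵐ x, -μ ≤ ρ x) {z : ℂ}
    (hz : 0 < z.im) : (cauchyTransform ρ z).im ≤ μ := by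
  have h1 : 0 ≤ ∫ s, (ρ s + μ) * (z.im / ‖z - s‖ ^ 2) := by
    apply integral_nonneg_of_ae
    filter_upwards [hlow] with s hs
    have : 0 ≤ ρ s + μ := by linarith
    simp only [Pi.zero_apply]
    positivity
  rw [integral_shift_mul_poisson hρ μ hz] at h1
  have := nonneg_of_mul_nonneg_right h1 Real.pi_pos
  linarith

theorem integrable_mul_inv_mul_inv (hρ : Integrable ρ) {z w : ℂ} (hz : 0 < z.im) (hw : 0 < w.im) :
    Integrable fun s : ℝ => (ρ s : ℂ) * ((z - s)⁻¹ * (w - s)⁻¹) := by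
  refine integrable_mul_bounded hρ ((continuous_inv_sub hz).mul (continuous_inv_sub hw))
      (B := z.im⁻¹ * w.im⁻¹) fun s => ?_
  rw [norm_mul]
  have := norm_inv_sub_le hz s
  have := norm_inv_sub_le hw s
  gcongr

/-- This replaces the signed density `ρ` by the nonnegative one `ρ + μ` for free, although `ρ + μ`
itself is not integrable in general. -/
theorem integral_shift_mul_inv_mul_inv (hρ : Integrable ρ) (μ : ℝ) {z w : ℂ} (hz : 0 < z.im)
    (hw : 0 < w.im) :
    ∫ s : ℝ, ((ρ s + μ : ℝ) : ℂ) * ((z - s)⁻¹ * (w - s)⁻¹)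
      = ∫ s : ℝ, (ρ s : ℂ) * ((z - s)⁻¹ * (w - s)⁻¹) := by
  have : ∀ s : ℝ, ((ρ s + μ : ℝ) : ℂ) * ((z - s)⁻¹ * (w - s)⁻¹) =
    (ρ s : ℂ) * ((z - s)⁻¹ * (w - s)⁻¹) + μ * ((z - s)⁻¹ * (w - s)⁻¹) := fun s => by
      push_cast; ring
  simp_rw [this]
  have hi : Integrable fun s : ℝ => (μ : ℂ) * ((z - s)⁻¹ * (w - s)⁻¹) :=
    ((memLp_two_inv_sub hz).integrable_mul (memLp_two_inv_sub hw)).const_mul (μ : ℂ)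
  rw [integral_add (integrable_mul_inv_mul_inv hρ hz hw) hi,
    integral_const_mul, integral_inv_mul_inv_eq_zero hz hw]
  simp

/-- The Cauchy-Schwarz inequality for integrals of real functions. -/
theorem integral_mul_sq_le {α : Type*} [MeasurableSpace α] {m : Measure α} {f g : α → ℝ}
    (hf : MemLp f 2 m) (hg : MemLp g 2 m) :
    (∫ x, ‖f x‖ * ‖g x‖ ∂m) ^ 2 ≤ (∫ x, f x ^ 2 ∂m) * ∫ x, g x ^ 2 ∂m := by
  have h := integral_mul_norm_le_Lp_mul_Lq (μ := m) (f := f) (g := g) (p := 2) (q := 2)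
    (by constructor <;> norm_num) (by simpa using hf) (by simpa using hg)
  have h0 : 0 ≤ ∫ x, ‖f x‖ * ‖g x‖ ∂m := integral_nonneg fun x => by positivity
  have h2 := pow_le_pow_left₀ h0 h 2
  refine h2.trans (le_of_eq ?_)
  have e : ∀ A : ℝ, 0 ≤ A → (A ^ (1 / 2 : ℝ)) ^ 2 = A := fun A hA => by
    rw [← Real.rpow_natCast, ← Real.rpow_mul hA]; norm_num
  have hn : ∀ f : α → ℝ, ∫ x, ‖f x‖ ^ (2:ℝ) ∂m = ∫ x, f x ^ 2 ∂m := fun f => by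
    congr 1; ext x
    rw [Real.rpow_two, Real.norm_eq_abs, sq_abs]
  rw [mul_pow, hn, hn, e _ (integral_nonneg fun x => by positivity),
    e _ (integral_nonneg fun x => by positivity)]

/-- Cauchy-Schwarz for the nonnegative measure `(ρ + μ) ds`, applied to `√(Im z)/|z - s|` and `√(Im
w)/|w - s|`. The squares of these are Poisson kernels, whose integrals are `π (μ - Im f₀)`. -/
theorem norm_integral_shift_sq_le (hρ : Integrable ρ) (hlow : ∀ᵐ x, -μ ≤ ρ x) {z w : ℂ}
    (hz : 0 < z.im) (hw : 0 < w.im) :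
    ‖∫ s : ℝ, (ρ s : ℂ) * ((z - s)⁻¹ * (w - s)⁻¹)‖ ^ 2 * (z.im * w.im) ≤
      Real.pi ^ 2 * ((μ - (cauchyTransform ρ z).im) * (μ - (cauchyTransform ρ w).im)) := by
  have hmeas : AEStronglyMeasurable (fun s => √(ρ s + μ)) volume :=
    (Real.continuous_sqrt.comp_aestronglyMeasurable (hρ.1.add aestronglyMeasurable_const))
  have hsq : ∀ {z : ℂ}, 0 < z.im → ∀ s, (√(ρ s + μ) * (√z.im / ‖z - s‖)) ^ 2 =
      (√(ρ s + μ)) ^ 2 * (z.im / ‖z - s‖ ^ 2) := fun {z} hz s => by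
    rw [mul_pow, div_pow, Real.sq_sqrt hz.le]
  have hae : ∀ {z : ℂ}, 0 < z.im → (fun s : ℝ => (√(ρ s + μ) * (√z.im / ‖z - s‖)) ^ 2) =ᵐ[volume]
      fun s => (ρ s + μ) * (z.im / ‖z - s‖ ^ 2) := fun {z} hz => by
    filter_upwards [hlow] with s hs
    rw [hsq hz, Real.sq_sqrt (by linarith)]
  have hmem : ∀ {z : ℂ}, 0 < z.im → MemLp (fun s : ℝ => √(ρ s + μ) * (√z.im / ‖z - s‖)) 2 :=
    fun {z} hz => by
    rw [memLp_two_iff_integrable_sq]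
    · exact (integrable_shift_mul_poisson hρ μ hz).congr (hae hz).symm
    · refine hmeas.mul (Continuous.aestronglyMeasurable ?_)
      exact continuous_const.div (by fun_prop) fun s => (norm_sub_ofReal_pos hz s).ne'
  have hcs := integral_mul_sq_le (hmem hz) (hmem hw)
  rw [integral_congr_ae (hae hz), integral_congr_ae (hae hw), integral_shift_mul_poisson hρ μ hz,
    integral_shift_mul_poisson hρ μ hw] at hcs
  have hle : ‖∫ s : ℝ, (ρ s : ℂ) * ((z - s)⁻¹ * (w - s)⁻¹)‖ * (√z.im * √w.im) ≤
      ∫ s, ‖√(ρ s + μ) * (√z.im / ‖z - s‖)‖ * ‖√(ρ s + μ) * (√w.im / ‖w - s‖)‖ := by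
    rw [← integral_shift_mul_inv_mul_inv hρ μ hz hw]
    refine (mul_le_mul_of_nonneg_right (norm_integral_le_integral_norm _) (by positivity)).trans ?_
    rw [← integral_mul_const]
    apply le_of_eq
    apply integral_congr_ae
    filter_upwards [hlow] with s hs
    have h0 : 0 ≤ ρ s + μ := by linarith
    rw [norm_mul, norm_mul, norm_inv, norm_inv, Complex.norm_real, Real.norm_of_nonneg h0,
      Real.norm_of_nonneg (by positivity), Real.norm_of_nonneg (by positivity)]
    nth_rw 1 [← Real.sq_sqrt h0]
    field_simp
  have h3 := pow_le_pow_left₀ (by positivity) hle 2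
  rw [mul_pow, mul_pow, Real.sq_sqrt hz.le, Real.sq_sqrt hw.le] at h3
  refine h3.trans (hcs.trans (le_of_eq (by ring)))

theorem cauchyTransform_sub (hρ : Integrable ρ) {z w : ℂ} (hz : 0 < z.im) (hw : 0 < w.im) :
    cauchyTransform ρ z - cauchyTransform ρ w =
      -(z - w) * (1 / (Real.pi : ℂ) * ∫ s : ℝ, (ρ s : ℂ) * ((z - s)⁻¹ * (w - s)⁻¹)) := by
  rw [cauchyTransform, cauchyTransform, ← mul_sub,
    ← integral_sub (integrable_cauchy hρ hz) (integrable_cauchy hρ hw), mul_left_comm,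
    ← integral_const_mul (-(z - w))]
  congr 1
  refine integral_congr_ae (ae_of_all _ fun s => ?_)
  simp only
  have h1 := sub_ofReal_ne_zero hz s
  have h2 := sub_ofReal_ne_zero hw s
  field_simp
  ring

/-- The Schwarz-Pick inequality for `f₀ - iμ`, which maps the upper half-plane into the closed lower
one: the difference quotient of `f₀` is the integral bounded by Cauchy-Schwarz. -/
theorem norm_cauchyTransform_sub_sq_le (hρ : Integrable ρ) (hlow : ∀ᵐ x, -μ ≤ ρ x) {z w : ℂ}
    (hz : 0 < z.im) (hw : 0 < w.im) :
    ‖cauchyTransform ρ z - cauchyTransform ρ w‖ ^ 2 * (z.im * w.im) ≤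
      ‖z - w‖ ^ 2 * ((μ - (cauchyTransform ρ z).im) * (μ - (cauchyTransform ρ w).im)) := by
  have h := norm_integral_shift_sq_le hρ hlow hz hw
  rw [cauchyTransform_sub hρ hz hw, norm_mul, norm_mul, norm_neg, norm_div, norm_one,
    Complex.norm_real, Real.norm_of_nonneg Real.pi_pos.le, mul_pow, mul_pow, mul_assoc]
  have hp := Real.pi_pos
  refine mul_le_mul_of_nonneg_left ?_ (by positivity)
  rw [mul_assoc, one_div, inv_pow, inv_mul_le_iff₀ (by positivity)]
  exact h

/-- The infinitesimal form: the same Cauchy-Schwarz estimate on the diagonal `w = z`. -/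
theorem norm_cauchyDeriv_mul_im_le (hρ : Integrable ρ) (hlow : ∀ᵐ x, -μ ≤ ρ x) {z : ℂ}
    (hz : 0 < z.im) : ‖cauchyDeriv ρ z‖ * z.im ≤ μ - (cauchyTransform ρ z).im := by
  have h := norm_integral_shift_sq_le hρ hlow hz hz
  have hq : 0 ≤ μ - (cauchyTransform ρ z).im := by linarith [im_cauchyTransform_le hρ hlow hz]
  have hp := Real.pi_pos
  rw [cauchyDeriv, norm_neg, norm_mul, norm_div, norm_one, Complex.norm_real,
    Real.norm_of_nonneg hp.le, mul_assoc, one_div, inv_mul_le_iff₀ hp]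
  refine le_of_sq_le_sq ?_ (by positivity)
  rw [mul_pow, mul_pow]
  calc _ = _ := by ring
    _ ≤ _ := h
    _ = _ := by ring

end CauchyTransform

/-! ### The equation `w = ζ - a f₀(w)` for the foot of a characteristic -/

section Characteristics

variable {ρ : ℝ → ℝ} {μ : ℝ}

/-- Let `δ = Im ζ - aμ > 0`. At a root, `a (μ - Im f₀(z)) = Im z - δ`. Multiplied by `a²`, the
Schwarz-Pick inequality for two roots reads `|z - w|² Im z Im w ≤ |z - w|² (Im z - δ)(Im w - δ)`,
which forces `z = w`. -/
theorem root_unique (hρ : Integrable ρ) (hlow : ∀ᵐ x, -μ ≤ ρ x) {ζ : ℂ} {a : ℝ} (ha : 0 ≤ a)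
    (hζ : a * μ < ζ.im) {z w : ℂ} (hz : 0 < z.im) (hw : 0 < w.im)
    (hz' : z = ζ - a * cauchyTransform ρ z) (hw' : w = ζ - a * cauchyTransform ρ w) : z = w := by
  have h := norm_cauchyTransform_sub_sq_le hρ hlow hz hw
  have e1 : a * (μ - (cauchyTransform ρ z).im) = z.im - (ζ.im - a * μ) := by
    have := congrArg Complex.im hz'
    simp at this
    linarith
  have e2 : a * (μ - (cauchyTransform ρ w).im) = w.im - (ζ.im - a * μ) := by
    have := congrArg Complex.im hw'
    simp at this
    linarith
  have e3 : ‖z - w‖ ^ 2 = a ^ 2 * ‖cauchyTransform ρ z - cauchyTransform ρ w‖ ^ 2 := by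
    have : z - w = -(a * (cauchyTransform ρ z - cauchyTransform ρ w)) := by
      linear_combination hz' - hw'
    rw [this, norm_neg, norm_mul, mul_pow, Complex.norm_real, Real.norm_of_nonneg ha]
  set δ := ζ.im - a * μ with hδ
  have hδ0 : 0 < δ := by linarith
  have h1 : ‖z - w‖ ^ 2 * (z.im * w.im) ≤ ‖z - w‖ ^ 2 * ((z.im - δ) * (w.im - δ)) := by
    rw [← e1, ← e2]
    nth_rw 1 [e3]
    calc _ = a ^ 2 * (‖cauchyTransform ρ z - cauchyTransform ρ w‖ ^ 2 * (z.im * w.im)) := by ring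
      _ ≤ a ^ 2 * _ := mul_le_mul_of_nonneg_left h (by positivity)
      _ = _ := by ring
  have q1 := im_cauchyTransform_le hρ hlow hz
  have q2 := im_cauchyTransform_le hρ hlow hw
  have p1 : 0 ≤ z.im - δ := by rw [← e1]; apply mul_nonneg ha; linarith
  have p2 : 0 ≤ w.im - δ := by rw [← e2]; apply mul_nonneg ha; linarith
  by_contra hne
  have hpos : 0 < ‖z - w‖ ^ 2 := by
    have : 0 < ‖z - w‖ := norm_pos_iff.mpr (sub_ne_zero.mpr hne)
    positivity
  have := le_of_mul_le_mul_left h1 hpos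
  nlinarith

/-- Picard iteration from `ζ`. The iterates stay in a strip `δ ≤ Im ≤ Y`, where `Im z - δ ≤ (1 -
δ/Y) Im z`. By the Schwarz-Pick inequality, `|uₙ₊₁ - uₙ|² / (Im uₙ Im uₙ₊₁)` therefore decreases
geometrically, and on the strip this quantity controls the Euclidean distance. -/
theorem root_exists (hρ : Integrable ρ) (hlow : ∀ᵐ x, -μ ≤ ρ x) (hμ : 0 ≤ μ) {ζ : ℂ} {a : ℝ}
    (ha : 0 ≤ a) (hζ : a * μ < ζ.im) :
    ∃ z : ℂ, 0 < z.im ∧ z = ζ - a * cauchyTransform ρ z := by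
  set δ := ζ.im - a * μ with hδ
  have hδ0 : 0 < δ := by linarith
  set F : ℂ → ℂ := fun z => ζ - a * cauchyTransform ρ z with hF
  have hFim : ∀ z, (F z).im = δ + a * (μ - (cauchyTransform ρ z).im) := fun z => by
    simp [hF, hδ]; ring
  have hFge : ∀ z, 0 < z.im → δ ≤ (F z).im := fun z hz => by
    rw [hFim]
    have := im_cauchyTransform_le hρ hlow hz
    nlinarith
  -- On `δ ≤ Im z` one has `|f₀| ≤ ‖ρ‖₁/(πδ)`, so `Y` bounds the imaginary part after one step of
  -- the iteration.
  set Y : ℝ := ‖ζ‖ + a * (1 / Real.pi * (∫ s, |ρ s|) / δ) with hY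
  have hB0 : 0 ≤ 1 / Real.pi * (∫ s, |ρ s|) :=
    mul_nonneg (by positivity) (integral_nonneg fun s => abs_nonneg _)
  have hFle : ∀ z, δ ≤ z.im → (F z).im ≤ Y := fun z hz => by
    have h1 := norm_cauchyTransform_le hρ (hδ0.trans_le hz)
    have h2 : 1 / Real.pi * (∫ s, |ρ s|) / z.im ≤ 1 / Real.pi * (∫ s, |ρ s|) / δ := by gcongr
    calc (F z).im ≤ ‖F z‖ := Complex.im_le_norm _
      _ ≤ ‖ζ‖ + ‖(a : ℂ) * cauchyTransform ρ z‖ := norm_sub_le _ _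
      _ ≤ Y := by
        rw [norm_mul, Complex.norm_real, Real.norm_of_nonneg ha, hY]
        gcongr
        exact h1.trans h2
  set u : ℕ → ℂ := fun n => F^[n] ζ with hu
  have hus : ∀ n, u (n + 1) = F (u n) := fun n => Function.iterate_succ_apply' F n ζ
  have hδζ : δ ≤ ζ.im := by have := mul_nonneg ha hμ; linarith
  have huge : ∀ n, δ ≤ (u n).im := by
    intro n
    induction n with
    | zero => simpa [hu] using hδζ
    | succ n ih => rw [hus]; exact hFge _ (by linarith)
  have hYζ : ζ.im ≤ Y := by
    have h1 := Complex.im_le_norm ζ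
    have : 0 ≤ a * (1 / Real.pi * (∫ s, |ρ s|) / δ) := by positivity
    linarith
  have hule : ∀ n, (u n).im ≤ Y := by
    intro n
    cases n with
    | zero => simpa [hu] using hYζ
    | succ n => rw [hus]; exact hFle _ (huge n)
  have hδY : δ ≤ Y := hδζ.trans hYζ
  have hY0 : 0 < Y := by linarith
  set r : ℝ := 1 - δ / Y with hr
  have hr0 : 0 ≤ r := by
    have : δ / Y ≤ 1 := (div_le_one hY0).mpr hδY
    linarith
  have hr1 : r < 1 := by
    have : 0 < δ / Y := by positivity
    linarith
  set d : ℕ → ℝ := fun n => ‖u (n + 1) - u n‖ ^ 2 / ((u n).im * (u (n + 1)).im) with hd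
  have hstep : ∀ n, d (n + 1) ≤ r ^ 2 * d n := by
    intro n
    have p0 := hδ0.trans_le (huge n)
    have p1 := hδ0.trans_le (huge (n + 1))
    have p2 := hδ0.trans_le (huge (n + 2))
    have h := norm_cauchyTransform_sub_sq_le hρ hlow p1 p0
    have i1 : a * (μ - (cauchyTransform ρ (u n)).im) = (u (n + 1)).im - δ := by
      rw [hus n, hFim]; ring
    have i2 : a * (μ - (cauchyTransform ρ (u (n + 1))).im) = (u (n + 2)).im - δ := by
      rw [hus (n + 1), hFim]; ring
    have i3 : ‖u (n + 2) - u (n + 1)‖ ^ 2 =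
        a ^ 2 * ‖cauchyTransform ρ (u (n + 1)) - cauchyTransform ρ (u n)‖ ^ 2 := by
      have : u (n + 2) - u (n + 1) =
          -(a * (cauchyTransform ρ (u (n + 1)) - cauchyTransform ρ (u n))) := by
        rw [hus (n + 1)]; nth_rw 2 [hus n]; simp only [hF]; ring
      rw [this, norm_neg, norm_mul, mul_pow, Complex.norm_real, Real.norm_of_nonneg ha]
    have h1 : ‖u (n + 2) - u (n + 1)‖ ^ 2 * ((u (n + 1)).im * (u n).im) ≤
        ‖u (n + 1) - u n‖ ^ 2 * (((u (n + 2)).im - δ) * ((u (n + 1)).im - δ)) := by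
      rw [← i1, ← i2, i3]
      calc _ = a ^ 2 * (‖cauchyTransform ρ (u (n + 1)) - cauchyTransform ρ (u n)‖ ^ 2 *
            ((u (n + 1)).im * (u n).im)) := by ring
        _ ≤ a ^ 2 * _ := mul_le_mul_of_nonneg_left h (by positivity)
        _ = _ := by ring
    have hry : ∀ k, (u k).im - δ ≤ r * (u k).im := fun k => by
      have : δ / Y * (u k).im ≤ δ := by
        rw [div_mul_eq_mul_div, div_le_iff₀ hY0]
        exact mul_le_mul_of_nonneg_left (hule k) hδ0.le
      rw [hr]; linarith
    have h2 : ((u (n + 2)).im - δ) * ((u (n + 1)).im - δ) ≤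
        (r * (u (n + 2)).im) * (r * (u (n + 1)).im) :=
      mul_le_mul (hry _) (hry _) (by linarith [huge (n + 1)]) (by positivity)
    simp only [hd]
    rw [mul_div_assoc', div_le_div_iff₀ (by positivity) (by positivity)]
    have h3 := h1.trans (mul_le_mul_of_nonneg_left h2 (by positivity))
    have h4 := mul_le_mul_of_nonneg_right h3 p1.le
    calc _ = ‖u (n + 2) - u (n + 1)‖ ^ 2 * ((u (n + 1)).im * (u n).im) := by
          rw [mul_comm (u n).im]
      _ ≤ _ := h3
      _ = _ := by ring
  have hdn : ∀ n, d n ≤ (r ^ n) ^ 2 * d 0 := by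
    intro n
    induction n with
    | zero => simp
    | succ n ih =>
      refine (hstep n).trans ((mul_le_mul_of_nonneg_left ih (by positivity)).trans (le_of_eq ?_))
      ring
  have hd0 : 0 ≤ d 0 := by
    have p0 := hδ0.trans_le (huge 0)
    have p1 := hδ0.trans_le (huge 1)
    simp only [hd]; positivity
  have hdist : ∀ n, dist (u n) (u (n + 1)) ≤ (Y * √(d 0)) * r ^ n := by
    intro n
    have p0 := hδ0.trans_le (huge n)
    have p1 := hδ0.trans_le (huge (n + 1))
    rw [dist_comm, dist_eq_norm]
    refine le_of_sq_le_sq ?_ (by positivity)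
    have h1 := hdn n
    simp only [hd] at h1
    rw [div_le_iff₀ (by positivity)] at h1
    refine h1.trans ?_
    rw [mul_pow, mul_pow, Real.sq_sqrt hd0]
    have : (u n).im * (u (n + 1)).im ≤ Y ^ 2 := by
      rw [sq]; exact mul_le_mul (hule n) (hule _) p1.le hY0.le
    calc _ ≤ (r ^ n) ^ 2 * d 0 * Y ^ 2 := mul_le_mul_of_nonneg_left this (by positivity)
      _ = _ := by ring
  have hc := cauchySeq_of_le_geometric r _ hr1 hdist
  obtain ⟨w, hw⟩ := cauchySeq_tendsto_of_complete hc
  have hwim : δ ≤ w.im := ge_of_tendsto' ((Complex.continuous_im.tendsto w).comp hw) huge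
  have hw0 : 0 < w.im := by linarith
  refine ⟨w, hw0, ?_⟩
  have hcont : Tendsto (fun n => F (u n)) atTop (𝓝 (F w)) := by
    have : ContinuousAt F w := by
      have := (hasDerivAt_cauchyTransform hρ hw0).continuousAt
      exact continuousAt_const.sub (continuousAt_const.mul this)
    exact this.tendsto.comp hw
  refine tendsto_nhds_unique ((tendsto_add_atTop_iff_nat 1).mpr hw) ?_
  exact hcont.congr fun n => (hus n).symm

open Classical in
/-- The solution `w` in the upper half-plane of `w = ζ - a f₀(w)`. -/
noncomputable def root (ρ : ℝ → ℝ) (ζ : ℂ) (a : ℝ) : ℂ :=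
  if h : ∃ z : ℂ, 0 < z.im ∧ z = ζ - a * cauchyTransform ρ z then h.choose else 0

theorem root_spec (hρ : Integrable ρ) (hlow : ∀ᵐ x, -μ ≤ ρ x) (hμ : 0 ≤ μ) {ζ : ℂ} {a : ℝ}
    (ha : 0 ≤ a) (hζ : a * μ < ζ.im) :
    0 < (root ρ ζ a).im ∧ root ρ ζ a = ζ - a * cauchyTransform ρ (root ρ ζ a) := by
  have h := root_exists hρ hlow hμ ha hζ
  rw [root, dif_pos h]
  exact h.choose_spec

theorem root_eq (hρ : Integrable ρ) (hlow : ∀ᵐ x, -μ ≤ ρ x) (hμ : 0 ≤ μ) {ζ : ℂ} {a : ℝ}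
    (ha : 0 ≤ a) (hζ : a * μ < ζ.im) {z : ℂ} (hz : 0 < z.im)
    (hz' : z = ζ - a * cauchyTransform ρ z) : root ρ ζ a = z :=
  root_unique hρ hlow ha hζ (root_spec hρ hlow hμ ha hζ).1 hz (root_spec hρ hlow hμ ha hζ).2 hz'

theorem im_root_ge (hρ : Integrable ρ) (hlow : ∀ᵐ x, -μ ≤ ρ x) (hμ : 0 ≤ μ) {ζ : ℂ} {a : ℝ}
    (ha : 0 ≤ a) (hζ : a * μ < ζ.im) : ζ.im - a * μ ≤ (root ρ ζ a).im := by
  obtain ⟨h1, h2⟩ := root_spec hρ hlow hμ ha hζ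
  have h3 := im_cauchyTransform_le hρ hlow h1
  have := congrArg Complex.im h2
  simp at this
  nlinarith

/-- The infinitesimal Schwarz-Pick inequality with its right-hand side rewritten by the root
equation. It shows `|a f₀'| < 1` at the root, with a quantitative gap, so that the equation is
nondegenerate there. -/
theorem mul_norm_cauchyDeriv_root_le (hρ : Integrable ρ) (hlow : ∀ᵐ x, -μ ≤ ρ x) (hμ : 0 ≤ μ)
    {ζ : ℂ} {a : ℝ} (ha : 0 ≤ a) (hζ : a * μ < ζ.im) :
    ‖a * cauchyDeriv ρ (root ρ ζ a)‖ * (root ρ ζ a).im ≤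
      (root ρ ζ a).im - (ζ.im - a * μ) := by
  obtain ⟨h1, h2⟩ := root_spec hρ hlow hμ ha hζ
  have h3 := norm_cauchyDeriv_mul_im_le hρ hlow h1
  have h4 := congrArg Complex.im h2
  simp at h4
  rw [norm_mul, Complex.norm_real, Real.norm_of_nonneg ha, mul_assoc]
  have := mul_le_mul_of_nonneg_left h3 ha
  linarith

theorem norm_one_add_ge (hρ : Integrable ρ) (hlow : ∀ᵐ x, -μ ≤ ρ x) (hμ : 0 ≤ μ)
    {ζ : ℂ} {a : ℝ} (ha : 0 ≤ a) (hζ : a * μ < ζ.im) :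
    (ζ.im - a * μ) / (root ρ ζ a).im ≤ ‖1 + a * cauchyDeriv ρ (root ρ ζ a)‖ := by
  have h1 := (root_spec hρ hlow hμ ha hζ).1
  have h2 := mul_norm_cauchyDeriv_root_le hρ hlow hμ ha hζ
  have h3 := norm_sub_norm_le (1 : ℂ) (-(a * cauchyDeriv ρ (root ρ ζ a)))
  rw [norm_one, norm_neg, sub_neg_eq_add] at h3
  refine le_trans ?_ h3
  rw [div_le_iff₀ h1]
  linarith

theorem one_add_ne_zero (hρ : Integrable ρ) (hlow : ∀ᵐ x, -μ ≤ ρ x) (hμ : 0 ≤ μ)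
    {ζ : ℂ} {a : ℝ} (ha : 0 ≤ a) (hζ : a * μ < ζ.im) :
    1 + a * cauchyDeriv ρ (root ρ ζ a) ≠ 0 := by
  have h1 := (root_spec hρ hlow hμ ha hζ).1
  have h := norm_one_add_ge hρ hlow hμ ha hζ
  have : 0 < (ζ.im - a * μ) / (root ρ ζ a).im := div_pos (by linarith) h1
  exact norm_pos_iff.mp (this.trans_le h)

/-- The implicit function theorem for `w - ζ + a f₀(w)`, with `a` made complex. The implicit
function stays in the upper half-plane near the base point, so uniqueness of the root identifies it
with `root`; this is available only for real `b ≥ 0`. -/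
theorem root_analytic (hρ : Integrable ρ) (hlow : ∀ᵐ x, -μ ≤ ρ x) (hμ : 0 ≤ μ)
    {ζ : ℂ} {a : ℝ} (ha : 0 ≤ a) (hζ : a * μ < ζ.im) :
    ∃ Ψ : ℂ × ℂ → ℂ, AnalyticAt ℂ Ψ (ζ, (a : ℂ)) ∧ Ψ (ζ, (a : ℂ)) = root ρ ζ a ∧
      ∀ᶠ p in 𝓝 (ζ, (a : ℂ)), ∀ b : ℝ, 0 ≤ b → (b : ℂ) = p.2 → root ρ p.1 b = Ψ p := by
  obtain ⟨hw, hroot⟩ := root_spec hρ hlow hμ ha hζ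
  set w := root ρ ζ a with hwdef
  set f : (ℂ × ℂ) × ℂ → ℂ := fun q => q.2 - q.1.1 + q.1.2 * cauchyTransform ρ q.2 with hf
  have hC : AnalyticAt ℂ (cauchyTransform ρ) w := analyticOnNhd_cauchyTransform hρ w hw
  have hfan : AnalyticAt ℂ f ((ζ, (a : ℂ)), w) := by
    have h1 : AnalyticAt ℂ (fun q : (ℂ × ℂ) × ℂ => cauchyTransform ρ q.2) ((ζ, (a : ℂ)), w) :=
      AnalyticAt.fun_comp (g := cauchyTransform ρ) hC analyticAt_snd
    have h2 : AnalyticAt ℂ (fun q : (ℂ × ℂ) × ℂ => q.1.2) ((ζ, (a : ℂ)), w) :=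
      AnalyticAt.fun_comp analyticAt_snd analyticAt_fst
    have h3 : AnalyticAt ℂ (fun q : (ℂ × ℂ) × ℂ => q.1.1) ((ζ, (a : ℂ)), w) :=
      AnalyticAt.fun_comp analyticAt_fst analyticAt_fst
    exact (analyticAt_snd.sub h3).add (h2.mul h1)
  have hcd : ContDiffAt ℂ ω f ((ζ, (a : ℂ)), w) := hfan.contDiffAt
  have hpart : (fderiv ℂ f ((ζ, (a : ℂ)), w) ∘L .inr ℂ (ℂ × ℂ) ℂ) =
      ContinuousLinearMap.toSpanSingleton ℂ (1 + a * cauchyDeriv ρ w) := by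
    have h1 : HasFDerivAt (fun v : ℂ => f ((ζ, (a : ℂ)), v))
        (fderiv ℂ f ((ζ, (a : ℂ)), w) ∘L .inr ℂ (ℂ × ℂ) ℂ) w :=
      HasFDerivAt.comp (g := f) w hfan.differentiableAt.hasFDerivAt (hasFDerivAt_prodMk_right _ _)
    have h2 : HasDerivAt (fun v : ℂ => f ((ζ, (a : ℂ)), v)) (1 + a * cauchyDeriv ρ w) w :=
      ((hasDerivAt_id w).sub_const ζ).add ((hasDerivAt_cauchyTransform hρ hw).const_mul (a : ℂ))
    exact h1.unique h2.hasFDerivAt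
  have hinv : (fderiv ℂ f ((ζ, (a : ℂ)), w) ∘L .inr ℂ (ℂ × ℂ) ℂ).IsInvertible := by
    rw [hpart]
    refine ⟨ContinuousLinearEquiv.unitsEquivAut ℂ
      (Units.mk0 _ (one_add_ne_zero hρ hlow hμ ha hζ)), ?_⟩
    ext
    simp [hwdef]
  have hn : (ω : WithTop ℕ∞) ≠ 0 := by simp
  set Ψ := hcd.implicitFunction hn hinv with hΨ
  have hΨan : AnalyticAt ℂ Ψ (ζ, (a : ℂ)) :=
    (hcd.contDiffAt_implicitFunction hn hinv).analyticAt
  have hΨ0 : Ψ (ζ, (a : ℂ)) = w := hcd.implicitFunction_apply_self hn hinv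
  have hf0 : f ((ζ, (a : ℂ)), w) = 0 := by
    simp only [hf]; linear_combination hroot
  refine ⟨Ψ, hΨan, hΨ0, ?_⟩
  have ev1 := hcd.eventually_apply_implicitFunction hn hinv
  have ev2 : ∀ᶠ p in 𝓝 (ζ, (a : ℂ)), 0 < (Ψ p).im := by
    have : ContinuousAt (fun p => (Ψ p).im) (ζ, (a : ℂ)) :=
      Complex.continuous_im.continuousAt.comp hΨan.continuousAt
    exact this.eventually (lt_mem_nhds (by simpa only [hΨ0] using hw))
  have ev3 : ∀ᶠ p in 𝓝 (ζ, (a : ℂ)), p.2.re * μ < p.1.im := by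
    have h1 : ContinuousAt (fun p : ℂ × ℂ => p.1.im - p.2.re * μ) (ζ, (a : ℂ)) := by
      fun_prop
    filter_upwards [h1.eventually (lt_mem_nhds (by simpa using hζ : 0 < ζ.im - (a : ℂ).re * μ))]
      with p hp
    linarith
  filter_upwards [ev1, ev2, ev3] with p h1 h2 h3 b hb hbp
  rw [hf0] at h1
  refine root_eq hρ hlow hμ hb (by rw [← hbp] at h3; simpa using h3) h2 ?_
  have h1' : Ψ p - p.1 + p.2 * cauchyTransform ρ (Ψ p) = 0 := h1
  rw [hbp]
  linear_combination h1'

end Characteristics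

/-! ### Joint analyticity in complexified time and space -/

section AnalyticExtension

/-- Near `(t, z)`, the function `h` of a real and a complex variable is the restriction of an
analytic function of two complex variables. -/
def HasAnalyticExt (h : ℝ → ℂ → ℂ) (t : ℝ) (z : ℂ) : Prop :=
  ∃ G : ℂ × ℂ → ℂ, AnalyticAt ℂ G ((t : ℂ), z) ∧
    ∀ᶠ p : ℝ × ℂ in 𝓝 (t, z), h p.1 p.2 = G ((p.1 : ℂ), p.2)

variable {h : ℝ → ℂ → ℂ} {t : ℝ} {z : ℂ}

theorem continuous_ofReal_prod : Continuous fun p : ℝ × ℂ => ((p.1 : ℂ), p.2) := by fun_prop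

theorem HasAnalyticExt.analyticAt (H : HasAnalyticExt h t z) : AnalyticAt ℂ (h t) z := by
  obtain ⟨G, hG, hev⟩ := H
  have h1 : AnalyticAt ℂ (fun w : ℂ => G ((t : ℂ), w)) z :=
    AnalyticAt.fun_comp (g := G) hG (analyticAt_const.prod analyticAt_id)
  refine h1.congr ?_
  have : Tendsto (fun w : ℂ => (t, w)) (𝓝 z) (𝓝 (t, z)) := by
    exact (Continuous.prodMk_right t).tendsto z
  filter_upwards [this.eventually hev] with w hw
  exact hw.symm

theorem HasAnalyticExt.contDiffAt (H : HasAnalyticExt h t z) (n : WithTop ℕ∞) :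
    ContDiffAt ℝ n (fun p : ℝ × ℂ => h p.1 p.2) (t, z) := by
  obtain ⟨G, hG, hev⟩ := H
  have h1 : ContDiffAt ℝ n G ((t : ℂ), z) := hG.contDiffAt.restrict_scalars ℝ
  have h2 : ContDiffAt ℝ n (fun p : ℝ × ℂ => ((p.1 : ℂ), p.2)) (t, z) := by
    refine ContDiffAt.prodMk ?_ contDiffAt_snd
    exact Complex.ofRealCLM.contDiff.contDiffAt.comp _ contDiffAt_fst
  exact (h1.comp (t, z) h2).congr_of_eventuallyEq hev

theorem HasAnalyticExt.contDiffAt_fst (H : HasAnalyticExt h t z) (n : WithTop ℕ∞) :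
    ContDiffAt ℝ n (fun τ => h τ z) t :=
  (H.contDiffAt n).comp t (f := fun τ : ℝ => (τ, z)) (contDiffAt_id.prodMk contDiffAt_const)

/-- The time derivative is the restriction of the partial derivative of the extension in its first
complex variable. Stability of the property under `∂ₜ` makes every `∂ₜᵏ` holomorphic in `z`. -/
theorem HasAnalyticExt.deriv (H : HasAnalyticExt h t z) :
    HasAnalyticExt (fun τ w => deriv (fun τ' => h τ' w) τ) t z := by
  obtain ⟨G, hG, hev⟩ := H
  refine ⟨fun p => fderiv ℂ G p (1, 0), ?_, ?_⟩
  · exact (ContinuousLinearMap.apply ℂ ℂ ((1, 0) : ℂ × ℂ)).analyticAt _ |>.comp hG.fderiv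
  · have hGev : ∀ᶠ p : ℝ × ℂ in 𝓝 (t, z), AnalyticAt ℂ G ((p.1 : ℂ), p.2) :=
      (continuous_ofReal_prod.tendsto (t, z)).eventually hG.eventually_analyticAt
    filter_upwards [hev.eventually_nhds, hGev] with p hp hpG
    have hd : HasDerivAt (fun τ : ℝ => G ((τ : ℂ), p.2)) (fderiv ℂ G ((p.1 : ℂ), p.2) (1, 0))
        p.1 := by
      have h1 : HasDerivAt (fun τ : ℂ => G (τ, p.2)) (fderiv ℂ G ((p.1 : ℂ), p.2) (1, 0))
          (p.1 : ℂ) := by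
        exact HasFDerivAt.comp_hasDerivAt (p.1 : ℂ) hpG.differentiableAt.hasFDerivAt
          ((hasDerivAt_id (p.1 : ℂ)).prodMk (hasDerivAt_const (p.1 : ℂ) p.2))
      exact h1.comp_ofReal
    have : (fun τ' => h τ' p.2) =ᶠ[𝓝 p.1] fun τ : ℝ => G ((τ : ℂ), p.2) := by
      have ht : Tendsto (fun τ : ℝ => (τ, p.2)) (𝓝 p.1) (𝓝 (p.1, p.2)) :=
        (Continuous.prodMk_left p.2).tendsto p.1
      exact ht.eventually hp
    exact (hd.congr_of_eventuallyEq this).deriv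

theorem HasAnalyticExt.iteratedDeriv (H : HasAnalyticExt h t z) (k : ℕ) :
    HasAnalyticExt (fun τ w => iteratedDeriv k (fun τ' => h τ' w) τ) t z := by
  induction k with
  | zero => simpa using H
  | succ k ih =>
    simp_rw [iteratedDeriv_succ]
    exact ih.deriv

end AnalyticExtension

/-! ### The explicit solution of the complex Burgers equation -/

section Flow

variable {ρ : ℝ → ℝ} {γ ν μ : ℝ}

/-- `(exp (2γt) - 1) / (2γ)`. -/
noncomputable def growth (γ t : ℝ) : ℝ := (Real.exp (2 * γ * t) - 1) / (2 * γ)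

/-- `ν (exp (γt) - 1) / γ`. -/
noncomputable def lift (γ ν t : ℝ) : ℝ := ν * (Real.exp (γ * t) - 1) / γ

/-- `exp (γt) z + iν (exp (γt) - 1) / γ`. -/
noncomputable def base (γ ν t : ℝ) (z : ℂ) : ℂ :=
  (Real.exp (γ * t) : ℂ) * z + Complex.I * (lift γ ν t : ℂ)

/-- The starting point of the characteristic through `(z, t)`. -/
noncomputable def foot (γ ν : ℝ) (ρ : ℝ → ℝ) (t : ℝ) (z : ℂ) : ℂ :=
  root ρ (base γ ν t z) (growth γ t)

/-- The solution `f(z, t) = g(z, t) + γ z`. -/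
noncomputable def solf (γ ν : ℝ) (ρ : ℝ → ℝ) (t : ℝ) (z : ℂ) : ℂ :=
  (Real.exp (γ * t) : ℂ) * cauchyTransform ρ (foot γ ν ρ t z)

/-- The solution of the complex Burgers equation. -/
noncomputable def solg (γ ν : ℝ) (ρ : ℝ → ℝ) (t : ℝ) (z : ℂ) : ℂ :=
  solf γ ν ρ t z - γ * z

theorem base_im (γ ν t : ℝ) (z : ℂ) :
    (base γ ν t z).im = Real.exp (γ * t) * z.im + lift γ ν t := by
  rw [base, Complex.add_im, Complex.im_ofReal_mul]; simp

theorem growth_nonneg (hγ : 0 < γ) {t : ℝ} (ht : 0 ≤ t) : 0 ≤ growth γ t := by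
  apply div_nonneg _ (by positivity)
  have : 1 ≤ Real.exp (2 * γ * t) := Real.one_le_exp (by positivity)
  linarith

theorem growth_pos (hγ : 0 < γ) {t : ℝ} (ht : 0 < t) : 0 < growth γ t := by
  apply div_pos _ (by positivity)
  have : 1 < Real.exp (2 * γ * t) := Real.one_lt_exp_iff.mpr (by positivity)
  linarith

theorem exp_two_mul (γ t : ℝ) : Real.exp (2 * γ * t) = Real.exp (γ * t) ^ 2 := by
  rw [← Real.exp_nat_mul]; congr 1; push_cast; ring

theorem growth_eq (γ t : ℝ) :
    growth γ t = (Real.exp (γ * t) - 1) * (Real.exp (γ * t) + 1) / (2 * γ) := by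
  rw [growth, exp_two_mul]; ring

/-- With `growth` factored out, `growth * μ < lift` for `t > 0` becomes `μ (exp(γt) + 1) < 2ν`; this
is the origin of the lifespan. -/
theorem lift_eq (hγ : 0 < γ) (ν t : ℝ) :
    lift γ ν t = growth γ t * (2 * ν / (Real.exp (γ * t) + 1)) := by
  have := Real.exp_pos (γ * t)
  rw [growth_eq, lift]; field_simp

theorem mul_exp_add_one_lt (hγ : 0 < γ) (hμ : 0 ≤ μ) (hμν : μ < ν) {t : ℝ} 
    (hT : (t : EReal) < lifespan γ ν μ) : μ * (Real.exp (γ * t) + 1) < 2 * ν := by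
  rcases hμ.eq_or_lt with rfl | hμ'
  · linarith
  · rw [lifespan, if_neg hμ'.ne', EReal.coe_lt_coe_iff] at hT
    have h1 : 0 < 2 * ν / μ - 1 := by
      have : 1 < ν / μ := (one_lt_div hμ').mpr hμν
      have : 2 * ν / μ = ν / μ + ν / μ := by ring
      linarith
    have h2 : γ * t < Real.log (2 * ν / μ - 1) := by
      have := mul_lt_mul_of_pos_left hT hγ
      rwa [← mul_assoc, mul_one_div_cancel hγ.ne', one_mul] at this
    have h3 := Real.exp_lt_exp.mpr h2
    rw [Real.exp_log h1] at h3
    have h4 := mul_lt_mul_of_pos_left h3 hμ'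
    have h5 : μ * (2 * ν / μ - 1) = 2 * ν - μ := by field_simp
    linarith

/-- Admissible pairs `(t, z)`. -/
def Admissible (γ ν μ t : ℝ) (z : ℂ) : Prop :=
  growth γ t * μ < (base γ ν t z).im

/-- The admissibility condition on the real axis, where `base` has imaginary part `lift`. The
positive difference is the distance by which every foot stays above the axis. -/
theorem growth_mul_lt_lift (hγ : 0 < γ) (hμ : 0 ≤ μ) (hμν : μ < ν) {t : ℝ} (ht : 0 < t)
    (hT : (t : EReal) < lifespan γ ν μ) : growth γ t * μ < lift γ ν t := by
  have h1 := mul_exp_add_one_lt hγ hμ hμν hT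
  have h2 : 0 < Real.exp (γ * t) := Real.exp_pos _
  rw [lift_eq hγ]
  apply mul_lt_mul_of_pos_left _ (growth_pos hγ ht)
  rw [lt_div_iff₀ (by linarith)]
  exact h1

theorem admissible_of_mem (hγ : 0 < γ) (hμ : 0 ≤ μ) (hμν : μ < ν) {t : ℝ}
    (ht : t ∈ times (lifespan γ ν μ)) {z : ℂ} (hz : 0 ≤ z.im) : Admissible γ ν μ t z := by
  rw [Admissible, base_im]
  have := growth_mul_lt_lift hγ hμ hμν ht.1 ht.2
  have : 0 ≤ Real.exp (γ * t) * z.im := by positivity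
  linarith

/-- At `t = 0` both `growth` and `lift` vanish and the condition is `Im z > 0`, so the initial time
is covered only over the open half-plane. -/
theorem admissible_of_upperHalf (hγ : 0 < γ) (hμ : 0 ≤ μ) (hμν : μ < ν) {t : ℝ} (ht : 0 ≤ t)
    (hT : (t : EReal) < lifespan γ ν μ) {z : ℂ} (hz : 0 < z.im) : Admissible γ ν μ t z := by
  rcases ht.eq_or_lt with rfl | ht'
  · simp [Admissible, base_im, growth, lift, hz]
  · exact admissible_of_mem hγ hμ hμν ⟨ht', hT⟩ hz.le

theorem continuous_growth (γ : ℝ) : Continuous (growth γ) := by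
  unfold growth; fun_prop

theorem continuous_base (γ ν : ℝ) : Continuous fun p : ℝ × ℂ => base γ ν p.1 p.2 := by
  unfold base lift; fun_prop

theorem hasDerivAt_growth (hγ : 0 < γ) (t : ℝ) :
    HasDerivAt (growth γ) (Real.exp (γ * t) ^ 2) t := by
  have h1 : HasDerivAt (fun t : ℝ => 2 * γ * t) (2 * γ) t := by
    simpa using (hasDerivAt_id t).const_mul (2 * γ)
  have h2 := ((h1.exp).sub_const 1).div_const (2 * γ)
  refine h2.congr_deriv ?_
  rw [exp_two_mul]; field_simp

theorem hasDerivAt_lift (hγ : 0 < γ) (ν t : ℝ) :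
    HasDerivAt (lift γ ν) (ν * Real.exp (γ * t)) t := by
  have h1 : HasDerivAt (fun t : ℝ => γ * t) γ t := by
    simpa using (hasDerivAt_id t).const_mul γ
  have h2 := (((h1.exp).sub_const 1).const_mul ν).div_const γ
  refine h2.congr_deriv ?_
  field_simp

variable (hγ : 0 < γ) (hμ : 0 ≤ μ) (hρ : Integrable ρ) (hlow : ∀ᵐ x, -μ ≤ ρ x)

section
include hγ hμ hρ hlow

theorem foot_spec {t : ℝ} (ht : 0 ≤ t) {z : ℂ} (hz : Admissible γ ν μ t z) :
    0 < (foot γ ν ρ t z).im ∧ foot γ ν ρ t z =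
      base γ ν t z - growth γ t * cauchyTransform ρ (foot γ ν ρ t z) :=
  root_spec hρ hlow hμ (growth_nonneg hγ ht) hz

/-- The case `t = 0` is included for the continuity of the solution down to the initial time. There
`foot` agrees with its extension only at times `≥ 0`, where `growth` is nonnegative. -/
theorem exists_ext_foot {t : ℝ} (ht : 0 ≤ t) {z : ℂ} (hz : Admissible γ ν μ t z) :
    ∃ G : ℂ × ℂ → ℂ, AnalyticAt ℂ G ((t : ℂ), z) ∧ G ((t : ℂ), z) = foot γ ν ρ t z ∧
    ∀ᶠ p : ℝ × ℂ in 𝓝 (t, z), 0 ≤ p.1 → foot γ ν ρ p.1 p.2 = G ((p.1 : ℂ), p.2) := by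
  obtain ⟨Ψ, hΨ, hΨ0, hev⟩ := root_analytic hρ hlow hμ (growth_nonneg hγ ht) hz
  set e : ℂ × ℂ → ℂ × ℂ := fun p =>
    (Complex.exp (γ * p.1) * p.2 + Complex.I * (ν * (Complex.exp (γ * p.1) - 1) / γ),
      (Complex.exp (2 * γ * p.1) - 1) / (2 * γ)) with he
  have hereal : ∀ (τ : ℝ) (w : ℂ), e ((τ : ℂ), w) = (base γ ν τ w, (growth γ τ : ℂ)) := by
    intro τ w
    simp only [he, base, lift, growth]
    push_cast
    rfl
  have hean : AnalyticAt ℂ e ((t : ℂ), z) := by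
    simp only [he]
    have hfst : AnalyticAt ℂ (fun p : ℂ × ℂ => p.1) ((t : ℂ), z) := analyticAt_fst
    have hsnd : AnalyticAt ℂ (fun p : ℂ × ℂ => p.2) ((t : ℂ), z) := analyticAt_snd
    fun_prop (disch := simp [hγ.ne'])
  refine ⟨fun p => Ψ (e p), AnalyticAt.fun_comp (g := Ψ) (by rw [hereal]; exact hΨ) hean, ?_, ?_⟩
  · simp only [hereal]; exact hΨ0
  · have hc : Tendsto (fun p : ℝ × ℂ => e ((p.1 : ℂ), p.2)) (𝓝 (t, z))
        (𝓝 (base γ ν t z, (growth γ t : ℂ))) := by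
      rw [← hereal]
      exact (hean.continuousAt.tendsto).comp (continuous_ofReal_prod.tendsto (t, z))
    filter_upwards [hc.eventually hev] with p hp hp0
    have := hp (growth γ p.1) (growth_nonneg hγ hp0) (by rw [hereal])
    simp only [hereal] at this ⊢
    exact this

theorem hasAnalyticExt_foot {t : ℝ} (ht : 0 < t) {z : ℂ} (hz : Admissible γ ν μ t z) :
    HasAnalyticExt (foot γ ν ρ) t z := by
  obtain ⟨G, h1, -, h2⟩ := exists_ext_foot hγ hμ hρ hlow ht.le hz
  refine ⟨G, h1, ?_⟩
  have : ∀ᶠ p : ℝ × ℂ in 𝓝 (t, z), 0 < p.1 :=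
    continuous_fst.continuousAt.eventually (lt_mem_nhds ht)
  filter_upwards [h2, this] with p hp hp0
  exact hp hp0.le

theorem hasAnalyticExt_solf {t : ℝ} (ht : 0 < t) {z : ℂ} (hz : Admissible γ ν μ t z) :
    HasAnalyticExt (solf γ ν ρ) t z := by
  obtain ⟨G, h1, h2⟩ := hasAnalyticExt_foot hγ hμ hρ hlow ht hz
  have h0 : foot γ ν ρ t z = G ((t : ℂ), z) := h2.self_of_nhds
  refine ⟨fun p => Complex.exp (γ * p.1) * cauchyTransform ρ (G p), ?_, ?_⟩
  · have h3 : AnalyticAt ℂ (cauchyTransform ρ) (G ((t : ℂ), z)) := by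
      rw [← h0]
      exact analyticOnNhd_cauchyTransform hρ _ (foot_spec hγ hμ hρ hlow ht.le hz).1
    refine AnalyticAt.mul ?_ (AnalyticAt.fun_comp (g := cauchyTransform ρ) h3 h1)
    have hfst : AnalyticAt ℂ (fun p : ℂ × ℂ => p.1) ((t : ℂ), z) := analyticAt_fst
    fun_prop
  · filter_upwards [h2] with p hp
    rw [solf, hp]; push_cast; rfl

theorem hasAnalyticExt_solg {t : ℝ} (ht : 0 < t) {z : ℂ} (hz : Admissible γ ν μ t z) :
    HasAnalyticExt (solg γ ν ρ) t z := by
  obtain ⟨G, h1, h2⟩ := hasAnalyticExt_solf hγ hμ hρ hlow ht hz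
  refine ⟨fun p => G p - γ * p.2, h1.sub (analyticAt_const.mul analyticAt_snd), ?_⟩
  filter_upwards [h2] with p hp
  rw [solg, hp]

theorem continuousWithinAt_solg {t : ℝ} (ht : 0 ≤ t) {z : ℂ} (hz : Admissible γ ν μ t z) :
    ContinuousWithinAt (fun p : ℝ × ℂ => solg γ ν ρ p.1 p.2) {p | 0 ≤ p.1} (t, z) := by
  obtain ⟨G, h1, h0, h2⟩ := exists_ext_foot hγ hμ hρ hlow ht hz
  have hC : ContinuousAt (cauchyTransform ρ) (G ((t : ℂ), z)) := by
    rw [h0]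
    exact (hasDerivAt_cauchyTransform hρ (foot_spec hγ hμ hρ hlow ht hz).1).continuousAt
  have h3 : ContinuousAt (fun p : ℝ × ℂ => (Real.exp (γ * p.1) : ℂ) *
      cauchyTransform ρ (G ((p.1 : ℂ), p.2)) - γ * p.2) (t, z) := by
    have h4 : ContinuousAt (fun p : ℝ × ℂ => G ((p.1 : ℂ), p.2)) (t, z) :=
      ContinuousAt.comp (g := G) h1.continuousAt continuous_ofReal_prod.continuousAt
    have h5 : ContinuousAt (fun p : ℝ × ℂ => cauchyTransform ρ (G ((p.1 : ℂ), p.2))) (t, z) :=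
      ContinuousAt.comp (g := cauchyTransform ρ) hC h4
    refine (ContinuousAt.mul ?_ h5).sub ?_ <;> fun_prop
  refine h3.continuousWithinAt.congr_of_eventuallyEq ?_ ?_
  · rw [EventuallyEq, eventually_nhdsWithin_iff]
    filter_upwards [h2] with p hp hp0
    simp only [solg, solf, hp hp0]
  · simp only [solg, solf, h0]

/-- Differentiability is known from the analytic extension, so differentiating the root equation
gives a linear equation for the derivative, with nonzero coefficient `1 + a f₀'`. -/
theorem hasDerivAt_foot_snd {t : ℝ} (ht : 0 < t) {z : ℂ} (hz : Admissible γ ν μ t z) :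
    HasDerivAt (foot γ ν ρ t)
      (Real.exp (γ * t) / (1 + growth γ t * cauchyDeriv ρ (foot γ ν ρ t z))) z := by
  have h1 := (hasAnalyticExt_foot hγ hμ hρ hlow ht hz).analyticAt.differentiableAt.hasDerivAt
  have hne := one_add_ne_zero hρ hlow hμ (growth_nonneg hγ ht.le) hz
  rw [← foot] at hne
  have hC := hasDerivAt_cauchyTransform hρ (foot_spec hγ hμ hρ hlow ht.le hz).1
  have h2 : HasDerivAt (fun w => base γ ν t w - growth γ t * cauchyTransform ρ (foot γ ν ρ t w))
      (Real.exp (γ * t) - growth γ t * (cauchyDeriv ρ (foot γ ν ρ t z) *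
        deriv (foot γ ν ρ t) z)) z := by
    refine HasDerivAt.sub ?_ ((hC.comp z h1).const_mul _)
    have := ((hasDerivAt_id z).const_mul (Real.exp (γ * t) : ℂ)).add_const
      (Complex.I * (lift γ ν t : ℂ))
    rw [mul_one] at this
    exact this
  have hadm : ∀ᶠ w in 𝓝 z, Admissible γ ν μ t w := by
    have : ContinuousAt (fun w => (base γ ν t w).im) z := by
      unfold base; fun_prop
    exact this.eventually (lt_mem_nhds hz)
  have h3 : HasDerivAt (foot γ ν ρ t) _ z := h2.congr_of_eventuallyEq (by
    filter_upwards [hadm] with w hw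
    exact (foot_spec hγ hμ hρ hlow ht.le hw).2)
  have h4 := h1.unique h3
  refine h1.congr_deriv ?_
  symm
  rw [div_eq_iff hne]
  linear_combination -h4

theorem hasDerivAt_foot_fst {t : ℝ} (ht : 0 < t) {z : ℂ} (hz : Admissible γ ν μ t z) :
    HasDerivAt (fun τ => foot γ ν ρ τ z)
      (Real.exp (γ * t) * (γ * z + Complex.I * ν - solf γ ν ρ t z) /
        (1 + growth γ t * cauchyDeriv ρ (foot γ ν ρ t z))) t := by
  have h1 := (((hasAnalyticExt_foot hγ hμ hρ hlow ht hz).contDiffAt_fst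
    1).differentiableAt one_ne_zero).hasDerivAt
  have hne := one_add_ne_zero hρ hlow hμ (growth_nonneg hγ ht.le) hz
  rw [← foot] at hne
  have hC := hasDerivAt_cauchyTransform hρ (foot_spec hγ hμ hρ hlow ht.le hz).1
  have hE : HasDerivAt (fun τ : ℝ => Real.exp (γ * τ)) (Real.exp (γ * t) * γ) t := by
    have h1 : HasDerivAt (fun t : ℝ => γ * t) γ t := by
      simpa using (hasDerivAt_id t).const_mul γ
    exact h1.exp
  have h2 : HasDerivAt (fun τ => base γ ν τ z - growth γ τ * cauchyTransform ρ (foot γ ν ρ τ z))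
      (((Real.exp (γ * t) * γ : ℝ) * z + Complex.I * (ν * Real.exp (γ * t) : ℝ)) -
        ((Real.exp (γ * t) ^ 2 : ℝ) * cauchyTransform ρ (foot γ ν ρ t z) +
        growth γ t * (cauchyDeriv ρ (foot γ ν ρ t z) *
        deriv (fun τ => foot γ ν ρ τ z) t))) t := by
    refine HasDerivAt.sub ?_ ?_
    · exact (hE.ofReal_comp.mul_const z).add
        ((hasDerivAt_lift hγ ν t).ofReal_comp.const_mul Complex.I)
    · exact (hasDerivAt_growth hγ t).ofReal_comp.mul (HasDerivAt.comp (h₂ := cauchyTransform ρ)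
        (h := fun τ => foot γ ν ρ τ z) t hC h1)
  have hadm : ∀ᶠ τ in 𝓝 t, Admissible γ ν μ τ z ∧ 0 < τ := by
    have h5 : ContinuousAt (fun τ => (base γ ν τ z).im - growth γ τ * μ) t := by
      unfold base lift growth; fun_prop
    filter_upwards [h5.eventually (lt_mem_nhds (sub_pos.mpr hz)), lt_mem_nhds ht] with τ h6 h7
    exact ⟨by simpa [Admissible] using h6, h7⟩
  have h3 : HasDerivAt (fun τ => foot γ ν ρ τ z) _ t := h2.congr_of_eventuallyEq (by
    filter_upwards [hadm] with τ hτ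
    exact (foot_spec hγ hμ hρ hlow hτ.2.le hτ.1).2)
  have h4 := h1.unique h3
  refine h1.congr_deriv ?_
  symm
  rw [div_eq_iff hne, solf]
  push_cast at h4 ⊢
  linear_combination -h4

theorem hasDerivAt_solf_snd {t : ℝ} (ht : 0 < t) {z : ℂ} (hz : Admissible γ ν μ t z) :
    HasDerivAt (solf γ ν ρ t) (Real.exp (γ * t) * (cauchyDeriv ρ (foot γ ν ρ t z) *
      (Real.exp (γ * t) / (1 + growth γ t * cauchyDeriv ρ (foot γ ν ρ t z))))) z := by
  have hC := hasDerivAt_cauchyTransform hρ (foot_spec hγ hμ hρ hlow ht.le hz).1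
  exact (hC.comp z (hasDerivAt_foot_snd hγ hμ hρ hlow ht hz)).const_mul _

/-- The time and space derivatives of `foot` have the same denominator and differ by the factor `γz
+ iν - f`: the foot is transported by the flow. The prefactor `exp(γt)` produces the term `γ f`. -/
theorem hasDerivAt_solf_fst {t : ℝ} (ht : 0 < t) {z : ℂ} (hz : Admissible γ ν μ t z) :
    HasDerivAt (fun τ => solf γ ν ρ τ z) (γ * solf γ ν ρ t z -
      (solf γ ν ρ t z - γ * z - Complex.I * ν) * deriv (solf γ ν ρ t) z) t := by
  have hC := hasDerivAt_cauchyTransform hρ (foot_spec hγ hμ hρ hlow ht.le hz).1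
  have hE : HasDerivAt (fun τ : ℝ => Real.exp (γ * τ)) (Real.exp (γ * t) * γ) t := by
    have h1 : HasDerivAt (fun t : ℝ => γ * t) γ t := by
      simpa using (hasDerivAt_id t).const_mul γ
    exact h1.exp
  have h := hE.ofReal_comp.mul (HasDerivAt.comp (h₂ := cauchyTransform ρ)
    (h := fun τ => foot γ ν ρ τ z) t hC (hasDerivAt_foot_fst hγ hμ hρ hlow ht hz))
  rw [(hasDerivAt_solf_snd hγ hμ hρ hlow ht hz).deriv]
  refine h.congr_deriv ?_
  simp only [Function.comp, solf]
  push_cast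
  ring

theorem hasDerivAt_solg_fst {t : ℝ} (ht : 0 < t) {z : ℂ} (hz : Admissible γ ν μ t z) :
    HasDerivAt (fun τ => solg γ ν ρ τ z) ((γ : ℂ) ^ 2 * z + Complex.I * ν * γ -
      (solg γ ν ρ t z - Complex.I * ν) * deriv (solg γ ν ρ t) z) t := by
  have h1 := (hasDerivAt_solf_fst hγ hμ hρ hlow ht hz).sub_const ((γ : ℂ) * z)
  have h2 : deriv (solg γ ν ρ t) z = deriv (solf γ ν ρ t) z - γ := by
    have h3 := (hasDerivAt_solf_snd hγ hμ hρ hlow ht hz).differentiableAt.hasDerivAt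
    have h4 := h3.sub ((hasDerivAt_id z).const_mul (γ : ℂ))
    rw [mul_one] at h4
    exact h4.deriv
  refine h1.congr_deriv ?_
  rw [h2, solg]
  ring

end

theorem root_zero (hρ : Integrable ρ) (hlow : ∀ᵐ x, -μ ≤ ρ x) (hμ : 0 ≤ μ) {z : ℂ}
    (hz : 0 < z.im) : root ρ z 0 = z :=
  root_eq hρ hlow hμ le_rfl (by simpa using hz) hz (by simp)

theorem solg_zero (hρ : Integrable ρ) (hlow : ∀ᵐ x, -μ ≤ ρ x) (hμ : 0 ≤ μ) {z : ℂ}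
    (hz : 0 < z.im) : solg γ ν ρ 0 z = cauchyTransform ρ z - γ * z := by
  have h1 : base γ ν 0 z = z := by simp [base, lift]
  have h2 : growth γ 0 = 0 := by simp [growth]
  simp [solg, solf, foot, h1, h2, root_zero hρ hlow hμ hz]

theorem isBurgersSolution_solg (hγ : 0 < γ) (hμ : 0 ≤ μ) (hμν : μ < ν) (hρ : Integrable ρ)
    (hlow : ∀ᵐ x, -μ ≤ ρ x) :
    IsBurgersSolution γ ν (lifespan γ ν μ) ρ (solg γ ν ρ) where
  holomorphic t ht z hz := (hasAnalyticExt_solg hγ hμ hρ hlow ht.1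
    (admissible_of_mem hγ hμ hμν ht hz)).analyticAt
  continuous := by
    rintro ⟨t, z⟩ ⟨h1, h2, h3⟩
    exact (continuousWithinAt_solg hγ hμ hρ hlow h1
      (admissible_of_upperHalf hγ hμ hμν h1 h2 h3)).mono fun p hp => hp.1
  equation t ht z hz := hasDerivAt_solg_fst hγ hμ hρ hlow ht.1
    (admissible_of_mem hγ hμ hμν ht (le_of_lt hz))
  initial z hz := solg_zero hρ hlow hμ hz

end Flow

/-! ### Fourier transforms of integrable functions and of the Cauchy kernel -/

section Fourier

theorem integral_fourier_mul_eq_flip {f g : ℝ → ℂ} (hf : Integrable f) (hg : Integrable g) :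
    ∫ ξ : ℝ, 𝓕 f ξ * g ξ = ∫ x : ℝ, f x * 𝓕 g x := by
  have := VectorFourier.integral_fourierIntegral_smul_eq_flip (L := innerₗ ℝ) (μ := volume)
    (ν := volume) Real.continuous_fourierChar continuous_inner hf hg
  simp only [flip_innerₗ, smul_eq_mul] at this
  exact this

theorem integrable_ofReal_complex {ρ : ℝ → ℝ} (hρ : Integrable ρ) :
    Integrable fun x => (ρ x : ℂ) := hρ.ofReal

theorem continuous_fourier {f : ℝ → ℂ} (hf : Integrable f) : Continuous (𝓕 f) :=
  VectorFourier.fourierIntegral_continuous (L := innerₗ ℝ) Real.continuous_fourierChar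
    continuous_inner hf

theorem norm_fourier_le (f : ℝ → ℂ) (ξ : ℝ) : ‖𝓕 f ξ‖ ≤ ∫ x, ‖f x‖ :=
  VectorFourier.norm_fourierIntegral_le_integral_norm _ _ _ _ _

/-- Links the distributional Fourier transform, in which Sobolev regularity and Plancherel's theorem
are expressed, with the Fourier integral: both give the same pairing with every real smooth
compactly supported function. -/
theorem fourier_ae_eq_of_toTemperedDistribution {p q : ENNReal} [Fact (1 ≤ p)] [Fact (1 ≤ q)]
    {F : Lp ℂ p (volume : Measure ℝ)} {v : Lp ℂ q (volume : Measure ℝ)}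
    (h : 𝓕 (Lp.toTemperedDistribution F) = Lp.toTemperedDistribution v)
    {f : ℝ → ℂ} (hf : Integrable f) (hF : (F : ℝ → ℂ) =ᵐ[volume] f) :
    𝓕 f =ᵐ[volume] v := by
  refine ae_eq_of_integral_contDiff_smul_eq (continuous_fourier hf).locallyIntegrable
    ((Lp.memLp v).locallyIntegrable Fact.out) fun g hg hgs => ?_
  set φ : 𝓢(ℝ, ℂ) := HasCompactSupport.toSchwartzMap (f := fun x => (g x : ℂ))
    (hgs.comp_left (g := fun x : ℝ => (x : ℂ)) Complex.ofReal_zero)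
    (Complex.ofRealCLM.contDiff.comp hg) with hφ
  have hφ' : ∀ x, φ x = (g x : ℂ) := fun x => rfl
  have h1 := DFunLike.congr_fun h φ
  rw [TemperedDistribution.fourier_apply, Lp.toTemperedDistribution_apply,
    Lp.toTemperedDistribution_apply] at h1
  have h2 : ∫ x, g x • 𝓕 f x = ∫ x, 𝓕 f x * φ x := by
    congr 1; ext x; rw [hφ', Complex.real_smul, mul_comm]
  rw [h2, integral_fourier_mul_eq_flip hf φ.integrable]
  have h3 : ∫ x, g x • v x = ∫ x, φ x • v x := by
    congr 1
  rw [h3, ← h1]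
  refine integral_congr_ae ?_
  filter_upwards [hF] with x hx
  rw [hx, SchwartzMap.fourier_coe, smul_eq_mul, mul_comm]

/-- Plancherel's theorem for a function in `L¹ ∩ L²`. -/
theorem memLp_fourier {f : ℝ → ℂ} (hf : Integrable f) (hf2 : MemLp f 2) :
    MemLp (𝓕 f) 2 ∧ eLpNorm (𝓕 f) 2 volume = eLpNorm f 2 volume := by
  set F : Lp ℂ 2 (volume : Measure ℝ) := hf2.toLp f with hF
  have h1 : 𝓕 (Lp.toTemperedDistribution F) = Lp.toTemperedDistribution (𝓕 F) :=
    Lp.fourier_toTemperedDistribution_eq F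
  have h2 := fourier_ae_eq_of_toTemperedDistribution h1 hf hf2.coeFn_toLp
  refine ⟨(Lp.memLp (𝓕 F)).ae_eq h2.symm, ?_⟩
  have h3 := Lp.norm_fourier_eq F
  rw [Lp.norm_def, Lp.norm_def, ENNReal.toReal_eq_toReal_iff' (Lp.eLpNorm_ne_top _)
    (Lp.eLpNorm_ne_top _)] at h3
  rw [eLpNorm_congr_ae h2, h3]
  exact eLpNorm_congr_ae hf2.coeFn_toLp

theorem fourierInv_eq_fourier_neg' (f : ℝ → ℂ) (x : ℝ) : 𝓕⁻ f x = 𝓕 f (-x) :=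
  Real.fourierInv_eq_fourier_neg f x

theorem integral_fourierInv_mul_eq_flip {f g : ℝ → ℂ} (hf : Integrable f) (hg : Integrable g) :
    ∫ ξ : ℝ, 𝓕⁻ f ξ * g ξ = ∫ x : ℝ, f x * 𝓕⁻ g x := by
  have h1 := integral_fourier_mul_eq_flip hf (hg.comp_neg)
  have h2 : ∫ ξ : ℝ, 𝓕⁻ f ξ * g ξ = ∫ ξ : ℝ, 𝓕 f ξ * g (-ξ) := by
    rw [← integral_neg_eq_self]
    congr 1; ext x
    rw [fourierInv_eq_fourier_neg', neg_neg]
  rw [h2, h1]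
  congr 1; ext x
  congr 1
  rw [Real.fourier_eq, Real.fourierInv_eq, ← integral_neg_eq_self]
  simp

/-- `f` need not be continuous, so inversion holds only almost everywhere. It is proved by duality,
each test function being the Fourier transform of a Schwartz function. -/
theorem ae_eq_fourierInv_fourier {f : ℝ → ℂ} (hf : Integrable f) (hf' : Integrable (𝓕 f)) :
    f =ᵐ[volume] 𝓕⁻ (𝓕 f) := by
  have hc : Continuous (𝓕⁻ (𝓕 f)) := by
    have : 𝓕⁻ (𝓕 f) = fun x => 𝓕 (𝓕 f) (-x) := by
      ext x; exact fourierInv_eq_fourier_neg' _ x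
    rw [this]
    exact (continuous_fourier hf').comp continuous_neg
  refine ae_eq_of_integral_contDiff_smul_eq hf.locallyIntegrable hc.locallyIntegrable
    fun g hg hgs => ?_
  set η : 𝓢(ℝ, ℂ) := HasCompactSupport.toSchwartzMap (f := fun x => (g x : ℂ))
    (hgs.comp_left (g := fun x : ℝ => (x : ℂ)) Complex.ofReal_zero)
    (Complex.ofRealCLM.contDiff.comp hg) with hη
  have hη' : ∀ x, η x = (g x : ℂ) := fun x => rfl
  have h1 : ∫ x, g x • f x = ∫ x, f x * η x := by
    congr 1; ext x; rw [hη', Complex.real_smul, mul_comm]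
  have h2 : ∫ x, g x • 𝓕⁻ (𝓕 f) x = ∫ x, 𝓕⁻ (𝓕 f) x * η x := by
    congr 1; ext x; rw [hη', Complex.real_smul, mul_comm]
  rw [h1, h2, integral_fourierInv_mul_eq_flip hf' η.integrable]
  have h3 : (η : ℝ → ℂ) = 𝓕 ((𝓕⁻ η : 𝓢(ℝ, ℂ)) : ℝ → ℂ) := by
    rw [← SchwartzMap.fourier_coe, FourierTransform.fourier_fourierInv_eq]
  rw [← SchwartzMap.fourierInv_coe, integral_fourier_mul_eq_flip hf (𝓕⁻ η : 𝓢(ℝ, ℂ)).integrable,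
    ← h3]

/-- The density whose Fourier transform is `s ↦ (z - s)⁻¹`. -/
noncomputable def halfExp (z : ℂ) (ξ : ℝ) : ℂ :=
  (Set.Ioi (0 : ℝ)).indicator (fun ξ : ℝ => -(2 * Real.pi * Complex.I) *
    Complex.exp (2 * Real.pi * Complex.I * z * ξ)) ξ

theorem re_two_pi_I_mul (z : ℂ) : (2 * Real.pi * Complex.I * z).re = -(2 * Real.pi * z.im) := by
  have : (2 * Real.pi * Complex.I * z : ℂ) = ((2 * Real.pi : ℝ) : ℂ) * (Complex.I * z) := by
    push_cast; ring
  rw [this, Complex.re_ofReal_mul]; simp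

theorem integrable_halfExp {z : ℂ} (hz : 0 < z.im) : Integrable (halfExp z) := by
  unfold halfExp
  rw [integrable_indicator_iff measurableSet_Ioi]
  refine (integrableOn_exp_mul_complex_Ioi ?_ 0).const_mul _
  rw [re_two_pi_I_mul]
  have := Real.pi_pos
  nlinarith

theorem fourier_halfExp {z : ℂ} (hz : 0 < z.im) (s : ℝ) : 𝓕 (halfExp z) s = (z - s)⁻¹ := by
  have hne := sub_ofReal_ne_zero hz s
  rw [Real.fourier_real_eq_integral_exp_smul]
  have h1 : ∀ ξ : ℝ, Complex.exp (↑(-2 * Real.pi * ξ * s) * Complex.I) • halfExp z ξ =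
      (Set.Ioi (0 : ℝ)).indicator (fun ξ : ℝ => -(2 * Real.pi * Complex.I) *
    Complex.exp (2 * Real.pi * Complex.I * (z - s) * ξ)) ξ := by
    intro ξ
    by_cases h : ξ ∈ Set.Ioi (0 : ℝ)
    · rw [halfExp, Set.indicator_of_mem h, Set.indicator_of_mem h, smul_eq_mul, mul_left_comm,
        ← Complex.exp_add]
      congr 2
      push_cast; ring
    · rw [halfExp, Set.indicator_of_notMem h, Set.indicator_of_notMem h, smul_zero]
  simp_rw [h1]
  have hre : (2 * Real.pi * Complex.I * (z - s)).re < 0 := by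
    rw [re_two_pi_I_mul]
    have := Real.pi_pos
    simp
    positivity
  have hpi : (Real.pi : ℂ) ≠ 0 := by exact_mod_cast Real.pi_pos.ne'
  rw [integral_indicator measurableSet_Ioi, integral_const_mul,
    integral_exp_mul_complex_Ioi hre]
  simp only [Complex.ofReal_zero, mul_zero, Complex.exp_zero]
  field_simp [Complex.I_ne_zero]

/-- The formula `∫ f̂ g = ∫ f ĝ` with `1/(z - s)` as the Fourier transform of `halfExp z`. The
Cauchy transform thus sees only positive frequencies, with weight `exp(-2π ξ Im z)` in modulus. -/
theorem cauchyTransform_eq_fourier {ρ : ℝ → ℝ} (hρ : Integrable ρ) {z : ℂ} (hz : 0 < z.im) :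
    cauchyTransform ρ z = 1 / (Real.pi : ℂ) * ∫ ξ, 𝓕 (fun x => (ρ x : ℂ)) ξ * halfExp z ξ := by
  rw [integral_fourier_mul_eq_flip (integrable_ofReal_complex hρ) (integrable_halfExp hz), cauchyTransform]
  simp_rw [fourier_halfExp hz, div_eq_mul_inv]

theorem fourier_neg_of_real (ρ : ℝ → ℝ) (ξ : ℝ) :
    𝓕 (fun x => (ρ x : ℂ)) (-ξ) = starRingEnd ℂ (𝓕 (fun x => (ρ x : ℂ)) ξ) := by
  rw [Real.fourier_real_eq_integral_exp_smul, Real.fourier_real_eq_integral_exp_smul,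
    ← integral_conj]
  congr 1; ext x
  simp only [smul_eq_mul, map_mul, Complex.conj_ofReal, ← Complex.exp_conj, Complex.conj_I]
  congr 2
  push_cast; ring

end Fourier

/-! ### Consequences of Sobolev regularity `s > 1/2` -/

section Sobolev

variable {ρ : ℝ → ℝ} {s : ℝ}

theorem MemHs.memLp (h : MemHs s ρ) : MemLp ρ 2 := by
  obtain ⟨F, hF, -⟩ := h
  have h1 : MemLp (fun x => (ρ x : ℂ)) 2 := (Lp.memLp F).ae_eq hF
  exact h1.re

/-- The only use of `s > 1/2`: the weight `(1 + ξ²)^(-s/2)` is then square-integrable. -/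
theorem MemHs.integrable_fourier (h : MemHs s ρ) (hs : 1 / 2 < s) (hρ : Integrable ρ) :
    Integrable (𝓕 fun x => (ρ x : ℂ)) := by
  obtain ⟨F, hF, hS⟩ := h
  obtain ⟨v, hv⟩ := hS.fourier_memL1 (by simp; linarith)
  exact (L1.integrable_coeFn v).congr
    (fourier_ae_eq_of_toTemperedDistribution hv hρ.ofReal hF).symm

/-- The Cauchy transform of a function with integrable Fourier transform is bounded in the upper
half-plane and extends continuously to the real line. -/
theorem exists_cauchyTransform_extension (hρ : Integrable ρ)
    (hF : Integrable (𝓕 fun x => (ρ x : ℂ))) :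
    ∃ (Fc : ℂ → ℂ) (M : ℝ), ContinuousOn Fc closedUpperHalf ∧
      (∀ z ∈ upperHalf, Fc z = cauchyTransform ρ z) ∧
      (∀ z ∈ upperHalf, ‖cauchyTransform ρ z‖ ≤ M) ∧
      ∀ᵐ x : ℝ, -(Fc x).im = ρ x := by
  set r : ℝ → ℂ := 𝓕 fun x => (ρ x : ℂ) with hr
  set A : ℂ → ℂ := fun z => ∫ ξ in Set.Ioi (0 : ℝ), r ξ * Complex.exp (2 * Real.pi * Complex.I * z * ξ)
    with hA
  have hrc : Continuous r := continuous_fourier hρ.ofReal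
  have hexp : ∀ z ∈ closedUpperHalf, ∀ ξ ∈ Set.Ioi (0 : ℝ),
      ‖r ξ * Complex.exp (2 * Real.pi * Complex.I * z * ξ)‖ ≤ ‖r ξ‖ := by
    intro z hz ξ hξ
    rw [norm_mul, Complex.norm_exp, Complex.re_mul_ofReal, re_two_pi_I_mul]
    apply mul_le_of_le_one_right (norm_nonneg _)
    rw [Real.exp_le_one_iff]
    have h1 : 0 ≤ 2 * Real.pi * z.im := mul_nonneg (by positivity) hz
    have h2 : 0 < ξ := hξ
    nlinarith [mul_nonneg h1 h2.le]
  have hAC : ∀ z ∈ upperHalf, -(2 * Complex.I) * A z = cauchyTransform ρ z := by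
    intro z hz
    rw [cauchyTransform_eq_fourier hρ hz]
    have h1 : ∀ ξ : ℝ, r ξ * halfExp z ξ = (Set.Ioi (0 : ℝ)).indicator (fun ξ : ℝ =>
        -(2 * Real.pi * Complex.I) * (r ξ * Complex.exp (2 * Real.pi * Complex.I * z * ξ))) ξ := by
      intro ξ
      by_cases h : ξ ∈ Set.Ioi (0 : ℝ)
      · rw [halfExp, Set.indicator_of_mem h, Set.indicator_of_mem h]; ring
      · rw [halfExp, Set.indicator_of_notMem h, Set.indicator_of_notMem h, mul_zero]
    rw [← hr]
    simp_rw [h1]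
    rw [integral_indicator measurableSet_Ioi, integral_const_mul]
    have hpi : (Real.pi : ℂ) ≠ 0 := by exact_mod_cast Real.pi_pos.ne'
    change -(2 * Complex.I) * A z =
      1 / (Real.pi : ℂ) * (-(2 * Real.pi * Complex.I) * A z)
    generalize A z = X
    field_simp
  refine ⟨fun z => -(2 * Complex.I) * A z, 2 * ∫ ξ, ‖r ξ‖, ?_, hAC, ?_, ?_⟩
  · refine continuousOn_const.mul ?_
    refine continuousOn_of_dominated (bound := fun ξ => ‖r ξ‖) ?_ ?_ hF.norm.integrableOn ?_
    · intro z _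
      refine Continuous.aestronglyMeasurable ?_
      fun_prop
    · intro z hz
      exact (ae_restrict_iff' measurableSet_Ioi).mpr (ae_of_all _ fun ξ hξ => hexp z hz ξ hξ)
    · refine ae_of_all _ fun ξ => Continuous.continuousOn ?_
      fun_prop
  · intro z hz
    rw [← hAC z hz, norm_mul, norm_neg, norm_mul, Complex.norm_I, mul_one]
    have h2 : ‖(2 : ℂ)‖ = 2 := by simp
    rw [h2]
    gcongr
    refine (norm_integral_le_integral_norm _).trans ?_
    refine le_trans ?_ (setIntegral_le_integral (s := Set.Ioi (0 : ℝ)) hF.norm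
      (ae_of_all _ fun ξ => norm_nonneg _))
    refine integral_mono_of_nonneg (ae_of_all _ fun ξ => norm_nonneg _) hF.norm.integrableOn ?_
    exact (ae_restrict_iff' measurableSet_Ioi).mpr (ae_of_all _ fun ξ hξ =>
      hexp z (show 0 ≤ z.im from le_of_lt hz) ξ hξ)
  · filter_upwards [ae_eq_fourierInv_fourier (integrable_ofReal_complex hρ) hF] with x hx
    have h3 : 𝓕⁻ r x = ∫ ξ : ℝ, r ξ * Complex.exp (2 * Real.pi * Complex.I * x * ξ) := by
      rw [fourierInv_eq_fourier_neg', Real.fourier_real_eq_integral_exp_smul]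
      congr 1; ext ξ
      rw [smul_eq_mul, mul_comm]
      congr 2
      push_cast; ring
    have hint : Integrable fun ξ : ℝ => r ξ * Complex.exp (2 * Real.pi * Complex.I * x * ξ) := by
      refine hF.norm.mono' (Continuous.aestronglyMeasurable (by fun_prop)) (ae_of_all _ fun ξ => ?_)
      rw [norm_mul, Complex.norm_exp, Complex.re_mul_ofReal, re_two_pi_I_mul]
      simp
    -- As `ρ` is real, negative frequencies contribute the conjugate of the positive ones. Fourier
    -- inversion then reads `ρ = 2 Re A = -Im (-2i A)` almost everywhere.
    have h4 : ∫ ξ in Set.Iic (0 : ℝ), r ξ * Complex.exp (2 * Real.pi * Complex.I * x * ξ) =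
        starRingEnd ℂ (A x) := by
      have := integral_comp_neg_Ioi (0 : ℝ)
        (fun ξ => r ξ * Complex.exp (2 * Real.pi * Complex.I * x * ξ))
      rw [neg_zero] at this
      rw [← this, hA, ← integral_conj]
      refine integral_congr_ae (ae_of_all _ fun ξ => ?_)
      simp only [hr, fourier_neg_of_real, map_mul, ← Complex.exp_conj, Complex.conj_I,
        Complex.conj_ofReal]
      congr 2
      have : (starRingEnd ℂ) 2 = 2 := Complex.conj_ofNat 2
      rw [this]
      push_cast; ring
    have h5 : (ρ x : ℂ) = starRingEnd ℂ (A x) + A x := by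
      have h6 := intervalIntegral.integral_Iic_add_Ioi (b := (0:ℝ)) hint.integrableOn
        hint.integrableOn
      rw [h4] at h6
      exact hx.trans (h3.trans h6.symm)
    have h7 := congrArg Complex.re h5
    simp at h7
    simp [h7]; ring

end Sobolev

/-! ### `L¹` and `L²` bounds for Poisson averages -/

section PoissonConvolution

theorem eLpNorm_two_eq {α E : Type*} [MeasurableSpace α] {m : Measure α} [NormedAddCommGroup E]
    {f : α → E} (hf : MemLp f 2 m) : eLpNorm f 2 m = ENNReal.ofReal (√(∫ x, ‖f x‖ ^ 2 ∂m)) := by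
  rw [hf.eLpNorm_eq_integral_rpow_norm (by norm_num) (by norm_num), Real.sqrt_eq_rpow]
  simp

theorem integral_norm_sq_le_of_eLpNorm_le {α E : Type*} [MeasurableSpace α] {m : Measure α}
    [NormedAddCommGroup E] {f : α → E} {C : NNReal} (hf : AEStronglyMeasurable f m)
    (h : eLpNorm f 2 m ≤ C) : MemLp f 2 m ∧ ∫ x, ‖f x‖ ^ 2 ∂m ≤ (C : ℝ) ^ 2 := by
  have hm : MemLp f 2 m := ⟨hf, h.trans_lt ENNReal.coe_lt_top⟩
  refine ⟨hm, ?_⟩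
  rw [eLpNorm_two_eq hm, ← ENNReal.ofReal_coe_nnreal, ENNReal.ofReal_le_ofReal_iff C.coe_nonneg] at h
  exact (Real.sqrt_le_left C.coe_nonneg).mp h

theorem integrable_poisson_real {a : ℝ} (ha : 0 < a) :
    Integrable fun x : ℝ => a / (x ^ 2 + a ^ 2) := by
  refine (integrable_poisson (z := Complex.I * a) (by simpa using ha)).congr (ae_of_all _ fun s => ?_)
  simp only [norm_sub_ofReal_sq]
  simp

theorem integral_poisson_real {a : ℝ} (ha : 0 < a) :
    ∫ x : ℝ, a / (x ^ 2 + a ^ 2) = Real.pi := by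
  rw [← integral_poisson (z := Complex.I * a) (by simpa using ha)]
  congr 1; ext s
  rw [norm_sub_ofReal_sq]
  simp

/-- `∫ σ(s) a / ((y - s)² + a²) ds`. -/
noncomputable def poissonConv (a : ℝ) (σ : ℝ → ℝ) (y : ℝ) : ℝ :=
  ∫ s, σ s * (a / ((y - s) ^ 2 + a ^ 2))

theorem poissonConv_eq (a : ℝ) (σ : ℝ → ℝ) :
    poissonConv a σ = convolution σ (fun x => a / (x ^ 2 + a ^ 2))
      (ContinuousLinearMap.mul ℝ ℝ) volume := by
  ext y
  simp [poissonConv, convolution]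

theorem integrable_poissonConv {a : ℝ} (ha : 0 < a) {σ : ℝ → ℝ} (hσ : Integrable σ) :
    Integrable (poissonConv a σ) := by
  rw [poissonConv_eq]
  exact hσ.integrable_convolution _ (integrable_poisson_real ha)

theorem integral_poissonConv {a : ℝ} (ha : 0 < a) {σ : ℝ → ℝ} (hσ : Integrable σ) :
    ∫ y, poissonConv a σ y = (∫ s, σ s) * Real.pi := by
  rw [poissonConv_eq, integral_convolution _ hσ (integrable_poisson_real ha),
    integral_poisson_real ha]
  simp

theorem continuous_poisson_kernel {a : ℝ} (ha : 0 < a) (y : ℝ) :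
    Continuous fun s : ℝ => a / ((y - s) ^ 2 + a ^ 2) :=
  continuous_const.div (by fun_prop) fun s => by positivity

theorem integrable_mul_poisson_kernel {a : ℝ} (ha : 0 < a) {σ : ℝ → ℝ} (hσ : Integrable σ) (y : ℝ) :
    Integrable fun s => σ s * (a / ((y - s) ^ 2 + a ^ 2)) := by
  refine hσ.mul_bdd (c := a⁻¹) (continuous_poisson_kernel ha y).aestronglyMeasurable
    (ae_of_all _ fun s => ?_)
  rw [Real.norm_of_nonneg (by positivity), div_le_iff₀ (by positivity), inv_mul_eq_div,
    le_div_iff₀ ha]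
  nlinarith [sq_nonneg (y - s)]

/-- Jensen's inequality for a kernel of total mass `π`. -/
theorem poissonConv_sq_le {a : ℝ} (ha : 0 < a) {σ : ℝ → ℝ} (hσ : MemLp σ 2) (y : ℝ) :
    poissonConv a (fun s => |σ s|) y ^ 2 ≤ Real.pi * poissonConv a (fun s => σ s ^ 2) y := by
  have hk : ∀ s : ℝ, 0 ≤ a / ((y - s) ^ 2 + a ^ 2) := fun s => by positivity
  have hsq : ∀ s : ℝ, (√(a / ((y - s) ^ 2 + a ^ 2))) ^ 2 = a / ((y - s) ^ 2 + a ^ 2) := fun s =>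
    Real.sq_sqrt (hk s)
  have hker : Integrable fun s : ℝ => a / ((y - s) ^ 2 + a ^ 2) :=
    (integrable_poisson_real ha).comp_sub_left y
  have hkc : Continuous fun s : ℝ => √(a / ((y - s) ^ 2 + a ^ 2)) :=
    Real.continuous_sqrt.comp (continuous_poisson_kernel ha y)
  have m1 : MemLp (fun s : ℝ => √(a / ((y - s) ^ 2 + a ^ 2))) 2 := by
    rw [memLp_two_iff_integrable_sq hkc.aestronglyMeasurable]
    simp_rw [hsq]
    exact hker
  have m2 : MemLp (fun s : ℝ => |σ s| * √(a / ((y - s) ^ 2 + a ^ 2))) 2 := by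
    have hms : AEStronglyMeasurable (fun s : ℝ => |σ s| * √(a / ((y - s) ^ 2 + a ^ 2))) volume :=
      hσ.1.norm.mul hkc.aestronglyMeasurable
    rw [memLp_two_iff_integrable_sq hms]
    simp_rw [mul_pow, hsq, sq_abs]
    exact integrable_mul_poisson_kernel ha hσ.integrable_sq y
  have h := integral_mul_sq_le m2 m1
  simp_rw [mul_pow, hsq, sq_abs] at h
  have e1 : ∫ s : ℝ, a / ((y - s) ^ 2 + a ^ 2) = Real.pi := by
    rw [← integral_poisson_real ha]
    exact integral_sub_left_eq_self (fun s : ℝ => a / (s ^ 2 + a ^ 2)) volume y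
  rw [e1, mul_comm] at h
  refine le_trans (le_of_eq ?_) h
  unfold poissonConv
  congr 2; ext s
  rw [Real.norm_of_nonneg (by positivity), Real.norm_of_nonneg (by positivity), mul_assoc, ← sq,
    hsq]

/-- The pointwise bound, integrated. The constant `π²` is sharp enough to make the normalized
Poisson average a contraction of `L²`, which `integral_im_line_sq_le` needs. -/
theorem memLp_poissonConv {a : ℝ} (ha : 0 < a) {σ : ℝ → ℝ} (hσ1 : Integrable σ) (hσ : MemLp σ 2) :
    MemLp (poissonConv a fun s => |σ s|) 2 ∧
      ∫ y, poissonConv a (fun s => |σ s|) y ^ 2 ≤ Real.pi ^ 2 * ∫ s, σ s ^ 2 := by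
  have hm := (integrable_poissonConv ha hσ1.abs).1
  have hi := (integrable_poissonConv ha hσ.integrable_sq).const_mul Real.pi
  have hi2 : Integrable fun y => poissonConv a (fun s => |σ s|) y ^ 2 := by
    refine hi.mono' (hm.pow 2) (ae_of_all _ fun y => ?_)
    rw [Real.norm_of_nonneg (by positivity)]
    exact poissonConv_sq_le ha hσ y
  refine ⟨(memLp_two_iff_integrable_sq hm).mpr hi2, ?_⟩
  refine (integral_mono hi2 hi fun y => poissonConv_sq_le ha hσ y).trans (le_of_eq ?_)
  rw [integral_const_mul, integral_poissonConv ha hσ.integrable_sq]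
  ring

end PoissonConvolution

/-! ### Decay at infinity and bounds at the feet of characteristics -/

section Decay

variable {ρ : ℝ → ℝ}

/-- Dominated convergence with majorant `|ρ|/δ`. Keeping away from the real axis is essential; the
feet do so by `foot_im_ge'`. -/
theorem tendsto_cauchyTransform_zero (hρ : Integrable ρ) {δ : ℝ} (hδ : 0 < δ) :
    Tendsto (cauchyTransform ρ) (Bornology.cobounded ℂ ⊓ 𝓟 {z | δ ≤ z.im}) (𝓝 0) := by
  have hcg : (Bornology.cobounded ℂ).IsCountablyGenerated := by
    rw [← comap_norm_atTop]
    infer_instance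
  have h : Tendsto (fun z : ℂ => ∫ s : ℝ, (ρ s : ℂ) / (z - s))
      (Bornology.cobounded ℂ ⊓ 𝓟 {z | δ ≤ z.im}) (𝓝 (∫ _ : ℝ, (0 : ℂ))) := by
    refine tendsto_integral_filter_of_dominated_convergence (fun s => |ρ s| / δ) ?_ ?_
      (hρ.abs.div_const δ) ?_
    · rw [eventually_inf_principal]
      filter_upwards with z hz
      exact (integrable_cauchy hρ (hδ.trans_le hz)).1
    · rw [eventually_inf_principal]
      filter_upwards with z hz
      refine ae_of_all _ fun s => ?_
      rw [norm_div, Complex.norm_real, Real.norm_eq_abs]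
      have h1 : δ ≤ z.im := hz
      have := h1.trans (im_le_norm_sub_ofReal z s)
      gcongr
    · refine ae_of_all _ fun s => ?_
      have h1 : Tendsto (fun z : ℂ => z - s) (Bornology.cobounded ℂ) (Bornology.cobounded ℂ) :=
        tendsto_sub_const_cobounded _
      have h2 := (tendsto_inv₀_cobounded.comp h1).const_mul (ρ s : ℂ)
      rw [mul_zero] at h2
      exact h2.mono_left inf_le_left
  have h2 := h.const_mul (1 / (Real.pi : ℂ))
  rw [integral_zero, mul_zero] at h2
  exact h2

variable {γ ν μ M : ℝ} (hγ : 0 < γ) (hμ : 0 ≤ μ) (hμν : μ < ν) (hρ : Integrable ρ)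
  (hlow : ∀ᵐ x, -μ ≤ ρ x) (hM : ∀ z ∈ upperHalf, ‖cauchyTransform ρ z‖ ≤ M)
  {t : ℝ} (ht : t ∈ times (lifespan γ ν μ))

section
include hγ hμ hμν hρ hlow ht

theorem foot_im_ge {z : ℂ} (hz : 0 ≤ z.im) :
    Real.exp (γ * t) * z.im + (lift γ ν t - growth γ t * μ) ≤ (foot γ ν ρ t z).im := by
  have := im_root_ge hρ hlow hμ (growth_nonneg hγ ht.1.le) (admissible_of_mem hγ hμ hμν ht hz)
  rw [base_im] at this
  rw [foot]
  linarith

theorem foot_im_ge' {z : ℂ} (hz : 0 ≤ z.im) :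
    lift γ ν t - growth γ t * μ ≤ (foot γ ν ρ t z).im := by
  have h1 := foot_im_ge hγ hμ hμν hρ hlow ht hz
  have : 0 ≤ Real.exp (γ * t) * z.im := by positivity
  linarith

theorem foot_im_pos {z : ℂ} (hz : 0 ≤ z.im) : 0 < (foot γ ν ρ t z).im :=
  (foot_spec hγ hμ hρ hlow ht.1.le (admissible_of_mem hγ hμ hμν ht hz)).1

/-- Dividing by `1 + a f₀'` costs at most a factor `Im w / δ`. That factor is harmless, because
`|f₀'(w)| Im w` is controlled by Poisson integrals. -/
theorem norm_deriv_solf_le {z : ℂ} (hz : 0 ≤ z.im) :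
    ‖deriv (solf γ ν ρ t) z‖ ≤ Real.exp (γ * t) ^ 2 / (lift γ ν t - growth γ t * μ) *
      (‖cauchyDeriv ρ (foot γ ν ρ t z)‖ * (foot γ ν ρ t z).im) := by
  have hadm := admissible_of_mem hγ hμ hμν ht hz
  have hδ : 0 < lift γ ν t - growth γ t * μ := by
    linarith [growth_mul_lt_lift hγ hμ hμν ht.1 ht.2]
  have him := foot_im_pos hγ hμ hμν hρ hlow ht hz
  rw [(hasDerivAt_solf_snd hγ hμ hρ hlow ht.1 hadm).deriv]
  have h1 := norm_one_add_ge hρ hlow hμ (growth_nonneg hγ ht.1.le) hadm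
  rw [← foot] at h1
  have h2 : (lift γ ν t - growth γ t * μ) / (foot γ ν ρ t z).im ≤
      ‖1 + growth γ t * cauchyDeriv ρ (foot γ ν ρ t z)‖ := by
    refine le_trans ?_ h1
    rw [base_im]
    gcongr
    have : 0 ≤ Real.exp (γ * t) * z.im := by positivity
    linarith
  rw [norm_mul, norm_mul, norm_div, Complex.norm_real, Real.norm_of_nonneg (Real.exp_pos _).le]
  have h3 : Real.exp (γ * t) / ‖1 + growth γ t * cauchyDeriv ρ (foot γ ν ρ t z)‖ ≤
      Real.exp (γ * t) / ((lift γ ν t - growth γ t * μ) / (foot γ ν ρ t z).im) := by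
    gcongr
  calc _ ≤ Real.exp (γ * t) * (‖cauchyDeriv ρ (foot γ ν ρ t z)‖ *
        (Real.exp (γ * t) / ((lift γ ν t - growth γ t * μ) / (foot γ ν ρ t z).im))) := by gcongr
    _ = _ := by field_simp

include hM

theorem norm_foot_sub_base_le {z : ℂ} (hz : 0 ≤ z.im) :
    ‖foot γ ν ρ t z - base γ ν t z‖ ≤ growth γ t * M := by
  obtain ⟨h1, h2⟩ := foot_spec hγ hμ hρ hlow ht.1.le (admissible_of_mem hγ hμ hμν ht hz)
  have : foot γ ν ρ t z - base γ ν t z =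
      -(growth γ t * cauchyTransform ρ (foot γ ν ρ t z)) := by linear_combination h2
  rw [this, norm_neg, norm_mul, Complex.norm_real, Real.norm_of_nonneg (growth_nonneg hγ ht.1.le)]
  exact mul_le_mul_of_nonneg_left (hM _ h1) (growth_nonneg hγ ht.1.le)

theorem tendsto_foot_cobounded :
    Tendsto (foot γ ν ρ t) (Bornology.cobounded ℂ ⊓ 𝓟 closedUpperHalf)
      (Bornology.cobounded ℂ ⊓ 𝓟 {z | lift γ ν t - growth γ t * μ ≤ z.im}) := by
  refine tendsto_inf.mpr ⟨?_, ?_⟩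
  · rw [← tendsto_norm_atTop_iff_cobounded]
    have h1 : Tendsto (fun z : ℂ => Real.exp (γ * t) * ‖z‖ - (|lift γ ν t| + growth γ t * M))
        (Bornology.cobounded ℂ ⊓ 𝓟 closedUpperHalf) atTop :=
      (tendsto_atTop_add_const_right _ _ ((tendsto_norm_cobounded_atTop).const_mul_atTop
        (Real.exp_pos (γ * t)))).mono_left inf_le_left
    refine tendsto_atTop_mono' _ ?_ h1
    rw [EventuallyLE, eventually_inf_principal]
    filter_upwards with z hz
    have h2 := norm_foot_sub_base_le hγ hμ hμν hρ hlow hM ht hz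
    have h3 : ‖(Real.exp (γ * t) : ℂ) * z‖ = Real.exp (γ * t) * ‖z‖ := by
      rw [norm_mul, Complex.norm_real, Real.norm_of_nonneg (Real.exp_pos _).le]
    have h4 : (Real.exp (γ * t) : ℂ) * z = foot γ ν ρ t z - (foot γ ν ρ t z - base γ ν t z)
        - Complex.I * (lift γ ν t : ℂ) := by rw [base]; ring
    have h5 : ‖Complex.I * (lift γ ν t : ℂ)‖ = |lift γ ν t| := by
      rw [norm_mul, Complex.norm_I, one_mul, Complex.norm_real, Real.norm_eq_abs]
    have h6 : ‖(Real.exp (γ * t) : ℂ) * z‖ ≤ ‖foot γ ν ρ t z‖ + ‖foot γ ν ρ t z - base γ ν t z‖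
        + ‖Complex.I * (lift γ ν t : ℂ)‖ := by
      rw [h4]
      exact (norm_sub_le _ _).trans (by gcongr; exact norm_sub_le _ _)
    rw [h3, h5] at h6
    linarith
  · rw [tendsto_principal, eventually_inf_principal]
    filter_upwards with z hz
    exact foot_im_ge' hγ hμ hμν hρ hlow ht hz

theorem tendsto_solf_zero :
    Tendsto (solf γ ν ρ t) (Bornology.cobounded ℂ ⊓ 𝓟 closedUpperHalf) (𝓝 0) := by
  have hδ : 0 < lift γ ν t - growth γ t * μ := by
    linarith [growth_mul_lt_lift hγ hμ hμν ht.1 ht.2]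
  have h := ((tendsto_cauchyTransform_zero hρ hδ).comp
    (tendsto_foot_cobounded hγ hμ hμν hρ hlow hM ht)).const_mul (Real.exp (γ * t) : ℂ)
  rw [mul_zero] at h
  exact h

theorem norm_deriv_solf_le' {z : ℂ} (hz : 0 ≤ z.im) :
    ‖deriv (solf γ ν ρ t) z‖ ≤ Real.exp (γ * t) ^ 2 / (lift γ ν t - growth γ t * μ) * (μ + M) := by
  have hδ : 0 < lift γ ν t - growth γ t * μ := by
    linarith [growth_mul_lt_lift hγ hμ hμν ht.1 ht.2]
  have him := foot_im_pos hγ hμ hμν hρ hlow ht hz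
  refine (norm_deriv_solf_le hγ hμ hμν hρ hlow ht hz).trans ?_
  gcongr
  refine (norm_cauchyDeriv_mul_im_le hρ hlow him).trans ?_
  have h1 := Complex.abs_im_le_norm (cauchyTransform ρ (foot γ ν ρ t z))
  have h2 := hM _ him
  have := neg_abs_le (cauchyTransform ρ (foot γ ν ρ t z)).im
  linarith

/-- The Poisson kernel at the foot of a characteristic is comparable with the one at
`exp (γt) x + i growth γ t`. -/
theorem poisson_foot_le {c : ℝ} (hc : 0 < c) (hct : c ≤ 2 * ν / (Real.exp (γ * t) + 1) - μ)
    (x s : ℝ) :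
    (foot γ ν ρ t x).im / ‖foot γ ν ρ t x - s‖ ^ 2 ≤
      (ν + M) * (1 + (1 + M) / c) ^ 2 *
        (growth γ t / ((Real.exp (γ * t) * x - s) ^ 2 + growth γ t ^ 2)) := by
  set Z := foot γ ν ρ t x with hZ
  set a := growth γ t with ha
  have ha0 : 0 < a := growth_pos hγ ht.1
  have hx : (0 : ℝ) ≤ (x : ℂ).im := by simp
  have h1 := norm_foot_sub_base_le hγ hμ hμν hρ hlow hM ht hx
  have h2 := foot_im_ge' hγ hμ hμν hρ hlow ht hx
  have h3 := lift_eq hγ ν t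
  have hE : 1 ≤ Real.exp (γ * t) := Real.one_le_exp (mul_nonneg hγ.le ht.1.le)
  rw [← ha] at h1 h2 h3
  rw [← hZ] at h1 h2
  have hM0 : 0 ≤ M := (norm_nonneg _).trans (hM _ (foot_im_pos hγ hμ hμν hρ hlow ht hx))
  have hν : 0 ≤ ν := hμ.trans hμν.le
  -- `lift - a μ = a (2ν/(exp(γt) + 1) - μ)`, so the height of the foot is at least a fixed multiple
  -- of `a`, even as `t → 0`.
  have hca : c * a ≤ Z.im := by
    refine le_trans ?_ h2
    rw [h3]
    nlinarith
  have hlift : lift γ ν t ≤ a * ν := by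
    rw [h3]
    gcongr
    rw [div_le_iff₀ (by linarith)]
    nlinarith
  have hZim : Z.im ≤ a * (ν + M) := by
    have := (Complex.abs_im_le_norm (Z - base γ ν t x)).trans h1
    rw [Complex.sub_im, base_im] at this
    have := (abs_le.mp this).2
    simp at this
    linarith
  have hZre : |Z.re - Real.exp (γ * t) * x| ≤ a * M := by
    have := (Complex.abs_re_le_norm (Z - base γ ν t x)).trans h1
    rw [Complex.sub_re] at this
    have e : (base γ ν t x).re = Real.exp (γ * t) * x := by
      rw [base, Complex.add_re, Complex.re_ofReal_mul]; simp
    rwa [e] at this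
  have hN0 : 0 < ‖Z - s‖ := (mul_pos hc ha0).trans_le (hca.trans (im_le_norm_sub_ofReal Z s))
  have hN1 : c * a ≤ ‖Z - s‖ := hca.trans (im_le_norm_sub_ofReal Z s)
  have hN2 : |Z.re - s| ≤ ‖Z - s‖ := by
    have := Complex.abs_re_le_norm (Z - s)
    simpa using this
  have hN3 : |Real.exp (γ * t) * x - s| ≤ ‖Z - s‖ + a * M := by
    have : Real.exp (γ * t) * x - s = (Z.re - s) - (Z.re - Real.exp (γ * t) * x) := by ring
    rw [this]
    exact (abs_sub _ _).trans (add_le_add hN2 hZre)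
  have haN : a ≤ ‖Z - s‖ / c := by rw [le_div_iff₀ hc]; linarith
  have hN4 : a + |Real.exp (γ * t) * x - s| ≤ (1 + (1 + M) / c) * ‖Z - s‖ := by
    have : (1 + (1 + M) / c) * ‖Z - s‖ = ‖Z - s‖ + (1 + M) * (‖Z - s‖ / c) := by ring
    rw [this]
    nlinarith
  have hN5 : (Real.exp (γ * t) * x - s) ^ 2 + a ^ 2 ≤ ((1 + (1 + M) / c) * ‖Z - s‖) ^ 2 := by
    refine le_trans ?_ (pow_le_pow_left₀ (by positivity) hN4 2)
    have := abs_nonneg (Real.exp (γ * t) * x - s)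
    rw [← sq_abs (Real.exp (γ * t) * x - s)]
    nlinarith
  have hden : 0 < (Real.exp (γ * t) * x - s) ^ 2 + a ^ 2 := by positivity
  rw [mul_div_assoc', div_le_div_iff₀ (by positivity) hden]
  calc Z.im * ((Real.exp (γ * t) * x - s) ^ 2 + a ^ 2)
      ≤ (a * (ν + M)) * ((1 + (1 + M) / c) * ‖Z - s‖) ^ 2 := by gcongr
    _ = _ := by ring

/-- `c` is any positive lower bound for the gap `2ν/(exp(γt) + 1) - μ`, so that a single constant
can serve all times up to a given one. -/
theorem integral_abs_poisson_foot_le {c : ℝ} (hc : 0 < c)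
    (hct : c ≤ 2 * ν / (Real.exp (γ * t) + 1) - μ) (x : ℝ) :
    ∫ s, |ρ s| * ((foot γ ν ρ t x).im / ‖foot γ ν ρ t x - s‖ ^ 2) ≤
      (ν + M) * (1 + (1 + M) / c) ^ 2 *
        poissonConv (growth γ t) (fun s => |ρ s|) (Real.exp (γ * t) * x) := by
  have him := foot_im_pos hγ hμ hμν hρ hlow ht (z := x) (by simp)
  rw [poissonConv, ← integral_const_mul]
  refine integral_mono (integrable_mul_poisson hρ.abs him)
    ((integrable_mul_poisson_kernel (growth_pos hγ ht.1) hρ.abs _).const_mul _) fun s => ?_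
  have := poisson_foot_le hγ hμ hμν hρ hlow hM ht hc hct x s
  have h2 := mul_le_mul_of_nonneg_left this (abs_nonneg (ρ s))
  simp only
  linarith

theorem abs_im_solf_le {c : ℝ} (hc : 0 < c)
    (hct : c ≤ 2 * ν / (Real.exp (γ * t) + 1) - μ) (x : ℝ) :
    |(solf γ ν ρ t x).im| ≤ Real.exp (γ * t) * (1 / Real.pi) * ((ν + M) * (1 + (1 + M) / c) ^ 2) *
        poissonConv (growth γ t) (fun s => |ρ s|) (Real.exp (γ * t) * x) := by
  have him := foot_im_pos hγ hμ hμν hρ hlow ht (z := x) (by simp)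
  have h1 := integral_abs_poisson_foot_le hγ hμ hμν hρ hlow hM ht hc hct x
  rw [solf, Complex.im_ofReal_mul, im_cauchyTransform hρ him, abs_mul, abs_neg, abs_mul,
    abs_of_pos (Real.exp_pos _), abs_of_pos (by positivity), mul_assoc, mul_assoc (Real.exp _)]
  have hE := Real.exp_pos (γ * t)
  refine mul_le_mul_of_nonneg_left ?_ hE.le
  rw [mul_assoc]
  refine mul_le_mul_of_nonneg_left ?_ (by positivity)
  refine le_trans ?_ (h1.trans (le_of_eq (by ring)))
  refine (abs_integral_le_integral_abs).trans (le_of_eq ?_)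
  congr 1; ext s
  rw [abs_mul, abs_of_nonneg (div_nonneg him.le (by positivity))]

theorem norm_cauchyDeriv_mul_im_foot_le {c : ℝ} (hc : 0 < c)
    (hct : c ≤ 2 * ν / (Real.exp (γ * t) + 1) - μ) (x : ℝ) :
    ‖cauchyDeriv ρ (foot γ ν ρ t x)‖ * (foot γ ν ρ t x).im ≤
      1 / Real.pi * ((ν + M) * (1 + (1 + M) / c) ^ 2) *
        poissonConv (growth γ t) (fun s => |ρ s|) (Real.exp (γ * t) * x) := by
  have him := foot_im_pos hγ hμ hμν hρ hlow ht (z := x) (by simp)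
  have h1 := integral_abs_poisson_foot_le hγ hμ hμν hρ hlow hM ht hc hct x
  rw [cauchyDeriv, norm_neg, norm_mul, norm_div, norm_one, Complex.norm_real,
    Real.norm_of_nonneg Real.pi_pos.le, mul_assoc, mul_assoc (1 / Real.pi)]
  refine mul_le_mul_of_nonneg_left ?_ (by positivity)
  refine le_trans ?_ h1
  refine (mul_le_mul_of_nonneg_right (norm_integral_le_integral_norm _) him.le).trans
    (le_of_eq ?_)
  rw [← integral_mul_const]
  congr 1; ext s
  rw [norm_mul, norm_mul, norm_inv, Complex.norm_real, Real.norm_eq_abs]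
  ring

end

end Decay

/-! ### Hilbert transforms and Cauchy integrals of boundary values -/

section Plemelj

theorem tendsto_setIntegral_punctured {E : Type*} [NormedAddCommGroup E] [NormedSpace ℝ E]
    {k : ℝ → E} (hk : Integrable k) (x : ℝ) :
    Tendsto (fun ε : ℝ => ∫ y in {y : ℝ | ε < |x - y|}, k y) (𝓝[>] 0) (𝓝 (∫ y, k y)) := by
  have hms : ∀ ε : ℝ, MeasurableSet {y : ℝ | ε < |x - y|} := fun ε =>
    (isOpen_lt continuous_const (by fun_prop)).measurableSet
  simp_rw [← fun ε => integral_indicator (f := k) (μ := volume) (hms ε)]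
  refine tendsto_integral_filter_of_dominated_convergence (fun y => ‖k y‖) ?_ ?_ hk.norm ?_
  · exact Eventually.of_forall fun ε => (hk.indicator (hms ε)).1
  · exact Eventually.of_forall fun ε => ae_of_all _ fun y => norm_indicator_le_norm_self _ _
  · have : ∀ᵐ y : ℝ, y ≠ x := by simp [ae_iff, measure_singleton]
    filter_upwards [this] with y hy
    refine tendsto_const_nhds.congr' ?_
    have h0 : 0 < |x - y| := abs_pos.mpr (sub_ne_zero.mpr hy.symm)
    filter_upwards [mem_nhdsWithin_of_mem_nhds (Iio_mem_nhds h0)] with ε hε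
    rw [Set.indicator_of_mem]
    exact hε

theorem setIntegral_punctured_odd {h : ℝ → ℝ} (x ε : ℝ) (hodd : ∀ y, h (2 * x - y) = -h y) :
    ∫ y in {y : ℝ | ε < |x - y|}, h y = 0 := by
  have hms : MeasurableSet {y : ℝ | ε < |x - y|} :=
    (isOpen_lt continuous_const (by fun_prop)).measurableSet
  rw [← integral_indicator hms]
  have h1 := integral_sub_left_eq_self ({y : ℝ | ε < |x - y|}.indicator h) volume (2 * x)
  have h2 : ∀ y, {y : ℝ | ε < |x - y|}.indicator h (2 * x - y) =
      -({y : ℝ | ε < |x - y|}.indicator h y) := by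
    intro y
    have e : |x - (2 * x - y)| = |x - y| := by rw [← abs_neg]; congr 1; ring
    by_cases hy : ε < |x - y|
    · rw [Set.indicator_of_mem (by simpa [e] using hy), Set.indicator_of_mem (by simpa using hy),
        hodd]
    · rw [Set.indicator_of_notMem (by simpa [e] using hy),
        Set.indicator_of_notMem (by simpa using hy), neg_zero]
  simp_rw [h2, integral_neg] at h1
  linarith

theorem isOpen_setOf_analyticAt' (F : ℂ → ℂ) : IsOpen {z | AnalyticAt ℂ F z} :=
  isOpen_analyticAt ℂ F

/-- Division by `z - c` of a function which vanishes at `c` and tends to zero at infinity. -/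
theorem tendsto_integral_dslope {f : ℂ → ℂ} (hf : AnalyticOnNhd ℂ f closedUpperHalf) {c : ℂ}
    (hc : c ∈ closedUpperHalf) (hfc : f c = 0)
    (h0 : Tendsto f (Bornology.cobounded ℂ ⊓ 𝓟 closedUpperHalf) (𝓝 0)) :
    DifferentiableOn ℂ (dslope f c) closedUpperHalf ∧
    Tendsto (fun R : ℝ => ∫ x in (-R)..R, dslope f c x) atTop (𝓝 0) := by
  have hs : {z | AnalyticAt ℂ f z} ∈ 𝓝 c := (isOpen_setOf_analyticAt' f).mem_nhds (hf c hc)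
  have hd : DifferentiableOn ℂ (dslope f c) {z | AnalyticAt ℂ f z} :=
    (Complex.differentiableOn_dslope hs).mpr fun z hz => hz.differentiableAt.differentiableWithinAt
  have hd' : DifferentiableOn ℂ (dslope f c) closedUpperHalf := hd.mono hf
  refine ⟨hd', tendsto_integral_symm_of_mul_tendsto_zero hd' ?_⟩
  have hsub : Tendsto (fun z : ℂ => z - c) (Bornology.cobounded ℂ) (Bornology.cobounded ℂ) :=
    tendsto_sub_const_cobounded _
  have h1 : Tendsto (fun z : ℂ => 1 + c * (z - c)⁻¹) (Bornology.cobounded ℂ) (𝓝 1) := by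
    have := ((tendsto_inv₀_cobounded.comp hsub).const_mul c).const_add 1
    simpa using this
  have h2 := (h1.mono_left inf_le_left).mul h0
  rw [mul_zero] at h2
  refine h2.congr' ?_
  have hne : ∀ᶠ z in Bornology.cobounded ℂ, z ≠ c := by
    have : Bornology.IsBounded ({c} : Set ℂ) := Bornology.isBounded_singleton
    exact Bornology.isBounded_def.mp this
  filter_upwards [hne.filter_mono inf_le_left] with z hz
  rw [dslope_of_ne _ hz, slope_def_field, hfc, sub_zero]
  have : z - c ≠ 0 := sub_ne_zero.mpr hz
  field_simp
  ring

theorem tendsto_inv_sub_cobounded (c : ℂ) :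
    Tendsto (fun z : ℂ => (z - c)⁻¹) (Bornology.cobounded ℂ) (𝓝 0) :=
  tendsto_inv₀_cobounded.comp (tendsto_sub_const_cobounded _)

theorem continuous_ofReal_of_analytic {F : ℂ → ℂ} (hF : AnalyticOnNhd ℂ F closedUpperHalf) :
    Continuous fun x : ℝ => F x :=
  continuous_iff_continuousAt.mpr fun x => (hF x (by simp [closedUpperHalf])).continuousAt.comp
    Complex.continuous_ofReal.continuousAt

/-- Subtract from `F` the function `F(x) i/(z - (x - i))`, which equals `F(x)` at `x` and decays.
The quotient of the difference by `z - x` is holomorphic, with zero symmetric integral over the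
line. Its imaginary part is `-Im F(y)/(x - y)` minus an odd term, invisible to principal values, and
minus `Re F(x)/(1 + (y - x)²)`, whose integral is `π Re F(x)`. -/
theorem isHilbertTransform_of_analytic {F : ℂ → ℂ} (hF : AnalyticOnNhd ℂ F closedUpperHalf)
    (h0 : Tendsto F (Bornology.cobounded ℂ ⊓ 𝓟 closedUpperHalf) (𝓝 0))
    (hint : Integrable fun x : ℝ => (F x).im) :
    IsHilbertTransform (fun x => -(F x).im) (fun x => (F x).re) := by
  intro x
  have hxi : ∀ z ∈ closedUpperHalf, z - (x - Complex.I) ≠ 0 := by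
    intro z hz h
    have := congrArg Complex.im h
    simp at this
    have hz' : 0 ≤ z.im := hz
    linarith
  set f : ℂ → ℂ := fun z => F z - F x * (Complex.I * (z - (x - Complex.I))⁻¹) with hf
  have hxm : (x : ℂ) ∈ closedUpperHalf := by simp [closedUpperHalf]
  have hfan : AnalyticOnNhd ℂ f closedUpperHalf := by
    intro z hz
    refine (hF z hz).sub (analyticAt_const.mul (analyticAt_const.mul ?_))
    exact (analyticAt_id.sub analyticAt_const).inv (hxi z hz)
  have hfx : f x = 0 := by
    simp [hf]
  have hf0 : Tendsto f (Bornology.cobounded ℂ ⊓ 𝓟 closedUpperHalf) (𝓝 0) := by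
    have := h0.sub ((((tendsto_inv_sub_cobounded (x - Complex.I)).const_mul
      Complex.I).const_mul (F x)).mono_left inf_le_left)
    simpa using this
  obtain ⟨hG, hlim⟩ := tendsto_integral_dslope hfan hxm hfx hf0
  set G := dslope f x with hGdef
  have hGc : Continuous fun y : ℝ => G y := by
    refine continuous_iff_continuousAt.mpr fun y => ?_
    have : ContinuousOn G closedUpperHalf := hG.continuousOn
    exact (this.comp_continuous Complex.continuous_ofReal
      (fun y => by simp [closedUpperHalf])).continuousAt
  have hGimc : Continuous fun y : ℝ => (G y).im := Complex.continuous_im.comp hGc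
  have hGim : ∀ y : ℝ, y ≠ x → -(F y).im / (x - y) = (G y).im +
      ((F x).im / ((y - x) * (1 + (y - x) ^ 2)) + (F x).re * (1 + (y - x) ^ 2)⁻¹) := by
    intro y hy
    have hy' : (y : ℂ) ≠ x := by exact_mod_cast hy
    have hv : y - x ≠ 0 := sub_ne_zero.mpr hy
    have hv' : x - y ≠ 0 := sub_ne_zero.mpr hy.symm
    have e1 : G y = f y / ((y - x : ℝ) : ℂ) := by
      rw [hGdef, dslope_of_ne _ hy', slope_def_field, hfx, sub_zero]; push_cast; rfl
    have e2 : ((y : ℂ) - (x - Complex.I))⁻¹ =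
        (((y - x : ℝ) : ℂ) - Complex.I) * ((1 + (y - x) ^ 2 : ℝ) : ℂ)⁻¹ := by
      have h1 : (y : ℂ) - (x - Complex.I) ≠ 0 := hxi y (by simp [closedUpperHalf])
      have h2 : ((1 + (y - x) ^ 2 : ℝ) : ℂ) ≠ 0 := by
        have : (1 + (y - x) ^ 2 : ℝ) ≠ 0 := by positivity
        exact_mod_cast this
      rw [inv_eq_iff_eq_inv, mul_inv, inv_inv, inv_mul_eq_div, eq_div_iff]
      · push_cast
        ring_nf
        simp
        ring
      · intro h
        have := congrArg Complex.im h
        simp at this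
    have e3 : (f y).im = (F y).im - ((F x).im + (F x).re * (y - x)) * (1 + (y - x) ^ 2)⁻¹ := by
      simp only [hf, e2]
      rw [Complex.sub_im, ← Complex.ofReal_inv]
      have : F x * (Complex.I * ((((y - x : ℝ) : ℂ) - Complex.I) * (((1 + (y - x) ^ 2)⁻¹ : ℝ) : ℂ)))
        = (F x * (Complex.I * (((y - x : ℝ) : ℂ) - Complex.I))) * (((1 + (y - x) ^ 2)⁻¹ : ℝ) : ℂ) := by
          ring
      rw [this, Complex.im_mul_ofReal]
      simp
      left; ring
    rw [e1, Complex.div_ofReal_im, e3]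
    have : (1 + (y - x) ^ 2 : ℝ) ≠ 0 := by positivity
    field_simp
    ring
  have hcauchy : Integrable fun y : ℝ => (1 + (y - x) ^ 2)⁻¹ :=
    integrable_inv_one_add_sq.comp_sub_right x
  -- Continuity handles the neighbourhood of `x`; for `|y - x| > 1` the explicit formula and the
  -- integrability of `Im F` apply.
  have hGint : Integrable fun y : ℝ => (G y).im := by
    obtain ⟨B, hB⟩ := (isCompact_Icc (a := x - 1) (b := x + 1)).exists_bound_of_continuousOn
      (f := fun y : ℝ => (G y).im) hGimc.continuousOn
    have hdom : Integrable fun y : ℝ => (Set.Icc (x - 1) (x + 1)).indicator (fun _ => B) y +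
        (|(F y).im| + (|(F x).im| * (1 + (y - x) ^ 2)⁻¹ + |(F x).re| * (1 + (y - x) ^ 2)⁻¹)) := by
      refine Integrable.add ?_ (hint.abs.add ((hcauchy.const_mul _).add (hcauchy.const_mul _)))
      rw [integrable_indicator_iff measurableSet_Icc]
      exact integrableOn_const (by simp)
    refine hdom.mono' hGimc.aestronglyMeasurable (ae_of_all _ fun y => ?_)
    by_cases hy : y ∈ Set.Icc (x - 1) (x + 1)
    · rw [Set.indicator_of_mem hy]
      refine (hB y hy).trans ?_
      have : 0 ≤ |(F y).im| + (|(F x).im| * (1 + (y - x) ^ 2)⁻¹ +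
        |(F x).re| * (1 + (y - x) ^ 2)⁻¹) := by positivity
      linarith
    · rw [Set.indicator_of_notMem hy, zero_add]
      have hv : 1 < |y - x| := by
        rw [lt_abs]
        simp only [Set.mem_Icc, not_and_or, not_le] at hy
        rcases hy with h | h
        · right; linarith
        · left; linarith
      have hyx : y ≠ x := by rintro rfl; simp at hv; linarith
      have e := hGim y hyx
      have e' : (G y).im = -(F y).im / (x - y) -
        ((F x).im / ((y - x) * (1 + (y - x) ^ 2)) + (F x).re * (1 + (y - x) ^ 2)⁻¹) := by linarith
      rw [e', Real.norm_eq_abs]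
      refine (abs_sub _ _).trans (add_le_add ?_ ((abs_add_le _ _).trans (add_le_add ?_ ?_)))
      · rw [abs_div, abs_neg, abs_sub_comm x y]
        exact div_le_self (abs_nonneg _) hv.le
      · rw [abs_div, abs_mul, abs_of_pos (by positivity : (0:ℝ) < 1 + (y - x) ^ 2), div_eq_mul_inv]
        gcongr
        nlinarith [sq_nonneg (y - x)]
      · rw [abs_mul, abs_of_pos (by positivity : (0:ℝ) < (1 + (y - x) ^ 2)⁻¹)]
  have hGzero : ∫ y : ℝ, (G y).im = 0 := by
    refine tendsto_nhds_unique (intervalIntegral_tendsto_integral hGint tendsto_neg_atTop_atBot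
      tendsto_id) ?_
    have h1 := (Complex.continuous_im.tendsto 0).comp hlim
    refine h1.congr fun R => ?_
    have := intervalIntegral.intervalIntegral_eq_integral_uIoc (fun y : ℝ => G y) (-R) R volume
    exact (Complex.imCLM.intervalIntegral_comp_comm (hGc.intervalIntegrable (-R) R)).symm
  have hmain : Integrable fun y : ℝ => (G y).im + (F x).re * (1 + (y - x) ^ 2)⁻¹ :=
    hGint.add (hcauchy.const_mul _)
  have hval : ∫ y : ℝ, ((G y).im + (F x).re * (1 + (y - x) ^ 2)⁻¹) = Real.pi * (F x).re := by
    rw [integral_add hGint (hcauchy.const_mul _), hGzero, integral_const_mul,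
      integral_sub_right_eq_self (fun y : ℝ => (1 + y ^ 2)⁻¹) x, integral_univ_inv_one_add_sq]
    ring
  have hl := (tendsto_setIntegral_punctured hmain x).const_mul (1 / Real.pi)
  rw [hval, ← mul_assoc, one_div_mul_cancel Real.pi_pos.ne', one_mul] at hl
  refine hl.congr' ?_
  filter_upwards [self_mem_nhdsWithin] with ε hε
  have hε' : 0 < ε := hε
  have hms : MeasurableSet {y : ℝ | ε < |x - y|} :=
    (isOpen_lt continuous_const (by fun_prop)).measurableSet
  congr 1
  have hodd : ∫ y in {y : ℝ | ε < |x - y|}, (F x).im / ((y - x) * (1 + (y - x) ^ 2)) = 0 := by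
    apply setIntegral_punctured_odd
    intro y
    have : (2 * x - y - x) = -(y - x) := by ring
    rw [this, neg_sq, neg_mul, div_neg]
  have hoddint : IntegrableOn (fun y => (F x).im / ((y - x) * (1 + (y - x) ^ 2)))
      {y : ℝ | ε < |x - y|} := by
    refine Integrable.mono' ((hcauchy.const_mul (|(F x).im| * ε⁻¹)).integrableOn) ?_ ?_
    · refine Measurable.aestronglyMeasurable ?_
      fun_prop
    · refine (ae_restrict_iff' hms).mpr (ae_of_all _ fun y hy => ?_)
      have hy' : ε < |y - x| := by rw [abs_sub_comm]; exact hy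
      rw [Real.norm_eq_abs, abs_div, abs_mul, abs_of_pos (by positivity : (0:ℝ) < 1 + (y - x) ^ 2),
        div_eq_mul_inv, mul_inv, ← mul_assoc]
      gcongr
  calc _ = ∫ y in {y : ℝ | ε < |x - y|}, ((G y).im + (F x).re * (1 + (y - x) ^ 2)⁻¹) +
        (F x).im / ((y - x) * (1 + (y - x) ^ 2)) := by
        rw [integral_add hmain.integrableOn hoddint, hodd, add_zero]
    _ = _ := by
        refine setIntegral_congr_fun hms fun y hy => ?_
        have hyx : y ≠ x := by
          rintro rfl
          simp at hy
          linarith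
        rw [hGim y hyx]
        ring

/-- A holomorphic function in a neighbourhood of the closed upper half-plane that vanishes at
infinity is the Cauchy transform of minus its imaginary part. -/
theorem eq_cauchyTransform_of_analytic {F : ℂ → ℂ} (hF : AnalyticOnNhd ℂ F closedUpperHalf)
    (h0 : Tendsto F (Bornology.cobounded ℂ ⊓ 𝓟 closedUpperHalf) (𝓝 0))
    (hint : Integrable fun x : ℝ => (F x).im) {z : ℂ} (hz : 0 < z.im) :
    F z = cauchyTransform (fun x => -(F x).im) z := by
  set zb := starRingEnd ℂ z with hzb
  have hne : ∀ w ∈ closedUpperHalf, w - zb ≠ 0 := by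
    intro w hw h
    have := congrArg Complex.im h
    simp [hzb] at this
    have hw' : 0 ≤ w.im := hw
    linarith
  have hzm : z ∈ closedUpperHalf := hz.le
  set k : ℂ := 2 * Complex.I * z.im with hk
  have hkz : z - zb = k := by
    apply Complex.ext <;> simp [hk, hzb]; ring
  have hinv : AnalyticOnNhd ℂ (fun w => (w - zb)⁻¹) closedUpperHalf := fun w hw =>
    (analyticAt_id.sub analyticAt_const).inv (hne w hw)
  set f : ℂ → ℂ := fun w => F w - F z * (k * (w - zb)⁻¹) with hf
  have hfan : AnalyticOnNhd ℂ f closedUpperHalf := fun w hw =>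
    (hF w hw).sub (analyticAt_const.mul (analyticAt_const.mul (hinv w hw)))
  have hfz : f z = 0 := by
    have hk0 : k ≠ 0 := by rw [← hkz]; exact hne z hzm
    simp only [hf, hkz]
    rw [mul_inv_cancel₀ hk0]; ring
  have hf0 : Tendsto f (Bornology.cobounded ℂ ⊓ 𝓟 closedUpperHalf) (𝓝 0) := by
    have := h0.sub ((((tendsto_inv_sub_cobounded zb).const_mul k).const_mul (F z)).mono_left
      inf_le_left)
    simpa using this
  obtain ⟨hG, hlim⟩ := tendsto_integral_dslope hfan hzm hfz hf0
  -- `Re F` need not be integrable. Subtracting the conjugate of this second vanishing integral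
  -- removes it: only `Im F` and a multiple of the Poisson kernel remain, both integrable.
  have hlim2 : Tendsto (fun R : ℝ => ∫ x in (-R)..R, F x * ((x : ℂ) - zb)⁻¹) atTop (𝓝 0) := by
    refine tendsto_integral_symm_of_mul_tendsto_zero (h := fun w => F w * (w - zb)⁻¹)
      (fun w hw => ((hF w hw).mul (hinv w hw)).differentiableAt.differentiableWithinAt) ?_
    have h1 : Tendsto (fun w : ℂ => 1 + zb * (w - zb)⁻¹) (Bornology.cobounded ℂ) (𝓝 1) := by
      have := ((tendsto_inv_sub_cobounded zb).const_mul zb).const_add 1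
      simpa using this
    have h2 := (h1.mono_left inf_le_left).mul h0
    rw [mul_zero] at h2
    refine h2.congr' ?_
    rw [EventuallyEq, eventually_inf_principal]
    filter_upwards with w hw
    have := hne w hw
    field_simp
    ring
  have hcF := continuous_ofReal_of_analytic hF
  have hc2 : Continuous fun x : ℝ => F x * ((x : ℂ) - zb)⁻¹ :=
    continuous_ofReal_of_analytic fun w hw => (hF w hw).mul (hinv w hw)
  have hc1 : Continuous fun x : ℝ => dslope f z x :=
    hG.continuousOn.comp_continuous Complex.continuous_ofReal fun y => by simp [closedUpperHalf]
  have hlim3 := (Complex.continuous_conj.tendsto 0).comp hlim2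
  have hlim4 := hlim.sub hlim3
  have hpt : ∀ x : ℝ, dslope f z x - starRingEnd ℂ (F x * ((x : ℂ) - zb)⁻¹) =
      2 * Complex.I * (((-(F x).im : ℝ) : ℂ) / (z - x)) -
        2 * Complex.I * F z * ((z.im / ‖z - x‖ ^ 2 : ℝ) : ℂ) := by
    intro x
    have hzx : z - x ≠ 0 := sub_ofReal_ne_zero hz x
    have hxz : (x : ℂ) ≠ z := fun h => hzx (by rw [h, sub_self])
    have hxz' : (x : ℂ) - z ≠ 0 := sub_ne_zero.mpr hxz
    have hxb : (x : ℂ) - zb ≠ 0 := hne x (by simp [closedUpperHalf])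
    have hN : ((‖z - x‖ ^ 2 : ℝ) : ℂ) = ((x : ℂ) - z) * ((x : ℂ) - zb) := by
      rw [← Complex.normSq_eq_norm_sq, ← Complex.mul_conj]
      simp [hzb]; ring
    have hFc : starRingEnd ℂ (F x) = F x - 2 * Complex.I * ((F x).im : ℂ) := by
      apply Complex.ext <;> simp; ring
    rw [dslope_of_ne _ hxz, slope_def_field, hfz, sub_zero, map_mul, map_inv₀, map_sub,
      Complex.conj_ofReal, hzb, Complex.conj_conj, hFc]
    simp only [hf, hk]
    rw [Complex.ofReal_div, hN]
    push_cast
    have h5 : z - (x : ℂ) = -((x : ℂ) - z) := by ring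
    rw [h5]
    field_simp
    ring
  have hint1 : Integrable fun x : ℝ => 2 * Complex.I * (((-(F x).im : ℝ) : ℂ) / (z - x)) :=
    (integrable_cauchy hint.neg hz).const_mul _
  have hint2 : Integrable fun x : ℝ => 2 * Complex.I * F z * ((z.im / ‖z - x‖ ^ 2 : ℝ) : ℂ) :=
    (integrable_ofReal_complex (integrable_poisson hz)).const_mul _
  have hlim5 := intervalIntegral_tendsto_integral (hint1.sub hint2) tendsto_neg_atTop_atBot
    tendsto_id
  have hfin : ∫ x : ℝ, (2 * Complex.I * (((-(F x).im : ℝ) : ℂ) / (z - x)) -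
        2 * Complex.I * F z * ((z.im / ‖z - x‖ ^ 2 : ℝ) : ℂ)) = 0 := by
    refine tendsto_nhds_unique hlim5 ?_
    rw [map_zero, sub_zero] at hlim4
    refine hlim4.congr fun R => ?_
    have hconj : starRingEnd ℂ (∫ x in (-R)..R, F x * ((x : ℂ) - zb)⁻¹) =
        ∫ x in (-R)..R, starRingEnd ℂ (F x * ((x : ℂ) - zb)⁻¹) :=
      (Complex.conjCLE.toContinuousLinearMap.intervalIntegral_comp_comm
        (hc2.intervalIntegrable (-R) R)).symm
    simp only [Function.comp, hconj, id]
    have hc3 : Continuous fun x : ℝ => starRingEnd ℂ (F x * ((x : ℂ) - zb)⁻¹) :=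
      Complex.continuous_conj.comp hc2
    rw [← intervalIntegral.integral_sub (hc1.intervalIntegrable _ _)
      (hc3.intervalIntegrable _ _)]
    refine intervalIntegral.integral_congr fun x _ => ?_
    simp only [Pi.sub_apply]
    exact hpt x
  rw [integral_sub hint1 hint2, integral_const_mul, integral_const_mul, integral_complex_ofReal,
    integral_poisson hz] at hfin
  have hpi : (Real.pi : ℂ) ≠ 0 := by exact_mod_cast Real.pi_pos.ne'
  have h2I : (2 * Complex.I : ℂ) ≠ 0 := by simp
  have h6 : 2 * Complex.I * ((∫ x : ℝ, ((-(F x).im : ℝ) : ℂ) / (z - x)) - F z * Real.pi) = 0 := by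
    rw [mul_sub, ← mul_assoc]; exact hfin
  have h7 := (mul_eq_zero.mp h6).resolve_left h2I
  rw [cauchyTransform, sub_eq_zero.mp h7]
  field_simp

/-- `w/(w - s)` is bounded by `K` in the sector `‖w‖ ≤ K Im w` and tends to `1`. This reads the mass
off the behaviour at infinity, for conservation of mass and for the long-time limit. -/
theorem tendsto_mul_cauchyTransform {ρ : ℝ → ℝ} (hρ : Integrable ρ) {ι : Type*} {l : Filter ι}
    [l.IsCountablyGenerated] {w : ι → ℂ} {K : ℝ} (hw : Tendsto w l (Bornology.cobounded ℂ))
    (hK : ∀ᶠ i in l, 0 < (w i).im ∧ ‖w i‖ ≤ K * (w i).im) :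
    Tendsto (fun i => w i * cauchyTransform ρ (w i)) l (𝓝 ((∫ s, ρ s : ℝ) / Real.pi)) := by
  have h : Tendsto (fun i => ∫ s : ℝ, (ρ s : ℂ) * (w i / (w i - s))) l
      (𝓝 (∫ s : ℝ, (ρ s : ℂ) * 1)) := by
    refine tendsto_integral_filter_of_dominated_convergence (fun s => |ρ s| * K) ?_ ?_
      (hρ.abs.mul_const K) ?_
    · filter_upwards [hK] with i hi
      have := ((integrable_cauchy hρ hi.1).mul_const (w i)).1
      refine this.congr (ae_of_all _ fun s => ?_)
      simp only; ring
    · filter_upwards [hK] with i hi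
      refine ae_of_all _ fun s => ?_
      rw [norm_mul, Complex.norm_real, Real.norm_eq_abs, norm_div]
      refine mul_le_mul_of_nonneg_left ?_ (abs_nonneg _)
      have h1 := im_le_norm_sub_ofReal (w i) s
      have h2 := norm_sub_ofReal_pos hi.1 s
      rw [div_le_iff₀ h2]
      have hK0 : 0 ≤ K := by
        by_contra hneg
        have : K * (w i).im < 0 := mul_neg_of_neg_of_pos (not_le.mp hneg) hi.1
        linarith [hi.2, norm_nonneg (w i)]
      exact hi.2.trans (mul_le_mul_of_nonneg_left h1 hK0)
    · refine ae_of_all _ fun s => tendsto_const_nhds.mul ?_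
      have h1 : Tendsto (fun i => 1 + (s : ℂ) * (w i - s)⁻¹) l (𝓝 1) := by
        have := (((tendsto_inv_sub_cobounded (s : ℂ)).comp hw).const_mul (s : ℂ)).const_add 1
        simpa using this
      refine h1.congr' ?_
      filter_upwards [hK] with i hi
      have := sub_ofReal_ne_zero hi.1 s
      field_simp
      ring
  have h2 := h.const_mul (1 / (Real.pi : ℂ))
  have e : (1 / (Real.pi : ℂ)) * ∫ s : ℝ, (ρ s : ℂ) * 1 = (∫ s, ρ s : ℝ) / Real.pi := by
    simp_rw [mul_one]
    rw [integral_complex_ofReal]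
    ring
  rw [e] at h2
  refine h2.congr fun i => ?_
  rw [cauchyTransform, mul_left_comm, ← integral_const_mul (w i)]
  congr 2; ext s
  ring

end Plemelj

/-! ### The half-Laplacian of a boundary value -/

section FracLaplacian

/-- For `ξ ≤ 0` the factor `exp(-2πi ξ z)` is bounded in the upper half-plane, so the Fourier
transform of `F'` vanishes at `ξ`. With `F' = v - iρ'` this gives `v̂ = i (2πi ξ) ρ̂ = |2πξ| ρ̂`
there; positive frequencies follow by conjugation, as `v` and `ρ` are real. -/
theorem isFracLaplacian_of_analytic {F : ℂ → ℂ} (hF : AnalyticOnNhd ℂ F closedUpperHalf) {B : ℝ}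
    (hB : ∀ z ∈ closedUpperHalf, ‖deriv F z‖ ≤ B)
    (hint : Integrable fun x : ℝ => (F x).im)
    (hint' : Integrable fun x : ℝ => deriv F x) :
    IsFracLaplacian 1 (fun x => -(F x).im) (fun x => (deriv F x).re) := by
  have hmem : ∀ x : ℝ, (x : ℂ) ∈ closedUpperHalf := fun x => by simp [closedUpperHalf]
  have hF' : AnalyticOnNhd ℂ (deriv F) closedUpperHalf := fun z hz => (hF z hz).deriv
  have hcF' := continuous_ofReal_of_analytic hF'
  have hv : Continuous fun x : ℝ => (deriv F x).re := Complex.continuous_re.comp hcF'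
  have hvint : Integrable fun x : ℝ => (deriv F x).re := hint'.re
  -- the derivative of the density
  have hder : ∀ x : ℝ, HasDerivAt (fun x : ℝ => ((-(F x).im : ℝ) : ℂ)) ((-(deriv F x).im : ℝ) : ℂ) x := by
    intro x
    have h1 : HasDerivAt (fun x : ℝ => F x) (deriv F x) x :=
      ((hF x (hmem x)).differentiableAt.hasDerivAt).comp_ofReal
    have h2 : HasDerivAt (fun x : ℝ => (F x).im) ((deriv F x).im) x :=
      Complex.imCLM.hasFDerivAt.comp_hasDerivAt x h1
    exact h2.neg.ofReal_comp
  have hderiv : deriv (fun x : ℝ => ((-(F x).im : ℝ) : ℂ)) = fun x : ℝ => ((-(deriv F x).im : ℝ) : ℂ) :=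
    funext fun x => (hder x).deriv
  have hρint : Integrable fun x : ℝ => ((-(F x).im : ℝ) : ℂ) := integrable_ofReal_complex hint.neg
  have hρ'int : Integrable fun x : ℝ => ((-(deriv F x).im : ℝ) : ℂ) :=
    integrable_ofReal_complex (ρ := fun x : ℝ => -(deriv F x).im) hint'.im.neg
  have hfd := Real.fourier_deriv hρint (fun x => (hder x).differentiableAt)
    (by rw [hderiv]; exact hρ'int)
  rw [hderiv] at hfd
  have hzero : ∀ ξ : ℝ, ξ ≤ 0 → 𝓕 (fun x : ℝ => deriv F x) ξ = 0 := by
    intro ξ hξ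
    rw [Real.fourier_real_eq_integral_exp_smul]
    have h1 : ∀ x : ℝ, Complex.exp (((-2 * Real.pi * x * ξ : ℝ) : ℂ) * Complex.I) • deriv F x =
        (fun z : ℂ => Complex.exp (-2 * Real.pi * ξ * Complex.I * z) * deriv F z) x := by
      intro x
      simp only [smul_eq_mul]
      congr 2
      push_cast; ring
    simp_rw [h1]
    have hexp : ∀ z ∈ closedUpperHalf, ‖Complex.exp (-2 * Real.pi * ξ * Complex.I * z)‖ ≤ 1 := by
      intro z hz
      have hz' : 0 ≤ z.im := hz
      rw [Complex.norm_exp, Real.exp_le_one_iff]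
      have : (-2 * Real.pi * ξ * Complex.I * z : ℂ) =
          ((-2 * Real.pi * ξ : ℝ) : ℂ) * (Complex.I * z) := by push_cast; ring
      rw [this, Complex.re_ofReal_mul]
      simp only [Complex.mul_re, Complex.I_re, Complex.I_im]
      have := mul_nonneg Real.pi_pos.le hz'
      nlinarith
    apply integral_eq_zero_of_bounded (B := B)
      (h := fun z : ℂ => Complex.exp (-2 * Real.pi * ξ * Complex.I * z) * deriv F z)
    · refine DifferentiableOn.mul (by fun_prop) fun z hz =>
        (hF' z hz).differentiableAt.differentiableWithinAt
    · intro z hz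
      rw [norm_mul]
      calc _ ≤ 1 * B := mul_le_mul (hexp z hz) (hB z hz) (norm_nonneg _) zero_le_one
        _ = B := one_mul B
    · refine hint'.norm.mono' ?_ (ae_of_all _ fun x => ?_)
      · refine Continuous.aestronglyMeasurable ?_
        exact Continuous.mul (by fun_prop) hcF'
      · rw [norm_mul]
        exact mul_le_of_le_one_left (norm_nonneg _) (hexp x (hmem x))
  have hneg : ∀ ξ : ℝ, ξ ≤ 0 → 𝓕 (fun x : ℝ => ((deriv F x).re : ℂ)) ξ =
      ((|2 * Real.pi * ξ| ^ (1:ℝ) : ℝ) : ℂ) * 𝓕 (fun x : ℝ => ((-(F x).im : ℝ) : ℂ)) ξ := by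
    intro ξ hξ
    have h1 : 𝓕 (fun x : ℝ => ((deriv F x).re : ℂ)) ξ = 𝓕 (fun x : ℝ => deriv F x) ξ +
        Complex.I * 𝓕 (fun x : ℝ => ((-(deriv F x).im : ℝ) : ℂ)) ξ := by
      simp only [Real.fourier_real_eq_integral_exp_smul]
      have hb : ∀ {h : ℝ → ℂ}, Integrable h → Integrable fun x : ℝ =>
          Complex.exp (((-2 * Real.pi * x * ξ : ℝ) : ℂ) * Complex.I) • h x := by
        intro h hh
        have hc : Continuous fun x : ℝ =>
            Complex.exp (((-2 * Real.pi * x * ξ : ℝ) : ℂ) * Complex.I) := by fun_prop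
        refine hh.norm.mono' (hc.aestronglyMeasurable.smul hh.1) (ae_of_all _ fun x => ?_)
        rw [norm_smul, Complex.norm_exp_ofReal_mul_I, one_mul]
      rw [← integral_const_mul, ← integral_add (hb hint') ((hb hρ'int).const_mul Complex.I)]
      congr 1; ext x
      have : deriv F x = ((deriv F x).re : ℂ) + (deriv F x).im * Complex.I :=
        (Complex.re_add_im _).symm
      nth_rw 2 [this]
      simp only [smul_eq_mul]
      push_cast
      ring
    rw [h1, hzero ξ hξ, zero_add, hfd, Real.rpow_one,
      abs_of_nonpos (by nlinarith [Real.pi_pos])]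
    simp only [smul_eq_mul]
    push_cast
    linear_combination (2 * Real.pi * ξ * 𝓕 (fun x : ℝ => (-((F x).im : ℂ))) ξ) * Complex.I_mul_I
  have hall : ∀ ξ : ℝ, 𝓕 (fun x : ℝ => ((deriv F x).re : ℂ)) ξ =
      ((|2 * Real.pi * ξ| ^ (1:ℝ) : ℝ) : ℂ) * 𝓕 (fun x : ℝ => ((-(F x).im : ℝ) : ℂ)) ξ := by
    intro ξ
    rcases le_total ξ 0 with h | h
    · exact hneg ξ h
    · have h1 := congrArg (starRingEnd ℂ) (hneg (-ξ) (by linarith))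
      rw [map_mul, Complex.conj_ofReal, ← fourier_neg_of_real (fun x => (deriv F x).re),
        ← fourier_neg_of_real (fun x => -(F x).im), neg_neg, mul_neg, abs_neg] at h1
      exact h1
  refine ⟨hv, fun φ => ⟨?_, ?_⟩⟩
  · have hb : Integrable (fun x : ℝ => 𝓕 (φ : ℝ → ℂ) x) := by
      rw [← SchwartzMap.fourier_coe]; exact (𝓕 φ).integrable
    refine hb.bdd_mul (c := B) (Complex.continuous_ofReal.comp hv).aestronglyMeasurable
      (ae_of_all _ fun x => ?_)
    rw [Complex.norm_real]
    exact (Complex.abs_re_le_norm _).trans (hB x (hmem x))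
  · rw [← integral_fourier_mul_eq_flip (integrable_ofReal_complex hvint) φ.integrable]
    congr 1; ext ξ
    rw [hall]

end FracLaplacian

/-! ### Auxiliary facts on traces, times and real parts -/

theorem traceDensity_solg (γ ν : ℝ) (ρ : ℝ → ℝ) (t x : ℝ) :
    traceDensity γ (solg γ ν ρ) t x = -(solf γ ν ρ t x).im := by
  simp [traceDensity, solg]

theorem traceVelocity_solg (γ ν : ℝ) (ρ : ℝ → ℝ) (t x : ℝ) :
    traceVelocity γ (solg γ ν ρ) t x = (solf γ ν ρ t x).re := by
  simp [traceVelocity, solg]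

theorem mem_times_of_le {T : EReal} {t t₁ : ℝ} (h₁ : t₁ ∈ times T) (h : 0 < t) (hle : t ≤ t₁) :
    t ∈ times T :=
  ⟨h, lt_of_le_of_lt (by exact_mod_cast hle) h₁.2⟩

theorem lifespan_pos {γ ν μ : ℝ} (hγ : 0 < γ) (hμ : 0 ≤ μ) (hμν : μ < ν) :
    (0 : EReal) < lifespan γ ν μ := by
  unfold lifespan
  split_ifs with h
  · exact EReal.coe_lt_top 0
  · have hμ' : 0 < μ := lt_of_le_of_ne hμ (Ne.symm h)
    have h1 : 1 < ν / μ := (one_lt_div hμ').mpr hμν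
    have h2 : 2 * ν / μ = ν / μ + ν / μ := by ring
    have : 0 < 1 / γ * Real.log (2 * ν / μ - 1) :=
      mul_pos (by positivity) (Real.log_pos (by linarith))
    exact_mod_cast this

theorem isOpen_times (T : EReal) : IsOpen (times T) :=
  (isOpen_lt continuous_const continuous_id).inter
    (isOpen_lt continuous_coe_real_ereal continuous_const)

theorem eventually_mem_times {T : EReal} (hT : 0 < T) : ∀ᶠ t in 𝓝[>] (0 : ℝ), t ∈ times T := by
  have h1 : {t : ℝ | (t : EReal) < T} ∈ 𝓝 (0 : ℝ) :=
    (isOpen_lt continuous_coe_real_ereal continuous_const).mem_nhds (by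
      show ((0 : ℝ) : EReal) < T
      exact_mod_cast hT)
  filter_upwards [self_mem_nhdsWithin, mem_nhdsWithin_of_mem_nhds h1] with t h2 h3
  exact ⟨h2, h3⟩

theorem iteratedDeriv_clm_comp {h : ℝ → ℂ} {t : ℝ} (hh : ContDiffAt ℝ ∞ h t) (L : ℂ →L[ℝ] ℝ)
    (k : ℕ) : iteratedDeriv k (fun τ => L (h τ)) t = L (iteratedDeriv k h t) := by
  rw [iteratedDeriv_eq_iteratedFDeriv, iteratedDeriv_eq_iteratedFDeriv]
  have := L.iteratedFDeriv_comp_left hh (i := k) (by exact_mod_cast le_top)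
  simp only [Function.comp_def] at this
  rw [this]
  rfl

theorem analyticAt_ofReal_comp {h : ℂ → ℂ} {x : ℝ} (hh : AnalyticAt ℂ h x) (L : ℂ →L[ℝ] ℝ) :
    AnalyticAt ℝ (fun y : ℝ => L (h y)) x := by
  have h1 : AnalyticAt ℝ h (Complex.ofRealCLM x) := hh.restrictScalars
  have h2 : AnalyticAt ℝ (fun y : ℝ => h (Complex.ofRealCLM y)) x :=
    AnalyticAt.fun_comp h1 (Complex.ofRealCLM.analyticAt x)
  exact AnalyticAt.fun_comp (L.analyticAt _) h2

/-! ### The trace of the explicit solution -/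

section Trace

variable {ρ : ℝ → ℝ} {γ ν μ M : ℝ} (hγ : 0 < γ) (hμ : 0 ≤ μ) (hμν : μ < ν) (hρ : Integrable ρ)
  (hlow : ∀ᵐ x, -μ ≤ ρ x) (hM : ∀ z ∈ upperHalf, ‖cauchyTransform ρ z‖ ≤ M)

section
include hγ hμ hμν hρ hlow

theorem analyticOnNhd_solf {t : ℝ} (ht : t ∈ times (lifespan γ ν μ)) :
    AnalyticOnNhd ℂ (solf γ ν ρ t) closedUpperHalf := fun _ hz =>
  (hasAnalyticExt_solf hγ hμ hρ hlow ht.1 (admissible_of_mem hγ hμ hμν ht hz)).analyticAt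

/-- The bound `μ'` is independent of the `μ` that governs the lifespan, so that `μ' = 0` gives
positivity on the same time interval. -/
theorem neg_im_solf_ge {t : ℝ} (ht : t ∈ times (lifespan γ ν μ)) {μ' : ℝ}
    (hlow' : ∀ᵐ x, -μ' ≤ ρ x) (x : ℝ) :
    -μ' * Real.exp (γ * t) ≤ -(solf γ ν ρ t x).im := by
  rw [solf, Complex.im_ofReal_mul]
  have h1 := im_cauchyTransform_le hρ hlow'
    (foot_im_pos hγ hμ hμν hρ hlow ht (z := x) (by simp))
  have := Real.exp_pos (γ * t)
  nlinarith

theorem analytic_iteratedDeriv_traceDensity {t : ℝ} (ht : t ∈ times (lifespan γ ν μ)) (k : ℕ) :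
    AnalyticOnNhd ℝ
      (fun x => iteratedDeriv k (fun τ => traceDensity γ (solg γ ν ρ) τ x) t) Set.univ := by
  intro x _
  have hadm : ∀ y : ℝ, Admissible γ ν μ t y := fun y =>
    admissible_of_mem hγ hμ hμν ht (by simp)
  have h1 : ∀ y : ℝ, iteratedDeriv k (fun τ => traceDensity γ (solg γ ν ρ) τ y) t =
      (-Complex.imCLM) (iteratedDeriv k (fun τ => solf γ ν ρ τ y) t) := by
    intro y
    rw [← iteratedDeriv_clm_comp
      ((hasAnalyticExt_solf hγ hμ hρ hlow ht.1 (hadm y)).contDiffAt_fst ∞)]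
    simp_rw [traceDensity_solg]
    rfl
  simp_rw [h1]
  exact analyticAt_ofReal_comp
    ((hasAnalyticExt_solf hγ hμ hρ hlow ht.1 (hadm x)).iteratedDeriv k).analyticAt _

theorem hasDerivAt_solf_real {t : ℝ} (ht : t ∈ times (lifespan γ ν μ)) (x : ℝ) :
    HasDerivAt (fun y : ℝ => solf γ ν ρ t y) (deriv (solf γ ν ρ t) x) x :=
  ((analyticOnNhd_solf hγ hμ hμν hρ hlow ht x
    (by simp [closedUpperHalf])).differentiableAt.hasDerivAt).comp_ofReal

/-- The imaginary part of the equation of `f = u - iρ` at real points: `Im (f²/2) = -uρ`, the terms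
`γx ∂ₓf` and `γ f` combine into the divergence of `γxρ`, and `-iν ∂ₓf` leaves `ν ∂ₓu`. -/
theorem equation_traceDensity {t : ℝ} (ht : t ∈ times (lifespan γ ν μ)) (x : ℝ) :
    DifferentiableAt ℝ
      (fun y : ℝ => -(solf γ ν ρ t y).im * ((solf γ ν ρ t y).re - γ * y)) x ∧
    deriv (fun τ => -(solf γ ν ρ τ x).im) t +
      deriv (fun y : ℝ => -(solf γ ν ρ t y).im * ((solf γ ν ρ t y).re - γ * y)) x =
      -ν * (deriv (solf γ ν ρ t) x).re := by
  have h1 := hasDerivAt_solf_real hγ hμ hμν hρ hlow ht x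
  have him : HasDerivAt (fun y : ℝ => (solf γ ν ρ t y).im) (deriv (solf γ ν ρ t) x).im x :=
    Complex.imCLM.hasFDerivAt.comp_hasDerivAt x h1
  have hre : HasDerivAt (fun y : ℝ => (solf γ ν ρ t y).re) (deriv (solf γ ν ρ t) x).re x :=
    Complex.reCLM.hasFDerivAt.comp_hasDerivAt x h1
  have hγx : HasDerivAt (fun y : ℝ => γ * y) γ x := by
    simpa using (hasDerivAt_id x).const_mul γ
  have him' : HasDerivAt (fun y : ℝ => -(solf γ ν ρ t y).im) _ x := him.neg
  have hp : HasDerivAt (fun y : ℝ => -(solf γ ν ρ t y).im * ((solf γ ν ρ t y).re - γ * y))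
      _ x := him'.mul (hre.sub hγx)
  have ht1 := hasDerivAt_solf_fst hγ hμ hρ hlow ht.1
    (admissible_of_mem hγ hμ hμν ht (z := x) (by simp))
  have hti : HasDerivAt (fun τ => (solf γ ν ρ τ x).im) _ t :=
    Complex.imCLM.hasFDerivAt.comp_hasDerivAt t ht1
  refine ⟨hp.differentiableAt, ?_⟩
  have hti' : HasDerivAt (fun τ => -(solf γ ν ρ τ x).im) _ t := hti.neg
  rw [hp.deriv, hti'.deriv]
  simp
  ring

theorem contDiffOn_traceDensity :
    ContDiffOn ℝ 1 (fun p : ℝ × ℝ => traceDensity γ (solg γ ν ρ) p.1 p.2)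
      {p | p.1 ∈ times (lifespan γ ν μ)} := by
  intro p hp
  apply ContDiffAt.contDiffWithinAt
  simp_rw [traceDensity_solg]
  have h1 := (hasAnalyticExt_solf hγ hμ hρ hlow hp.1
    (admissible_of_mem hγ hμ hμν hp (z := p.2) (by simp))).contDiffAt 1
  have h2 : ContDiffAt ℝ 1 (fun p : ℝ × ℝ => (p.1, (p.2 : ℂ))) p :=
    contDiffAt_fst.prodMk (Complex.ofRealCLM.contDiff.contDiffAt.comp p contDiffAt_snd)
  have h3 : ContDiffAt ℝ 1 (fun p : ℝ × ℝ => solf γ ν ρ p.1 p.2) p :=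
    ContDiffAt.comp (f := fun p : ℝ × ℝ => (p.1, (p.2 : ℂ))) p h1 h2
  exact (Complex.imCLM.contDiff.contDiffAt.comp p h3).neg

include hM

theorem integrable_solf_im {t : ℝ} (ht : t ∈ times (lifespan γ ν μ)) :
    Integrable fun x : ℝ => (solf γ ν ρ t x).im := by
  have hc : 0 < 2 * ν / (Real.exp (γ * t) + 1) - μ := by
    have h1 := mul_exp_add_one_lt hγ hμ hμν ht.2
    have h2 := Real.exp_pos (γ * t)
    rw [sub_pos, lt_div_iff₀ (by linarith)]
    exact h1
  have hi := ((integrable_poissonConv (growth_pos hγ ht.1) hρ.abs).comp_mul_left'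
    (Real.exp_pos (γ * t)).ne')
  refine (hi.const_mul _).mono' ?_ (ae_of_all _ fun x =>
    abs_im_solf_le hγ hμ hμν hρ hlow hM ht hc le_rfl x)
  exact (Complex.continuous_im.comp (continuous_ofReal_of_analytic
    (analyticOnNhd_solf hγ hμ hμν hρ hlow ht))).aestronglyMeasurable

theorem integrable_deriv_solf {t : ℝ} (ht : t ∈ times (lifespan γ ν μ)) :
    Integrable fun x : ℝ => deriv (solf γ ν ρ t) x := by
  have hc : 0 < 2 * ν / (Real.exp (γ * t) + 1) - μ := by
    have h1 := mul_exp_add_one_lt hγ hμ hμν ht.2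
    have h2 := Real.exp_pos (γ * t)
    rw [sub_pos, lt_div_iff₀ (by linarith)]
    exact h1
  have hδ : 0 < lift γ ν t - growth γ t * μ := by
    linarith [growth_mul_lt_lift hγ hμ hμν ht.1 ht.2]
  have hi := ((integrable_poissonConv (growth_pos hγ ht.1) hρ.abs).comp_mul_left'
    (Real.exp_pos (γ * t)).ne')
  refine ((hi.const_mul _).const_mul _).mono' ?_ (ae_of_all _ fun x =>
    (norm_deriv_solf_le hγ hμ hμν hρ hlow ht (z := x) (by simp)).trans
      (mul_le_mul_of_nonneg_left
        (norm_cauchyDeriv_mul_im_foot_le hγ hμ hμν hρ hlow hM ht hc le_rfl x) (by positivity)))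
  exact (continuous_ofReal_of_analytic fun z hz =>
    (analyticOnNhd_solf hγ hμ hμν hρ hlow ht z hz).deriv).aestronglyMeasurable

theorem isHilbertTransform_solf {t : ℝ} (ht : t ∈ times (lifespan γ ν μ)) :
    IsHilbertTransform (fun x : ℝ => -(solf γ ν ρ t x).im) (fun x : ℝ => (solf γ ν ρ t x).re) :=
  isHilbertTransform_of_analytic (analyticOnNhd_solf hγ hμ hμν hρ hlow ht)
    (tendsto_solf_zero hγ hμ hμν hρ hlow hM ht) (integrable_solf_im hγ hμ hμν hρ hlow hM ht)

theorem isFracLaplacian_solf {t : ℝ} (ht : t ∈ times (lifespan γ ν μ)) :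
    IsFracLaplacian 1 (fun x : ℝ => -(solf γ ν ρ t x).im)
      (fun x : ℝ => (deriv (solf γ ν ρ t) x).re) :=
  isFracLaplacian_of_analytic (analyticOnNhd_solf hγ hμ hμν hρ hlow ht)
    (fun _ hz => norm_deriv_solf_le' hγ hμ hμν hρ hlow hM ht hz)
    (integrable_solf_im hγ hμ hμν hρ hlow hM ht) (integrable_deriv_solf hγ hμ hμν hρ hlow hM ht)

theorem solf_eq_cauchyTransform {t : ℝ} (ht : t ∈ times (lifespan γ ν μ)) {z : ℂ}
    (hz : 0 < z.im) :
    solf γ ν ρ t z = cauchyTransform (fun x => -(solf γ ν ρ t x).im) z :=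
  eq_cauchyTransform_of_analytic (analyticOnNhd_solf hγ hμ hμν hρ hlow ht)
    (tendsto_solf_zero hγ hμ hμν hρ hlow hM ht) (integrable_solf_im hγ hμ hμν hρ hlow hM ht) hz

/-- Compare `w Cσ(w) → (∫σ)/π` for the trace at `w = iy` with the same limit for `ρ₀` at the foot of
`iy`. By the root equation `exp(γt) iy` and the foot differ by a bounded amount, which is multiplied
by `f₀(foot) → 0`. -/
theorem integral_neg_im_solf {t : ℝ} (ht : t ∈ times (lifespan γ ν μ)) :
    ∫ x : ℝ, -(solf γ ν ρ t x).im = ∫ x, ρ x := by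
  set w : ℝ → ℂ := fun y => Complex.I * y with hw
  have hwim : ∀ y, (w y).im = y := fun y => by simp [hw]
  have hwn : ∀ y, ‖w y‖ = |y| := fun y => by simp [hw]
  have hwinf : Tendsto w atTop (Bornology.cobounded ℂ) := by
    rw [← tendsto_norm_atTop_iff_cobounded]
    simp_rw [hwn]
    exact tendsto_abs_atTop_atTop
  have hwc : Tendsto w atTop (Bornology.cobounded ℂ ⊓ 𝓟 closedUpperHalf) := by
    refine tendsto_inf.mpr ⟨hwinf, tendsto_principal.mpr ?_⟩
    filter_upwards [eventually_ge_atTop 0] with y hy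
    simpa [closedUpperHalf, hwim] using hy
  have hint : Integrable fun x : ℝ => -(solf γ ν ρ t x).im :=
    (integrable_solf_im hγ hμ hμν hρ hlow hM ht).neg
  have h1 := tendsto_mul_cauchyTransform (K := 1) hint hwinf (by
      filter_upwards [eventually_gt_atTop 0] with y hy
      rw [hwim, hwn, abs_of_pos hy, one_mul]
      exact ⟨hy, le_rfl⟩)
  have hZ := (tendsto_foot_cobounded hγ hμ hμν hρ hlow hM ht).comp hwc
  have hE := Real.exp_pos (γ * t)
  have hδ : 0 < lift γ ν t - growth γ t * μ := by
    linarith [growth_mul_lt_lift hγ hμ hμν ht.1 ht.2]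
  have ha := growth_pos hγ ht.1
  have h2 := tendsto_mul_cauchyTransform (K := 1 + (|lift γ ν t| + growth γ t * M + growth γ t * μ) /
      (lift γ ν t - growth γ t * μ)) hρ
    (hZ.mono_right inf_le_left) (by
      filter_upwards [eventually_gt_atTop 0] with y hy
      have hy0 : 0 ≤ (w y).im := by rw [hwim]; exact hy.le
      have g1 := foot_im_ge hγ hμ hμν hρ hlow ht hy0
      have g1' := foot_im_ge' hγ hμ hμν hρ hlow ht hy0
      have g2 := foot_im_pos hγ hμ hμν hρ hlow ht hy0
      have g3 := norm_foot_sub_base_le hγ hμ hμν hρ hlow hM ht hy0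
      simp only [Function.comp]
      refine ⟨g2, ?_⟩
      rw [hwim] at g1
      have g4 : ‖base γ ν t (w y)‖ ≤ Real.exp (γ * t) * y + |lift γ ν t| := by
        rw [base]
        refine (norm_add_le _ _).trans (le_of_eq ?_)
        rw [norm_mul, norm_mul, hwn, Complex.norm_I, one_mul, Complex.norm_real, Complex.norm_real,
          Real.norm_of_nonneg hE.le, Real.norm_eq_abs, abs_of_pos hy]
      have g5 : ‖foot γ ν ρ t (w y)‖ ≤ ‖base γ ν t (w y)‖ + ‖foot γ ν ρ t (w y) - base γ ν t (w y)‖ := by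
        have := norm_add_le (base γ ν t (w y)) (foot γ ν ρ t (w y) - base γ ν t (w y))
        rwa [add_sub_cancel] at this
      have hM0 : 0 ≤ M := (norm_nonneg _).trans (hM _ g2)
      have g6 : (|lift γ ν t| + growth γ t * M + growth γ t * μ) ≤
          (|lift γ ν t| + growth γ t * M + growth γ t * μ) / (lift γ ν t - growth γ t * μ) *
            (foot γ ν ρ t (w y)).im := by
        rw [div_mul_eq_mul_div, le_div_iff₀ hδ]
        exact mul_le_mul_of_nonneg_left g1' (by positivity)
      have := neg_abs_le (lift γ ν t)
      have g7 : Real.exp (γ * t) * y ≤ (foot γ ν ρ t (w y)).im := by linarith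
      rw [add_mul, one_mul]
      have := mul_nonneg ha.le hμ
      linarith)
  have hCZ := (tendsto_cauchyTransform_zero hρ hδ).comp hZ
  have h3 := h2.sub (((hCZ.const_mul (growth γ t : ℂ)).const_sub
    (Complex.I * (lift γ ν t : ℂ))).mul hCZ)
  simp only [mul_zero, sub_zero] at h3
  have h4 : ∀ᶠ y in atTop, w y * cauchyTransform (fun x => -(solf γ ν ρ t x).im) (w y) =
      foot γ ν ρ t (w y) * cauchyTransform ρ (foot γ ν ρ t (w y)) -
      (Complex.I * (lift γ ν t : ℂ) - growth γ t * cauchyTransform ρ (foot γ ν ρ t (w y))) *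
        cauchyTransform ρ (foot γ ν ρ t (w y)) := by
    filter_upwards [eventually_gt_atTop 0] with y hy
    have hy1 : 0 < (w y).im := by rw [hwim]; exact hy
    rw [← solf_eq_cauchyTransform hγ hμ hμν hρ hlow hM ht hy1, solf]
    have := (foot_spec hγ hμ hρ hlow ht.1.le (admissible_of_mem hγ hμ hμν ht hy1.le)).2
    rw [base] at this
    linear_combination (-cauchyTransform ρ (foot γ ν ρ t (w y))) * this
  have h5 := tendsto_nhds_unique (h1.congr' h4) h3
  have hpi : (Real.pi : ℂ) ≠ 0 := by exact_mod_cast Real.pi_pos.ne'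
  rw [div_left_inj' hpi] at h5
  exact_mod_cast h5

theorem tendsto_foot_zero (x : ℝ) :
    Tendsto (fun t => foot γ ν ρ t x) (𝓝[>] 0) (𝓝[closedUpperHalf] (x : ℂ)) := by
  have hev := eventually_mem_times (lifespan_pos hγ hμ hμν)
  refine tendsto_nhdsWithin_iff.mpr ⟨?_, ?_⟩
  · have hb : Tendsto (fun t => base γ ν t x) (𝓝 0) (𝓝 (base γ ν 0 x)) := by
      have : Continuous fun t => base γ ν t x :=
        (continuous_base γ ν).comp (Continuous.prodMk_left _)
      exact this.tendsto 0
    have hb0 : base γ ν 0 x = x := by simp [base, lift]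
    rw [hb0] at hb
    have hg : Tendsto (fun t => growth γ t * M) (𝓝 0) (𝓝 0) := by
      have := ((continuous_growth γ).tendsto 0).mul_const M
      simpa [growth] using this
    have hd : Tendsto (fun t => foot γ ν ρ t x - base γ ν t x) (𝓝[>] 0) (𝓝 0) := by
      refine squeeze_zero_norm' ?_ (hg.mono_left nhdsWithin_le_nhds)
      filter_upwards [hev] with t ht
      exact norm_foot_sub_base_le hγ hμ hμν hρ hlow hM ht (by simp)
    have := hd.add (hb.mono_left nhdsWithin_le_nhds)
    simpa using this
  · filter_upwards [hev] with t ht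
    exact (foot_im_pos hγ hμ hμν hρ hlow ht (z := x) (by simp)).le

theorem initial_traceDensity {Fc : ℂ → ℂ} (hFc : ContinuousOn Fc closedUpperHalf)
    (hFcC : ∀ z ∈ upperHalf, Fc z = cauchyTransform ρ z) (hFcρ : ∀ᵐ x : ℝ, -(Fc x).im = ρ x) :
    ∀ᵐ x : ℝ, Tendsto (fun t => -(solf γ ν ρ t x).im) (𝓝[>] 0) (𝓝 (ρ x)) := by
  have hev := eventually_mem_times (lifespan_pos hγ hμ hμν)
  filter_upwards [hFcρ] with x hx
  have h1 : Tendsto (fun t => Fc (foot γ ν ρ t x)) (𝓝[>] 0) (𝓝 (Fc x)) :=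
    (hFc x (by simp [closedUpperHalf])).tendsto.comp
      (tendsto_foot_zero hγ hμ hμν hρ hlow hM x)
  have hE : Tendsto (fun t => (Real.exp (γ * t) : ℂ)) (𝓝[>] 0) (𝓝 1) := by
    have : Continuous fun t => (Real.exp (γ * t) : ℂ) := by fun_prop
    have h2 := this.tendsto 0
    simp only [mul_zero, Real.exp_zero, Complex.ofReal_one] at h2
    exact h2.mono_left nhdsWithin_le_nhds
  have h3 : Tendsto (fun t => solf γ ν ρ t x) (𝓝[>] 0) (𝓝 (Fc x)) := by
    have h4 := hE.mul h1
    rw [one_mul] at h4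
    refine h4.congr' ?_
    filter_upwards [hev] with t ht
    rw [hFcC _ (foot_im_pos hγ hμ hμν hρ hlow ht (z := x) (by simp)), solf]
  rw [← hx]
  exact ((Complex.continuous_im.tendsto _).comp h3).neg

theorem eLpNorm_traceDensity_le (hρ2 : MemLp ρ 2) {t₁ : ℝ}
    (ht₁ : t₁ ∈ times (lifespan γ ν μ)) :
    ∃ C : NNReal, ∀ t : ℝ, 0 < t → t ≤ t₁ →
      eLpNorm (fun x : ℝ => -(solf γ ν ρ t x).im) 2 volume ≤ C := by
  -- The gap decreases in time, so its value at `t₁` serves for all `t ≤ t₁` and the bound is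
  -- uniform as `t → 0`.
  set c := 2 * ν / (Real.exp (γ * t₁) + 1) - μ with hcdef
  have hE₁ := Real.exp_pos (γ * t₁)
  have hν : 0 ≤ ν := hμ.trans hμν.le
  have hc : 0 < c := by
    have h1 := mul_exp_add_one_lt hγ hμ hμν ht₁.2
    rw [hcdef, sub_pos, lt_div_iff₀ (by linarith)]
    exact h1
  have hM0 : 0 ≤ M := (norm_nonneg _).trans (hM Complex.I (by simp [upperHalf]))
  set K := Real.exp (γ * t₁) * (1 / Real.pi) * ((ν + M) * (1 + (1 + M) / c) ^ 2) with hK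
  have hK0 : 0 ≤ K := by positivity
  refine ⟨Real.toNNReal (√(K ^ 2 * (Real.pi ^ 2 * ∫ s, ρ s ^ 2))), fun t ht htt => ?_⟩
  have htm := mem_times_of_le ht₁ ht htt
  have hE : Real.exp (γ * t) ≤ Real.exp (γ * t₁) :=
    Real.exp_le_exp.mpr (mul_le_mul_of_nonneg_left htt hγ.le)
  have hE1 : 1 ≤ Real.exp (γ * t) := Real.one_le_exp (mul_nonneg hγ.le ht.le)
  have hct : c ≤ 2 * ν / (Real.exp (γ * t) + 1) - μ := by
    rw [hcdef]; gcongr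
  set P := poissonConv (growth γ t) (fun s => |ρ s|) with hP
  have hPn : ∀ y, 0 ≤ P y := fun y => integral_nonneg fun s => by
    have := growth_pos hγ ht
    positivity
  have hb : ∀ x : ℝ, ‖-(solf γ ν ρ t x).im‖ ≤ K * P (Real.exp (γ * t) * x) := by
    intro x
    rw [norm_neg]
    refine (abs_im_solf_le hγ hμ hμν hρ hlow hM htm hc hct x).trans ?_
    refine mul_le_mul_of_nonneg_right ?_ (hPn _)
    rw [hK]; gcongr
  obtain ⟨hP2, hPle⟩ := memLp_poissonConv (growth_pos hγ ht) hρ hρ2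
  rw [← hP] at hP2
  have hPsq : Integrable fun x => (P (Real.exp (γ * t) * x)) ^ 2 :=
    hP2.integrable_sq.comp_mul_left' (by linarith)
  have hcont : Continuous fun x : ℝ => -(solf γ ν ρ t x).im :=
    (Complex.continuous_im.comp (continuous_ofReal_of_analytic
      (analyticOnNhd_solf hγ hμ hμν hρ hlow htm))).neg
  have hsq : ∀ x : ℝ, ‖-(solf γ ν ρ t x).im‖ ^ 2 ≤ K ^ 2 * (P (Real.exp (γ * t) * x)) ^ 2 := by
    intro x
    rw [← mul_pow]
    exact pow_le_pow_left₀ (norm_nonneg _) (hb x) 2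
  have hmem : MemLp (fun x : ℝ => -(solf γ ν ρ t x).im) 2 := by
    rw [memLp_two_iff_integrable_sq_norm hcont.aestronglyMeasurable]
    refine (hPsq.const_mul (K ^ 2)).mono' (hcont.norm.pow 2).aestronglyMeasurable
      (ae_of_all _ fun x => ?_)
    rw [Real.norm_of_nonneg (by positivity)]
    exact hsq x
  rw [eLpNorm_two_eq hmem]
  refine ENNReal.ofReal_le_ofReal (Real.sqrt_le_sqrt ?_)
  refine (integral_mono (hmem.integrable_norm_pow (by norm_num)) (hPsq.const_mul (K ^ 2))
    hsq).trans ?_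
  rw [integral_const_mul]
  refine mul_le_mul_of_nonneg_left ?_ (by positivity)
  refine le_trans ?_ hPle
  rw [Measure.integral_comp_mul_left (fun y => P y ^ 2), smul_eq_mul]
  refine mul_le_of_le_one_left (integral_nonneg fun y => by positivity) ?_
  rw [abs_of_pos (by positivity)]
  exact inv_le_one_of_one_le₀ hE1

theorem isAnalyticSolution_traceDensity (hρ2 : MemLp ρ 2) {Fc : ℂ → ℂ}
    (hFc : ContinuousOn Fc closedUpperHalf)
    (hFcC : ∀ z ∈ upperHalf, Fc z = cauchyTransform ρ z) (hFcρ : ∀ᵐ x : ℝ, -(Fc x).im = ρ x) :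
    IsAnalyticSolution 1 γ ν (lifespan γ ν μ) ρ (traceDensity γ (solg γ ν ρ)) := by
  have e : ∀ t, traceDensity γ (solg γ ν ρ) t = fun x : ℝ => -(solf γ ν ρ t x).im := fun t =>
    funext fun x => traceDensity_solg γ ν ρ t x
  refine ⟨fun t ht => ?_, contDiffOn_traceDensity hγ hμ hμν hρ hlow, fun t ht => ?_,
    fun t₁ ht₁ => ?_, fun t ht => ?_, ?_⟩
  · simpa using analytic_iteratedDeriv_traceDensity hγ hμ hμν hρ hlow ht 0
  · rw [e]; exact (integrable_solf_im hγ hμ hμν hρ hlow hM ht).neg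
  · simp_rw [e]; exact eLpNorm_traceDensity_le hγ hμ hμν hρ hlow hM hρ2 ht₁
  · simp_rw [e]
    exact ⟨_, _, isHilbertTransform_solf hγ hμ hμν hρ hlow hM ht,
      isFracLaplacian_solf hγ hμ hμν hρ hlow hM ht,
      fun x => equation_traceDensity hγ hμ hμν hρ hlow ht x⟩
  · simp_rw [e]; exact initial_traceDensity hγ hμ hμν hρ hlow hM hFc hFcC hFcρ

end

end Trace

/-! ### Uniqueness for the complex Burgers equation -/

/-- The derivative is available only for positive times, so Grönwall's inequality starts at `ε > 0`,
and continuity at `0` is used as `ε → 0`. -/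
theorem eq_zero_of_norm_deriv_le_mul {D D' : ℝ → ℂ} {K t : ℝ} (ht : 0 < t)
    (hc : ContinuousOn D (Set.Icc 0 t)) (hd : ∀ s ∈ Set.Ioo 0 t, HasDerivAt D (D' s) s)
    (h0 : D 0 = 0) (hb : ∀ s ∈ Set.Ioo 0 t, ‖D' s‖ ≤ K * ‖D s‖) : D t = 0 := by
  have h1 : ∀ ε ∈ Set.Ioo 0 t, ‖D t‖ ≤ ‖D ε‖ * Real.exp (K * (t - ε)) := by
    intro ε hε
    have := norm_le_gronwallBound_of_norm_deriv_right_le (f := D) (f' := D') (δ := ‖D ε‖) (K := K)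
      (ε := 0) (a := ε) (b := t) (hc.mono (Set.Icc_subset_Icc_left hε.1.le))
      (fun x hx => (hd x ⟨hε.1.trans_le hx.1, hx.2⟩).hasDerivWithinAt) le_rfl
      (fun x hx => by simpa using hb x ⟨hε.1.trans_le hx.1, hx.2⟩) t ⟨hε.2.le, le_rfl⟩
    rwa [gronwallBound_ε0] at this
  have h2 : Tendsto D (𝓝[>] 0) (𝓝 0) := by
    have := hc 0 ⟨le_rfl, ht.le⟩
    rw [ContinuousWithinAt, h0] at this
    refine this.mono_left ?_
    rw [← nhdsWithin_Ioo_eq_nhdsGT ht]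
    exact nhdsWithin_mono _ Set.Ioo_subset_Icc_self
  have h3 : Tendsto (fun ε => ‖D ε‖ * Real.exp (K * (t - ε))) (𝓝[>] 0) (𝓝 0) := by
    have h4 : Continuous fun ε : ℝ => Real.exp (K * (t - ε)) := by fun_prop
    have := h2.norm.mul ((h4.tendsto 0).mono_left (nhdsWithin_le_nhds (s := Set.Ioi 0)))
    simpa using this
  have h5 : ‖D t‖ ≤ 0 := by
    refine ge_of_tendsto h3 ?_
    filter_upwards [Ioo_mem_nhdsGT ht] with ε hε
    exact h1 ε hε
  exact norm_le_zero_iff.mp h5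

/-- Joint continuity makes `h τ` close to `h t` uniformly on a closed disc; Cauchy's estimate on
discs of half the radius passes this on to the derivatives. -/
theorem continuousAt_deriv_uncurry {h : ℝ → ℂ → ℂ} {U : Set (ℝ × ℂ)} (hU : IsOpen U)
    (hc : ContinuousOn (fun p : ℝ × ℂ => h p.1 p.2) U)
    (hd : ∀ p ∈ U, DifferentiableAt ℂ (h p.1) p.2) {p : ℝ × ℂ} (hp : p ∈ U) :
    ContinuousAt (fun q : ℝ × ℂ => deriv (h q.1) q.2) p := by
  obtain ⟨t, z⟩ := p
  obtain ⟨r, hr, hrU⟩ : ∃ r > 0, Metric.ball t r ×ˢ Metric.closedBall z r ⊆ U := by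
    obtain ⟨r, hr, h1⟩ := Metric.isOpen_iff.mp hU _ hp
    refine ⟨r / 2, by positivity, fun q hq => h1 ?_⟩
    rw [Metric.mem_ball, Prod.dist_eq, max_lt_iff]
    exact ⟨lt_trans hq.1 (by linarith), lt_of_le_of_lt hq.2 (by linarith)⟩
  have hzt : ∀ w ∈ Metric.ball z r, DifferentiableAt ℂ (h t) w := fun w hw =>
    hd (t, w) (hrU ⟨Metric.mem_ball_self hr, Metric.ball_subset_closedBall hw⟩)
  have hcd : ContinuousAt (deriv (h t)) z := by
    have : AnalyticAt ℂ (h t) z := Complex.analyticAt_iff_eventually_differentiableAt.mpr (by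
      filter_upwards [Metric.ball_mem_nhds z hr] with w hw using hzt w hw)
    exact this.deriv.continuousAt
  rw [Metric.continuousAt_iff']
  intro ε hε
  have hunif : ∀ᶠ τ in 𝓝 t, ∀ w ∈ Metric.closedBall z r, ‖h τ w - h t w‖ < ε / 2 * (r / 2) := by
    have := (isCompact_closedBall z r).eventually_forall_of_forall_eventually
      (x₀ := t) (P := fun (τ : ℝ) (w : ℂ) => ‖h τ w - h t w‖ < ε / 2 * (r / 2)) ?_
    · exact this
    · intro w hw
      have hwU : (t, w) ∈ U := hrU ⟨Metric.mem_ball_self hr, hw⟩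
      have h1 := (hc.continuousAt (hU.mem_nhds hwU)).tendsto
      have h2 : Tendsto (fun q : ℝ × ℂ => h t q.2) (𝓝 (t, w)) (𝓝 (h t w)) :=
        ((hd (t, w) hwU).continuousAt.tendsto).comp (continuous_snd.tendsto (t, w))
      have h3 := (h1.sub h2).norm
      simp only [sub_self, norm_zero] at h3
      exact h3.eventually (gt_mem_nhds (by positivity))
  have e1 : ∀ᶠ q : ℝ × ℂ in 𝓝 (t, z), ∀ w ∈ Metric.closedBall z r,
      ‖h q.1 w - h t w‖ < ε / 2 * (r / 2) := (continuous_fst.tendsto (t, z)).eventually hunif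
  have e2 : ∀ᶠ q : ℝ × ℂ in 𝓝 (t, z), dist (deriv (h t) q.2) (deriv (h t) z) < ε / 2 :=
    (continuous_snd.tendsto (t, z)).eventually (Metric.continuousAt_iff'.mp hcd _ (by positivity))
  have e3 : ∀ᶠ q : ℝ × ℂ in 𝓝 (t, z), q.1 ∈ Metric.ball t r :=
    (continuous_fst.tendsto (t, z)).eventually (Metric.ball_mem_nhds t hr)
  have e4 : ∀ᶠ q : ℝ × ℂ in 𝓝 (t, z), q.2 ∈ Metric.ball z (r / 2) :=
    (continuous_snd.tendsto (t, z)).eventually (Metric.ball_mem_nhds z (by positivity))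
  filter_upwards [e1, e2, e3, e4] with q h1 h2 h3 h4
  have hsub : Metric.closedBall q.2 (r / 2) ⊆ Metric.closedBall z r := by
    intro w hw
    rw [Metric.mem_closedBall] at hw ⊢
    have := dist_triangle w q.2 z
    have := Metric.mem_ball.mp h4
    linarith
  have hdq : ∀ w ∈ Metric.closedBall z r, DifferentiableAt ℂ (h q.1) w := fun w hw =>
    hd (q.1, w) (hrU ⟨h3, hw⟩)
  have hdt : ∀ w ∈ Metric.closedBall z r, DifferentiableAt ℂ (h t) w := fun w hw =>
    hd (t, w) (hrU ⟨Metric.mem_ball_self hr, hw⟩)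
  have hmem : q.2 ∈ Metric.closedBall z r := hsub (Metric.mem_closedBall_self (by positivity))
  have h5 : ‖deriv (fun w => h q.1 w - h t w) q.2‖ ≤ ε / 2 * (r / 2) / (r / 2) := by
    refine Complex.norm_deriv_le_of_forall_mem_sphere_norm_le (by positivity) ?_ fun w hw =>
      (h1 w (hsub (Metric.sphere_subset_closedBall hw))).le
    refine DifferentiableOn.diffContOnCl ?_
    rw [closure_ball _ (by positivity)]
    exact fun w hw => ((hdq w (hsub hw)).sub (hdt w (hsub hw))).differentiableWithinAt
  rw [mul_div_cancel_right₀ _ (by positivity), deriv_fun_sub (hdq _ hmem) (hdt _ hmem),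
    ← dist_eq_norm] at h5
  linarith [dist_triangle (deriv (h q.1) q.2) (deriv (h t) q.2) (deriv (h t) z)]

/-- A solution is only assumed differentiable in each variable separately. Joint continuity of both
partial derivatives provides the total differentiability behind the chain rule. -/
theorem hasDerivAt_comp_path {h : ℝ → ℂ → ℂ} {U : Set (ℝ × ℂ)} (hU : IsOpen U)
    (hc : ContinuousOn (fun p : ℝ × ℂ => h p.1 p.2) U)
    (hd : ∀ p ∈ U, DifferentiableAt ℂ (h p.1) p.2) {A : ℝ × ℂ → ℂ}
    (hA : ∀ p ∈ U, HasDerivAt (fun τ => h τ p.2) (A p) p.1) (hAc : ∀ p ∈ U, ContinuousAt A p)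
    {Φ : ℝ → ℂ} {s : ℝ} {Φ' : ℂ} (hΦ : HasDerivAt Φ Φ' s) (hs : (s, Φ s) ∈ U) :
    HasDerivAt (fun τ => h τ (Φ τ)) (A (s, Φ s) + deriv (h s) (Φ s) * Φ') s := by
  have hUn := hU.mem_nhds hs
  have h1 := hasStrictFDerivAt_uncurry_coprod (𝕜 := ℝ) (u := (s, Φ s)) (f := h)
    (f₁ := fun τ w => ContinuousLinearMap.toSpanSingletonCLE (A (τ, w)))
    (f₂ := fun τ w => deriv (h τ) w • (1 : ℂ →L[ℝ] ℂ))
    (by filter_upwards [hUn] with v hv using hA v hv)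
    (by filter_upwards [hUn] with v hv using (hd v hv).hasDerivAt.complexToReal_fderiv)
    ((ContinuousLinearMap.toSpanSingletonCLE (𝕜 := ℝ) (E := ℂ)).continuous.continuousAt.comp
      (hAc _ hs))
    ((continuousAt_deriv_uncurry hU hc hd hs).smul continuousAt_const)
  have h2 : HasDerivAt (fun τ : ℝ => (τ, Φ τ)) (1, Φ') s := (hasDerivAt_id s).prodMk hΦ
  have h3 := h1.hasFDerivAt.comp_hasDerivAt s h2
  refine h3.congr_deriv ?_
  simp [Function.HasUncurry.uncurry]

theorem upperHalf_subset : upperHalf ⊆ closedUpperHalf := fun z h =>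
  le_of_lt (show 0 < z.im from h)

theorem isOpen_times_prod_upperHalf (T : EReal) :
    IsOpen {p : ℝ × ℂ | p.1 ∈ times T ∧ p.2 ∈ upperHalf} :=
  ((isOpen_times T).preimage continuous_fst).inter (isOpen_upperHalf.preimage continuous_snd)

/-- The difference `D = h(s, Φ) - (Φ' + iν)` satisfies the linear equation `D' = -∂_z h D`, because
the path has the acceleration that the Burgers equation prescribes, and `D` vanishes initially. -/
theorem eq_along_characteristic {γ ν : ℝ} {T : EReal} {h : ℝ → ℂ → ℂ}
    (hol : ∀ t ∈ times T, DifferentiableOn ℂ (h t) upperHalf)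
    (hc : ContinuousOn (fun p : ℝ × ℂ => h p.1 p.2)
      {p | 0 ≤ p.1 ∧ (p.1 : EReal) < T ∧ p.2 ∈ upperHalf})
    (he : ∀ t ∈ times T, ∀ z ∈ upperHalf, HasDerivAt (fun τ => h τ z)
      ((γ : ℂ) ^ 2 * z + Complex.I * ν * γ - (h t z - Complex.I * ν) * deriv (h t) z) t)
    {Φ Φ' : ℝ → ℂ} {t : ℝ} (ht : t ∈ times T) (hΦ : ∀ s, HasDerivAt Φ (Φ' s) s)
    (hΦ' : ∀ s, HasDerivAt Φ' ((γ : ℂ) ^ 2 * Φ s + Complex.I * ν * γ) s)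
    (hpos : ∀ s ∈ Set.Icc 0 t, 0 < (Φ s).im) (h0 : h 0 (Φ 0) = Φ' 0 + Complex.I * ν) :
    h t (Φ t) = Φ' t + Complex.I * ν := by
  set U : Set (ℝ × ℂ) := {p | p.1 ∈ times T ∧ p.2 ∈ upperHalf} with hUdef
  have hU : IsOpen U := isOpen_times_prod_upperHalf T
  have hcU : ContinuousOn (fun p : ℝ × ℂ => h p.1 p.2) U :=
    hc.mono fun p hp => ⟨hp.1.1.le, hp.1.2, hp.2⟩
  have hdU : ∀ p ∈ U, DifferentiableAt ℂ (h p.1) p.2 := fun p hp =>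
    (hol p.1 hp.1).differentiableAt (isOpen_upperHalf.mem_nhds hp.2)
  have hmem : ∀ s ∈ Set.Ioo 0 t, (s, Φ s) ∈ U := fun s hs =>
    ⟨mem_times_of_le ht hs.1 hs.2.le, hpos s ⟨hs.1.le, hs.2.le⟩⟩
  have hΦc : Continuous Φ := continuous_iff_continuousAt.mpr fun s => (hΦ s).continuousAt
  have hΦ'c : Continuous Φ' := continuous_iff_continuousAt.mpr fun s => (hΦ' s).continuousAt
  obtain ⟨s₀, hs₀, hmin⟩ := isCompact_Icc.exists_isMinOn (Set.nonempty_Icc.mpr ht.1.le)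
    (Complex.continuous_im.comp hΦc).continuousOn
  set r := (Φ s₀).im / 2 with hr
  have hr0 : 0 < r := half_pos (hpos s₀ hs₀)
  have hball : ∀ s ∈ Set.Icc 0 t, ∀ w ∈ Metric.closedBall (Φ s) r, w ∈ upperHalf := by
    intro s hs w hw
    have h1 : (Φ s₀).im ≤ (Φ s).im := hmin hs
    have h2 : |(w - Φ s).im| ≤ r :=
      (Complex.abs_im_le_norm _).trans (by rwa [← dist_eq_norm])
    rw [Complex.sub_im, abs_le] at h2
    show 0 < w.im
    linarith [h2.1]
  -- `h` is bounded on a compact tube of radius `r` around the path, initial time included. Cauchy's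
  -- estimate then bounds `∂_z h` along the path by `C/r`, uniformly down to `s = 0`.
  obtain ⟨C, hC⟩ : ∃ C, ∀ s ∈ Set.Icc 0 t, ∀ w ∈ Metric.closedBall (Φ s) r, ‖h s w‖ ≤ C := by
    have hK : IsCompact ((fun q : ℝ × ℂ => (q.1, Φ q.1 + q.2)) ''
        (Set.Icc 0 t ×ˢ Metric.closedBall (0 : ℂ) r)) :=
      (isCompact_Icc.prod (isCompact_closedBall _ _)).image (by fun_prop)
    obtain ⟨C, hC⟩ := hK.exists_bound_of_continuousOn (hc.mono (by
      rintro _ ⟨⟨s, w⟩, ⟨hs, hw⟩, rfl⟩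
      refine ⟨hs.1, lt_of_le_of_lt (by exact_mod_cast hs.2) ht.2, hball s hs _ ?_⟩
      simpa [dist_eq_norm] using hw))
    refine ⟨C, fun s hs w hw => ?_⟩
    have := hC (s, w) ⟨(s, w - Φ s), ⟨hs, by simpa [dist_eq_norm] using hw⟩, by simp⟩
    exact this
  have hD : ∀ s ∈ Set.Ioo 0 t, HasDerivAt (fun τ => h τ (Φ τ) - (Φ' τ + Complex.I * ν))
      (-deriv (h s) (Φ s) * (h s (Φ s) - (Φ' s + Complex.I * ν))) s := by
    intro s hs
    have h1 := hasDerivAt_comp_path hU hcU hdU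
      (A := fun p => (γ : ℂ) ^ 2 * p.2 + Complex.I * ν * γ -
        (h p.1 p.2 - Complex.I * ν) * deriv (h p.1) p.2)
      (fun p hp => he p.1 hp.1 p.2 hp.2)
      (fun p hp => ((by fun_prop : Continuous fun p : ℝ × ℂ =>
        (γ : ℂ) ^ 2 * p.2 + Complex.I * ν * γ).continuousAt).sub
        (((hcU.continuousAt (hU.mem_nhds hp)).sub continuousAt_const).mul
          (continuousAt_deriv_uncurry hU hcU hdU hp)))
      (hΦ s) (hmem s hs)
    refine (h1.fun_sub ((hΦ' s).add_const (Complex.I * ν))).congr_deriv ?_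
    simp only
    ring
  have hDc : ContinuousOn (fun τ => h τ (Φ τ) - (Φ' τ + Complex.I * ν)) (Set.Icc 0 t) := by
    refine ContinuousOn.sub ?_ (by fun_prop)
    exact hc.comp (f := fun τ => (τ, Φ τ)) (by fun_prop) fun s hs =>
      ⟨hs.1, lt_of_le_of_lt (by exact_mod_cast hs.2) ht.2, hpos s hs⟩
  have := eq_zero_of_norm_deriv_le_mul (K := C / r) ht.1 hDc hD (by simp [h0]) (by
    intro s hs
    have hs' : s ∈ Set.Icc 0 t := ⟨hs.1.le, hs.2.le⟩
    rw [norm_mul, norm_neg]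
    refine mul_le_mul_of_nonneg_right ?_ (norm_nonneg _)
    refine Complex.norm_deriv_le_of_forall_mem_sphere_norm_le hr0 ?_ fun w hw =>
      hC s hs' w (Metric.sphere_subset_closedBall hw)
    refine DifferentiableOn.diffContOnCl ?_
    rw [closure_ball _ hr0.ne']
    exact (hol s (hmem s hs).1).mono (hball s hs'))
  exact sub_eq_zero.mp this

/-- For `Im z` large the explicit path from the foot of `z` to `z` lies in the upper half-plane, so
every solution takes the same value at its end. The identity theorem covers the remaining `z`.
Regularity up to the axis is not required of `h`, so that Cauchy transforms of densities qualify. -/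
theorem eqOn_solg {γ ν μ : ℝ} {ρ : ℝ → ℝ} (hγ : 0 < γ) (hμ : 0 ≤ μ) (hμν : μ < ν)
    (hρ : Integrable ρ) (hlow : ∀ᵐ x, -μ ≤ ρ x) {h : ℝ → ℂ → ℂ}
    (hol : ∀ t ∈ times (lifespan γ ν μ), DifferentiableOn ℂ (h t) upperHalf)
    (hc : ContinuousOn (fun p : ℝ × ℂ => h p.1 p.2)
      {p | 0 ≤ p.1 ∧ (p.1 : EReal) < lifespan γ ν μ ∧ p.2 ∈ upperHalf})
    (he : ∀ t ∈ times (lifespan γ ν μ), ∀ z ∈ upperHalf, HasDerivAt (fun τ => h τ z)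
      ((γ : ℂ) ^ 2 * z + Complex.I * ν * γ - (h t z - Complex.I * ν) * deriv (h t) z) t)
    (hi : ∀ z ∈ upperHalf, h 0 z = cauchyTransform ρ z - γ * z)
    {t : ℝ} (ht : t ∈ times (lifespan γ ν μ)) :
    Set.EqOn (h t) (solg γ ν ρ t) upperHalf := by
  have hν : 0 ≤ ν := hμ.trans hμν.le
  have hE := Real.exp_pos (γ * t)
  set L := 1 / Real.pi * ∫ s, |ρ s| with hL
  have hL0 : 0 ≤ L := mul_nonneg (by positivity) (integral_nonneg fun s => abs_nonneg _)
  -- The `1` gives `Im z₀ > 1`, hence `|f₀(z₀)| ≤ L`. The rest makes `γ Im z₀ exp(-γt)` exceed `ν +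
  -- L sinh(γt)`, which keeps `Im Φ` positive on `[0, t]`.
  set Y := 1 + (ν + L * Real.sinh (γ * t)) * Real.exp (γ * t) / γ with hY
  have hsinh : 0 ≤ Real.sinh (γ * t) := Real.sinh_nonneg_iff.mpr (mul_nonneg hγ.le ht.1.le)
  have hY1 : 1 ≤ Y := by
    rw [hY]; have : 0 ≤ (ν + L * Real.sinh (γ * t)) * Real.exp (γ * t) / γ := by positivity
    linarith
  have key : ∀ z : ℂ, Y < z.im → h t z = solg γ ν ρ t z := by
    intro z hz
    set z₀ := foot γ ν ρ t z with hz₀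
    set c := cauchyTransform ρ z₀ with hcdef
    have hzim : 0 ≤ z.im := by linarith
    have hy₀ : Y < z₀.im := by
      have h1 := foot_im_ge hγ hμ hμν hρ hlow ht hzim
      have h2 := growth_mul_lt_lift hγ hμ hμν ht.1 ht.2
      have h3 : 1 ≤ Real.exp (γ * t) := Real.one_le_exp (mul_nonneg hγ.le ht.1.le)
      nlinarith
    have hy₀1 : 1 < z₀.im := by linarith
    have hz₀p : 0 < z₀.im := by linarith
    have hcn : ‖c‖ ≤ L := by
      refine (norm_cauchyTransform_le hρ hz₀p).trans ?_
      exact div_le_self hL0 hy₀1.le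
    have hγc : (γ : ℂ) ≠ 0 := by exact_mod_cast hγ.ne'
    have hEd : ∀ s : ℝ, HasDerivAt (fun s : ℝ => ((Real.exp (-(γ * s)) : ℝ) : ℂ))
        ((-(γ * Real.exp (-(γ * s))) : ℝ) : ℂ) s := by
      intro s
      have h1 : HasDerivAt (fun s : ℝ => Real.exp (-(γ * s))) (-(γ * Real.exp (-(γ * s)))) s := by
        have h2 : HasDerivAt (fun s : ℝ => -(γ * s)) (-γ) s := by
          simpa using ((hasDerivAt_id s).const_mul γ).fun_neg
        exact h2.exp.congr_deriv (by ring)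
      exact h1.ofReal_comp
    have hlin : ∀ s : ℝ, HasDerivAt (fun s : ℝ => γ * s) γ s := fun s => by
      simpa using (hasDerivAt_id s).const_mul γ
    have hS : ∀ s : ℝ, HasDerivAt (fun s : ℝ => ((Real.sinh (γ * s) : ℝ) : ℂ))
        ((Real.cosh (γ * s) * γ : ℝ) : ℂ) s := fun s => (hlin s).sinh.ofReal_comp
    have hCh : ∀ s : ℝ, HasDerivAt (fun s : ℝ => ((Real.cosh (γ * s) : ℝ) : ℂ))
        ((Real.sinh (γ * s) * γ : ℝ) : ℂ) s := fun s => (hlin s).cosh.ofReal_comp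
    set Φ : ℝ → ℂ := fun s => ((γ * z₀ + Complex.I * ν) * ((Real.exp (-(γ * s)) : ℝ) : ℂ) +
      c * ((Real.sinh (γ * s) : ℝ) : ℂ) - Complex.I * ν) / γ with hΦdef
    set Φ' : ℝ → ℂ := fun s => -((γ * z₀ + Complex.I * ν) * ((Real.exp (-(γ * s)) : ℝ) : ℂ)) +
      c * ((Real.cosh (γ * s) : ℝ) : ℂ) with hΦ'def
    have hd1 : ∀ s, HasDerivAt Φ (Φ' s) s := by
      intro s
      have := ((((hEd s).const_mul (γ * z₀ + Complex.I * ν)).add ((hS s).const_mul c)).sub_const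
        (Complex.I * ν)).div_const (γ : ℂ)
      refine this.congr_deriv ?_
      simp only [hΦ'def]
      push_cast
      field_simp
    have hd2 : ∀ s, HasDerivAt Φ' ((γ : ℂ) ^ 2 * Φ s + Complex.I * ν * γ) s := by
      intro s
      have := ((hEd s).const_mul (γ * z₀ + Complex.I * ν)).neg.add ((hCh s).const_mul c)
      refine this.congr_deriv ?_
      simp only [hΦdef]
      push_cast
      field_simp
      ring
    have hpos : ∀ s ∈ Set.Icc 0 t, 0 < (Φ s).im := by
      intro s hs
      have him : (Φ s).im = ((γ * z₀.im + ν) * Real.exp (-(γ * s)) + c.im * Real.sinh (γ * s) - ν) / γ := by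
        simp only [hΦdef]
        rw [Complex.div_ofReal_im, Complex.sub_im, Complex.add_im, Complex.im_mul_ofReal,
          Complex.im_mul_ofReal]
        simp
      rw [him]
      refine div_pos ?_ hγ
      have h1 : Real.exp (-(γ * t)) ≤ Real.exp (-(γ * s)) :=
        Real.exp_le_exp.mpr (neg_le_neg (mul_le_mul_of_nonneg_left hs.2 hγ.le))
      have h2 : Real.sinh (γ * s) ≤ Real.sinh (γ * t) :=
        Real.sinh_le_sinh.mpr (mul_le_mul_of_nonneg_left hs.2 hγ.le)
      have h3 : 0 ≤ Real.sinh (γ * s) := Real.sinh_nonneg_iff.mpr (mul_nonneg hγ.le hs.1)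
      have h4 : -L ≤ c.im := by
        have := (abs_le.mp ((Complex.abs_im_le_norm c).trans hcn)).1
        exact this
      have h5 : (ν + L * Real.sinh (γ * t)) * Real.exp (γ * t) / γ < z₀.im := by linarith
      rw [div_lt_iff₀ hγ] at h5
      have h6 : ν + L * Real.sinh (γ * t) < z₀.im * γ * Real.exp (-(γ * t)) := by
        rw [Real.exp_neg, ← div_eq_mul_inv, lt_div_iff₀ hE]; exact h5
      have h7 : z₀.im * γ * Real.exp (-(γ * t)) ≤ z₀.im * γ * Real.exp (-(γ * s)) :=
        mul_le_mul_of_nonneg_left h1 (by positivity)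
      have h8 : 0 ≤ ν * Real.exp (-(γ * s)) := by positivity
      have h9 : -L * Real.sinh (γ * s) ≤ c.im * Real.sinh (γ * s) :=
        mul_le_mul_of_nonneg_right h4 h3
      have h10 : L * Real.sinh (γ * s) ≤ L * Real.sinh (γ * t) :=
        mul_le_mul_of_nonneg_left h2 hL0
      linarith
    have hΦ0 : Φ 0 = z₀ := by simp [hΦdef, hγc]
    have h0 : h 0 (Φ 0) = Φ' 0 + Complex.I * ν := by
      rw [hΦ0, hi z₀ hz₀p]; simp [hΦ'def, ← hcdef]; ring
    have hfoot := (foot_spec hγ hμ hρ hlow ht.1.le (admissible_of_mem hγ hμ hμν ht hzim)).2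
    rw [← hz₀, ← hcdef, base, growth_eq, lift] at hfoot
    have hEc : ((Real.exp (γ * t) : ℝ) : ℂ) ≠ 0 := by exact_mod_cast hE.ne'
    have hsin : ((Real.sinh (γ * t) : ℝ) : ℂ) =
        ((Real.exp (γ * t) : ℝ) - ((Real.exp (γ * t) : ℝ) : ℂ)⁻¹) / 2 := by
      rw [Real.sinh_eq, Real.exp_neg]; push_cast; ring
    have hcos : ((Real.cosh (γ * t) : ℝ) : ℂ) =
        ((Real.exp (γ * t) : ℝ) + ((Real.exp (γ * t) : ℝ) : ℂ)⁻¹) / 2 := by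
      rw [Real.cosh_eq, Real.exp_neg]; push_cast; ring
    have hexp : ((Real.exp (-(γ * t)) : ℝ) : ℂ) = ((Real.exp (γ * t) : ℝ) : ℂ)⁻¹ := by
      rw [Real.exp_neg]; push_cast; ring
    push_cast at hfoot
    rw [← Complex.ofReal_mul, ← Complex.ofReal_exp] at hfoot
    have hΦt : Φ t = z := by
      simp only [hΦdef]
      rw [hsin, hexp]
      generalize ((Real.exp (γ * t) : ℝ) : ℂ) = E at *
      field_simp at hfoot ⊢
      linear_combination hfoot
    have hmain := eq_along_characteristic hol hc he ht hd1 hd2 hpos h0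
    rw [hΦt] at hmain
    rw [hmain, solg, solf, ← hz₀, ← hcdef]
    have hz' : (γ : ℂ) * z = γ * Φ t := by rw [hΦt]
    rw [hz']
    simp only [hΦdef, hΦ'def]
    rw [hsin, hexp, hcos]
    generalize ((Real.exp (γ * t) : ℝ) : ℂ) = E at *
    field_simp
    ring
  have hconv : IsPreconnected upperHalf := (convex_halfSpace_im_gt 0).isPreconnected
  have ha1 : AnalyticOnNhd ℂ (h t) upperHalf := (hol t ht).analyticOnNhd isOpen_upperHalf
  have ha2 : AnalyticOnNhd ℂ (solg γ ν ρ t) upperHalf := fun z hz =>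
    (isBurgersSolution_solg hγ hμ hμν hρ hlow).holomorphic t ht z (upperHalf_subset hz)
  refine ha1.eqOn_of_preconnected_of_eventuallyEq ha2 hconv (z₀ := Complex.I * (Y + 1 : ℝ)) ?_ ?_
  · show 0 < (Complex.I * (Y + 1 : ℝ)).im
    simp; linarith
  · have : {z : ℂ | Y < z.im} ∈ 𝓝 (Complex.I * (Y + 1 : ℝ)) :=
      (isOpen_lt continuous_const Complex.continuous_im).mem_nhds (by simp)
    filter_upwards [this] with z hz using key z hz

theorem eqOn_closedUpperHalf_of_eqOn {f g : ℂ → ℂ} (hf : AnalyticOnNhd ℂ f closedUpperHalf)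
    (hg : AnalyticOnNhd ℂ g closedUpperHalf) (h : Set.EqOn f g upperHalf) :
    Set.EqOn f g closedUpperHalf := by
  refine hf.eqOn_of_preconnected_of_eventuallyEq hg
    (convex_halfSpace_im_ge 0).isPreconnected (z₀ := Complex.I) (by simp [closedUpperHalf]) ?_
  filter_upwards [isOpen_upperHalf.mem_nhds (show Complex.I ∈ upperHalf by simp [upperHalf])]
    with z hz using h hz

theorem IsBurgersSolution.eqOn_solg {γ ν μ : ℝ} {ρ : ℝ → ℝ} {g : ℝ → ℂ → ℂ} (hγ : 0 < γ)
    (hμ : 0 ≤ μ) (hμν : μ < ν) (hρ : Integrable ρ) (hlow : ∀ᵐ x, -μ ≤ ρ x)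
    (hg : IsBurgersSolution γ ν (lifespan γ ν μ) ρ g) {t : ℝ}
    (ht : t ∈ times (lifespan γ ν μ)) : Set.EqOn (g t) (solg γ ν ρ t) closedUpperHalf :=
  eqOn_closedUpperHalf_of_eqOn (hg.holomorphic t ht)
    ((isBurgersSolution_solg hγ hμ hμν hρ hlow).holomorphic t ht)
    (CriticalHilbert.eqOn_solg hγ hμ hμν hρ hlow
      (fun t ht z hz => (hg.holomorphic t ht z (upperHalf_subset hz)).differentiableAt.differentiableWithinAt)
      hg.continuous hg.equation hg.initial ht)

/-! ### The branch of the square root and the steady state -/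

theorem upperSqrt_sq {S : ℂ} (hS : 0 < S.im) : upperSqrt (S ^ 2) = S := by
  have h1 : -S ^ 2 = (-Complex.I * S) ^ 2 := by
    rw [mul_pow, neg_sq, Complex.I_sq]; ring
  rw [upperSqrt, h1, one_div, Complex.sq_cpow_two_inv (by simpa using hS), ← mul_assoc]
  simp

theorem continuousAt_upperSqrt {ζ : ℂ} (h : -ζ ∈ Complex.slitPlane) :
    ContinuousAt upperSqrt ζ :=
  continuousAt_const.mul (continuousAt_neg.cpow continuousAt_const h)

theorem neg_sq_sub_mem_slitPlane {w : ℂ} (hw : 0 < w.im) {r : ℝ} (hr : 0 ≤ r) :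
    -(w ^ 2 - (r : ℂ)) ∈ Complex.slitPlane := by
  rw [Complex.mem_slitPlane_iff]
  by_cases h : w.re = 0
  · left
    simp [sq, h]
    positivity
  · right
    simp [sq]
    intro h'
    have : w.re * w.im = 0 := by linarith
    rcases mul_eq_zero.mp this with h1 | h1
    · exact h h1
    · exact hw.ne' h1

theorem im_upperSqrt (ζ : ℂ) : (upperSqrt ζ).im = √((‖ζ‖ - ζ.re) / 2) := by
  rw [upperSqrt, Complex.I_mul_im, one_div, Complex.cpow_inv_two_re, norm_neg, Complex.neg_re,
    ← sub_eq_add_neg]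

theorem neg_im_steadyBurgers (γ ν m x : ℝ) :
    -(steadyBurgers γ ν m x + γ * x).im = steadyDensity γ ν m x := by
  have h1 : (Complex.I * (ν : ℂ)).im = ν := by simp
  have h2 : ((γ : ℂ) * x).im = 0 := by simp
  rw [steadyBurgers, Complex.add_im, Complex.sub_im, im_upperSqrt, h1, h2]
  set ζ : ℂ := ((γ : ℂ) * x + Complex.I * ν) ^ 2 - (2 * γ * m / Real.pi : ℝ) with hζ
  have hre : ζ.re = γ ^ 2 * x ^ 2 - ν ^ 2 - 2 * γ * m / Real.pi := by
    rw [hζ, Complex.sub_re, Complex.ofReal_re, sq]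
    simp
    ring
  have him : ζ.im = 2 * γ * x * ν := by
    rw [hζ, Complex.sub_im, Complex.ofReal_im, sq]
    simp
    ring
  have hn : ‖ζ‖ = √(ζ.re ^ 2 + 4 * γ ^ 2 * x ^ 2 * ν ^ 2) := by
    rw [Complex.norm_def, Complex.normSq_apply, him]
    congr 1
    ring
  rw [hn, steadyDensity]
  rw [← hre, Real.sqrt_div' _ (by norm_num)]
  have : √(2 : ℝ) ≠ 0 := by positivity
  field_simp
  ring

/-! ### Long-time behaviour for nonnegative data -/

section LongTime

variable {ρ : ℝ → ℝ} {γ ν : ℝ} (hγ : 0 < γ) (hν : 0 < ν) (hρ : Integrable ρ)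
  (hlow : ∀ᵐ x, 0 ≤ ρ x) {z : ℂ} (hz : 0 ≤ z.im)

theorem mem_times_lifespan_zero (γ ν : ℝ) {t : ℝ} (ht : 0 < t) :
    t ∈ times (lifespan γ ν 0) := by
  refine ⟨ht, ?_⟩
  rw [lifespan, if_pos rfl]
  exact EReal.coe_lt_top t

include hγ hν hρ hlow hz

/-- The imaginary part of the foot is at least `lift`, of order `exp(γt)`. Hence `|f₀| ≤ L/lift`
there, and `growth * L/lift` is again of order `exp(γt)`, although `growth` is of order `exp(2γt)`.
The foot therefore goes to infinity within a sector. -/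
theorem tendsto_foot_mul_cauchyTransform :
    Tendsto (fun t => foot γ ν ρ t z * cauchyTransform ρ (foot γ ν ρ t z)) atTop
      (𝓝 ((∫ x, ρ x : ℝ) / Real.pi)) := by
  have hlow' : ∀ᵐ x, -(0 : ℝ) ≤ ρ x := by simpa using hlow
  set L := 1 / Real.pi * ∫ s, |ρ s| with hL
  have hL0 : 0 ≤ L := mul_nonneg (by positivity) (integral_nonneg fun s => abs_nonneg _)
  have hE : Tendsto (fun t : ℝ => Real.exp (γ * t)) atTop atTop :=
    Real.tendsto_exp_atTop.comp (tendsto_id.const_mul_atTop hγ)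
  have him : ∀ t, 0 < t → lift γ ν t ≤ (foot γ ν ρ t z).im := by
    intro t ht
    have := foot_im_ge' hγ le_rfl hν hρ hlow' (mem_times_lifespan_zero γ ν ht) hz
    simpa using this
  have hlift : Tendsto (lift γ ν) atTop atTop := by
    have : Tendsto (fun t => ν / γ * (Real.exp (γ * t) + (-1))) atTop atTop :=
      (tendsto_atTop_add_const_right _ _ hE).const_mul_atTop (by positivity)
    refine this.congr fun t => ?_
    rw [lift]; ring
  refine tendsto_mul_cauchyTransform (K := 1 + (‖z‖ + L / ν) * (2 * γ / ν)) hρ ?_ ?_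
  · rw [← tendsto_norm_atTop_iff_cobounded]
    refine tendsto_atTop_mono' _ ?_ hlift
    filter_upwards [eventually_gt_atTop 0] with t ht
    exact (him t ht).trans ((le_abs_self _).trans (Complex.abs_im_le_norm _))
  · filter_upwards [eventually_gt_atTop 0, hE.eventually_ge_atTop 2] with t ht hE2
    have htm := mem_times_lifespan_zero γ ν ht
    obtain ⟨h1, h2⟩ := foot_spec hγ le_rfl hρ hlow' ht.le
      (admissible_of_mem hγ le_rfl hν htm hz)
    refine ⟨h1, ?_⟩
    set E := Real.exp (γ * t) with hEdef
    have hlp : 0 < lift γ ν t := by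
      rw [lift]; exact div_pos (mul_pos hν (by linarith)) hγ
    have h3 : ‖cauchyTransform ρ (foot γ ν ρ t z)‖ ≤ L / lift γ ν t :=
      (norm_cauchyTransform_le hρ h1).trans (div_le_div_of_nonneg_left hL0 hlp (him t ht))
    have h4 : growth γ t * (L / lift γ ν t) = L / ν * ((E + 1) / 2) := by
      have hE1 : E - 1 ≠ 0 := by linarith
      rw [growth_eq, lift, ← hEdef]
      field_simp
    have h5 : ‖foot γ ν ρ t z‖ ≤ E * ‖z‖ + lift γ ν t + L / ν * ((E + 1) / 2) := by
      rw [h2, base]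
      refine (norm_sub_le _ _).trans (add_le_add ((norm_add_le _ _).trans ?_) ?_)
      · rw [norm_mul, norm_mul, Complex.norm_I, Complex.norm_real, Complex.norm_real,
          Real.norm_of_nonneg hlp.le, Real.norm_of_nonneg (Real.exp_pos _).le, one_mul]
      · rw [norm_mul, Complex.norm_real, Real.norm_of_nonneg (growth_nonneg hγ ht.le), ← h4]
        exact mul_le_mul_of_nonneg_left h3 (growth_nonneg hγ ht.le)
    have h6 : E ≤ 2 * γ / ν * lift γ ν t := by
      have : 2 * γ / ν * lift γ ν t = 2 * (E - 1) := by rw [lift, ← hEdef]; field_simp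
      linarith
    have h7 := him t ht
    have h8 : 0 ≤ L / ν := by positivity
    have h9 : L / ν * ((E + 1) / 2) ≤ L / ν * E := mul_le_mul_of_nonneg_left (by linarith) h8
    have h10 : (‖z‖ + L / ν) * E ≤ (‖z‖ + L / ν) * (2 * γ / ν * lift γ ν t) :=
      mul_le_mul_of_nonneg_left h6 (by positivity)
    have h11 : (‖z‖ + L / ν) * (2 * γ / ν) * lift γ ν t ≤
        (‖z‖ + L / ν) * (2 * γ / ν) * (foot γ ν ρ t z).im :=
      mul_le_mul_of_nonneg_left h7 (by positivity)
    linarith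

/-- Completing the square in the root equation: with `S = w - κ f`, `w = γz + iν(1 - exp(-γt))` and
`κ = 1 - exp(-2γt)`, one has `S² = w² - 2γκ Z f₀(Z)` for the foot `Z`. The right-hand side
converges, and `Im S > 0` determines which square root `S` is. -/
theorem tendsto_solg_atTop :
    Tendsto (fun t => solg γ ν ρ t z) atTop (𝓝 (steadyBurgers γ ν (∫ x, ρ x) z)) := by
  have hlow' : ∀ᵐ x, -(0 : ℝ) ≤ ρ x := by simpa using hlow
  have hγc : (γ : ℂ) ≠ 0 := by exact_mod_cast hγ.ne'
  set m := ∫ x, ρ x with hm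
  have hm0 : 0 ≤ m := integral_nonneg_of_ae hlow
  set e : ℝ → ℂ := fun t => ((Real.exp (-(γ * t)) : ℝ) : ℂ) with he
  have he0 : Tendsto e atTop (𝓝 0) := by
    have : Tendsto (fun t : ℝ => Real.exp (-(γ * t))) atTop (𝓝 0) :=
      Real.tendsto_exp_neg_atTop_nhds_zero.comp (tendsto_id.const_mul_atTop hγ)
    have h2 := (Complex.continuous_ofReal.tendsto 0).comp this
    rwa [Complex.ofReal_zero] at h2
  set w : ℝ → ℂ := fun t => γ * z + Complex.I * ν * (1 - e t) with hw
  have hwlim : Tendsto w atTop (𝓝 (γ * z + Complex.I * ν)) := by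
    have := ((he0.const_sub 1).const_mul (Complex.I * ν)).const_add ((γ : ℂ) * z)
    simpa using this
  set κ : ℝ → ℂ := fun t => 1 - e t ^ 2 with hκ
  have hκlim : Tendsto κ atTop (𝓝 1) := by
    have := (he0.pow 2).const_sub 1
    simpa using this
  set S : ℝ → ℂ := fun t => w t - κ t * solf γ ν ρ t z with hS
  have hfp := tendsto_foot_mul_cauchyTransform hγ hν hρ hlow hz
  have hSsq : Tendsto (fun t => S t ^ 2) atTop
      (𝓝 ((γ * z + Complex.I * ν) ^ 2 - (2 * γ * m / Real.pi : ℝ))) := by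
    have h1 := (hwlim.pow 2).sub ((hκlim.mul hfp).const_mul (2 * γ : ℂ))
    have h2 : (γ * z + Complex.I * ν) ^ 2 - 2 * γ * (1 * ((m : ℂ) / Real.pi)) =
        (γ * z + Complex.I * ν) ^ 2 - (2 * γ * m / Real.pi : ℝ) := by
      push_cast; ring
    rw [h2] at h1
    refine h1.congr' ?_
    filter_upwards [eventually_gt_atTop 0] with t ht
    have hfoot := (foot_spec hγ le_rfl hρ hlow' ht.le
      (admissible_of_mem hγ le_rfl hν (mem_times_lifespan_zero γ ν ht) hz)).2
    have hEe : e t = ((Real.exp (γ * t) : ℝ) : ℂ)⁻¹ := by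
      simp only [he]; rw [Real.exp_neg]; push_cast; ring
    have hE0 : ((Real.exp (γ * t) : ℝ) : ℂ) ≠ 0 := by exact_mod_cast (Real.exp_pos _).ne'
    simp only [hS, hw, hκ, solf]
    rw [base, growth_eq, lift] at hfoot
    rw [hEe]
    generalize cauchyTransform ρ (foot γ ν ρ t z) = c at *
    generalize foot γ ν ρ t z = Z at *
    push_cast at hfoot
    rw [← Complex.ofReal_mul, ← Complex.ofReal_exp] at hfoot
    generalize ((Real.exp (γ * t) : ℝ) : ℂ) = E at *
    rw [hfoot]
    field_simp
    ring
  have hSim : ∀ t, 0 < t → 0 < (S t).im := by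
    intro t ht
    have htm := mem_times_lifespan_zero γ ν ht
    have h1 : (solf γ ν ρ t z).im ≤ 0 := by
      rw [solf, Complex.im_ofReal_mul]
      have := im_cauchyTransform_le hρ hlow'
        (foot_im_pos hγ le_rfl hν hρ hlow' htm hz)
      exact mul_nonpos_of_nonneg_of_nonpos (Real.exp_pos _).le this
    have he1 : Real.exp (-(γ * t)) < 1 := Real.exp_lt_one_iff.mpr (by nlinarith [mul_pos hγ ht])
    have he2 := Real.exp_pos (-(γ * t))
    have h2 : (S t).im = γ * z.im + ν * (1 - Real.exp (-(γ * t))) -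
        (1 - Real.exp (-(γ * t)) ^ 2) * (solf γ ν ρ t z).im := by
      have h3 : S t = (γ : ℂ) * z + Complex.I * ((ν * (1 - Real.exp (-(γ * t))) : ℝ) : ℂ) -
          ((1 - Real.exp (-(γ * t)) ^ 2 : ℝ) : ℂ) * solf γ ν ρ t z := by
        simp only [hS, hw, hκ, he]; push_cast; ring
      rw [h3, Complex.sub_im, Complex.add_im, Complex.im_ofReal_mul, Complex.im_ofReal_mul,
        Complex.I_mul_im, Complex.ofReal_re]
    rw [h2]
    have h4 : 0 < ν * (1 - Real.exp (-(γ * t))) := mul_pos hν (by linarith)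
    have h5 : 0 ≤ γ * z.im := mul_nonneg hγ.le hz
    have h6 : 0 ≤ 1 - Real.exp (-(γ * t)) ^ 2 := by nlinarith
    nlinarith
  have hSlim : Tendsto S atTop
      (𝓝 (upperSqrt ((γ * z + Complex.I * ν) ^ 2 - (2 * γ * m / Real.pi : ℝ)))) := by
    have hcont := continuousAt_upperSqrt (neg_sq_sub_mem_slitPlane
      (w := γ * z + Complex.I * ν) (r := 2 * γ * m / Real.pi)
      (by simp; nlinarith [mul_nonneg hγ.le hz]) (by positivity))
    refine (hcont.tendsto.comp hSsq).congr' ?_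
    filter_upwards [eventually_gt_atTop 0] with t ht
    exact upperSqrt_sq (hSim t ht)
  have hlim := ((hwlim.sub hSlim).div hκlim one_ne_zero).sub_const ((γ : ℂ) * z)
  have hval : (γ * z + Complex.I * ν - upperSqrt ((γ * z + Complex.I * ν) ^ 2 -
      (2 * γ * m / Real.pi : ℝ))) / 1 - γ * z = steadyBurgers γ ν m z := by
    rw [steadyBurgers]; ring
  rw [hval] at hlim
  refine hlim.congr' ?_
  filter_upwards [eventually_gt_atTop 0] with t ht
  have hκ0 : κ t ≠ 0 := by
    have he1 : Real.exp (-(γ * t)) < 1 := Real.exp_lt_one_iff.mpr (by nlinarith [mul_pos hγ ht])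
    have he2 := Real.exp_pos (-(γ * t))
    have : κ t = ((1 - Real.exp (-(γ * t)) ^ 2 : ℝ) : ℂ) := by
      simp only [hκ, he]; push_cast; ring
    rw [this]
    exact_mod_cast (by nlinarith : (0 : ℝ) < 1 - Real.exp (-(γ * t)) ^ 2).ne'
  simp only [Pi.div_apply, hS, solg]
  field_simp
  ring

omit hz in
theorem tendsto_traceDensity_atTop (x : ℝ) :
    Tendsto (fun t => traceDensity γ (solg γ ν ρ) t x) atTop
      (𝓝 (steadyDensity γ ν (∫ x, ρ x) x)) := by
  rw [← neg_im_steadyBurgers]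
  exact ((Complex.continuous_im.tendsto _).comp
    ((tendsto_solg_atTop hγ hν hρ hlow (z := x) (by simp)).add_const _)).neg

end LongTime

/-! ### Weak and strong convergence in `L²` -/

section WeakConvergence

/-- Fatou's lemma along a sequence extracted from the filter. -/
theorem eLpNorm_le_of_ae_tendsto_of_eventually {E : Type*} [NormedAddCommGroup E] {ι : Type*}
    {l : Filter ι} [l.IsCountablyGenerated] [l.NeBot] {f : ι → ℝ → E} {f₀ : ℝ → E} {C : NNReal}
    (hf : ∀ᶠ i in l, AEStronglyMeasurable (f i) volume ∧ eLpNorm (f i) 2 volume ≤ C)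
    (hlim : ∀ᵐ x, Tendsto (fun i => f i x) l (𝓝 (f₀ x))) :
    AEStronglyMeasurable f₀ volume ∧ eLpNorm f₀ 2 volume ≤ C := by
  obtain ⟨v, hv⟩ := l.exists_seq_tendsto
  obtain ⟨N, hN⟩ := eventually_atTop.mp (hv.eventually hf)
  have hv' : Tendsto (fun n => v (n + N)) atTop l := hv.comp (tendsto_add_atTop_nat N)
  have hlim' : ∀ᵐ x, Tendsto (fun n => f (v (n + N)) x) atTop (𝓝 (f₀ x)) := by
    filter_upwards [hlim] with x hx using hx.comp hv'
  refine ⟨aestronglyMeasurable_of_tendsto_ae atTop (fun n => (hN (n + N) (by omega)).1) hlim', ?_⟩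
  refine (Lp.eLpNorm_lim_le_liminf_eLpNorm (fun n => (hN (n + N) (by omega)).1) f₀ hlim').trans ?_
  refine liminf_le_of_le (by isBoundedDefault) fun b hb => ?_
  obtain ⟨n, hn⟩ := hb.exists
  exact hn.trans (hN (n + N) (by omega)).2

/-- Splits a product so that the first term is dominated by `A b²`, which allows dominated
convergence, while the integral of the second is small for large `A` by the `L²` bound. It takes the
place of Egorov's theorem. -/
theorem mul_le_min_add {a b A : ℝ} (ha : 0 ≤ a) (hb : 0 ≤ b) (hA : 0 < A) :
    a * b ≤ min (a * b) (A * b ^ 2) + a ^ 2 / A := by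
  rcases le_total (a * b) (A * b ^ 2) with h | h
  · rw [min_eq_left h]; linarith [show 0 ≤ a ^ 2 / A by positivity]
  · rw [min_eq_right h]
    rcases hb.eq_or_lt with rfl | hb'
    · have : 0 ≤ a ^ 2 / A := by positivity
      simpa using this
    · have h1 : A * b ≤ a := by nlinarith
      have h2 : a * b ≤ a ^ 2 / A := by rw [le_div_iff₀ hA]; nlinarith
      have : 0 ≤ A * b ^ 2 := by positivity
      linarith

/-- Bounded sequences in `L²` which converge almost everywhere converge weakly. -/
theorem tendsto_integral_mul_of_ae_tendsto {ι : Type*} {l : Filter ι} [l.IsCountablyGenerated]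
    [l.NeBot] {f : ι → ℝ → ℂ} {f₀ g : ℝ → ℂ} {C : NNReal}
    (hf : ∀ᶠ i in l, AEStronglyMeasurable (f i) volume ∧ eLpNorm (f i) 2 volume ≤ C)
    (hlim : ∀ᵐ x, Tendsto (fun i => f i x) l (𝓝 (f₀ x))) (hg : MemLp g 2) :
    Tendsto (fun i => ∫ x, f i x * g x) l (𝓝 (∫ x, f₀ x * g x)) := by
  obtain ⟨hf₀m, hf₀C⟩ := eLpNorm_le_of_ae_tendsto_of_eventually hf hlim
  have hf₀ : MemLp f₀ 2 := ⟨hf₀m, hf₀C.trans_lt ENNReal.coe_lt_top⟩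
  have hg2 : Integrable fun x => ‖g x‖ ^ 2 := hg.integrable_norm_pow (by norm_num)
  rw [tendsto_iff_norm_sub_tendsto_zero]
  have hbound : ∀ A : ℝ, 0 < A → ∀ᶠ i in l, ‖(∫ x, f i x * g x) - ∫ x, f₀ x * g x‖ ≤
      (∫ x, min (‖f i x - f₀ x‖ * ‖g x‖) (A * ‖g x‖ ^ 2)) + (C + C : ℝ) ^ 2 / A := by
    intro A hA
    filter_upwards [hf] with i hi
    have hfi : MemLp (f i) 2 := ⟨hi.1, hi.2.trans_lt ENNReal.coe_lt_top⟩
    have hd : MemLp (fun x => f i x - f₀ x) 2 := hfi.sub hf₀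
    have hdC : eLpNorm (fun x => f i x - f₀ x) 2 volume ≤ (C + C : NNReal) := by
      refine (eLpNorm_sub_le hi.1 hf₀m (by norm_num)).trans ?_
      rw [ENNReal.coe_add]
      exact add_le_add hi.2 hf₀C
    have hd2 := (integral_norm_sq_le_of_eLpNorm_le hd.1 hdC).2
    have hdg : Integrable fun x => ‖f i x - f₀ x‖ * ‖g x‖ := hd.norm.integrable_mul hg.norm
    have hmin : Integrable fun x => min (‖f i x - f₀ x‖ * ‖g x‖) (A * ‖g x‖ ^ 2) :=
      hdg.inf (hg2.const_mul A)
    have i1 : Integrable fun x => f i x * g x := hfi.integrable_mul hg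
    have i2 : Integrable fun x => f₀ x * g x := hf₀.integrable_mul hg
    have e1 : (∫ x, f i x * g x) - ∫ x, f₀ x * g x = ∫ x, (f i x - f₀ x) * g x := by
      rw [← integral_sub i1 i2]
      congr 1; ext x; ring
    rw [e1]
    calc ‖∫ x, (f i x - f₀ x) * g x‖ ≤ ∫ x, ‖f i x - f₀ x‖ * ‖g x‖ := by
          refine (norm_integral_le_integral_norm _).trans (le_of_eq ?_)
          simp_rw [norm_mul]
      _ ≤ ∫ x, (min (‖f i x - f₀ x‖ * ‖g x‖) (A * ‖g x‖ ^ 2) + ‖f i x - f₀ x‖ ^ 2 / A) := by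
          refine integral_mono hdg (hmin.add ((hd.integrable_norm_pow (by norm_num)).div_const A))
            fun x => mul_le_min_add (norm_nonneg _) (norm_nonneg _) hA
      _ ≤ _ := by
          rw [integral_add hmin ((hd.integrable_norm_pow (by norm_num)).div_const A),
            integral_div]
          have h3 : (∫ x, ‖f i x - f₀ x‖ ^ 2) / A ≤ (C + C : ℝ) ^ 2 / A :=
            div_le_div_of_nonneg_right (by push_cast at hd2; exact hd2) hA.le
          linarith
  have hzero : ∀ A : ℝ, 0 < A → Tendsto (fun i => ∫ x, min (‖f i x - f₀ x‖ * ‖g x‖) (A * ‖g x‖ ^ 2))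
      l (𝓝 0) := by
    intro A hA
    have h0 : (∫ _ : ℝ, (0 : ℝ)) = 0 := by simp
    rw [← h0]
    refine tendsto_integral_filter_of_dominated_convergence (fun x => A * ‖g x‖ ^ 2) ?_ ?_
      (hg2.const_mul A) ?_
    · filter_upwards [hf] with i hi
      exact (((hi.1.sub hf₀m).norm.mul hg.1.norm).inf (hg2.const_mul A).1)
    · refine Eventually.of_forall fun i => ae_of_all _ fun x => ?_
      rw [Real.norm_of_nonneg (by positivity)]
      exact min_le_right _ _
    · filter_upwards [hlim] with x hx
      have h1 : Tendsto (fun i => ‖f i x - f₀ x‖ * ‖g x‖) l (𝓝 0) := by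
        have := (tendsto_iff_norm_sub_tendsto_zero.mp hx).mul_const ‖g x‖
        simpa using this
      have h2 := h1.min (tendsto_const_nhds (x := A * ‖g x‖ ^ 2))
      rwa [min_eq_left (by positivity)] at h2
  rw [Metric.tendsto_nhds]
  intro ε hε
  obtain ⟨A, hA, hAε⟩ : ∃ A : ℝ, 0 < A ∧ (C + C : ℝ) ^ 2 / A < ε / 2 := by
    refine ⟨((C + C : ℝ) ^ 2 + 1) * (2 / ε), by positivity, ?_⟩
    rw [div_lt_iff₀ (by positivity)]
    field_simp
    linarith
  filter_upwards [hbound A hA, (hzero A hA).eventually (gt_mem_nhds (half_pos hε))] with i h1 h2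
  rw [Real.dist_0_eq_abs, abs_of_nonneg (norm_nonneg _)]
  linarith

/-- Weak convergence without loss of mass is strong convergence. -/
theorem tendsto_integral_sub_sq {ι : Type*} {l : Filter ι} [l.IsCountablyGenerated]
    [l.NeBot] {b : ι → ℝ → ℝ} {b₀ : ℝ → ℝ} (hb₀ : MemLp b₀ 2)
    (hb : ∀ᶠ i in l, MemLp (b i) 2 ∧ ∫ x, b i x ^ 2 ≤ ∫ x, b₀ x ^ 2)
    (hlim : ∀ᵐ x, Tendsto (fun i => b i x) l (𝓝 (b₀ x))) :
    Tendsto (fun i => ∫ x, (b i x - b₀ x) ^ 2) l (𝓝 0) := by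
  have h1 : Tendsto (fun i => ∫ x, (b i x : ℂ) * (b₀ x : ℂ)) l
      (𝓝 (∫ x, (b₀ x : ℂ) * (b₀ x : ℂ))) := by
    refine tendsto_integral_mul_of_ae_tendsto (C := Real.toNNReal (√(∫ x, b₀ x ^ 2))) ?_ ?_
      hb₀.ofReal
    · filter_upwards [hb] with i hi
      have hm : MemLp (fun x => (b i x : ℂ)) 2 := hi.1.ofReal
      refine ⟨hm.1, ?_⟩
      rw [eLpNorm_two_eq hm]
      refine ENNReal.ofReal_le_ofReal (Real.sqrt_le_sqrt ?_)
      simpa using hi.2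
    · filter_upwards [hlim] with x hx
      exact (Complex.continuous_ofReal.tendsto _).comp hx
  have h2 : Tendsto (fun i => ∫ x, b i x * b₀ x) l (𝓝 (∫ x, b₀ x * b₀ x)) := by
    have := (Complex.continuous_re.tendsto _).comp h1
    simp only [← Complex.ofReal_mul, integral_complex_ofReal, Function.comp_def,
      Complex.ofReal_re] at this
    exact this
  have h3 := (h2.const_mul 2).const_sub (2 * ∫ x, b₀ x * b₀ x)
  rw [sub_self] at h3
  refine squeeze_zero' (Eventually.of_forall fun i => integral_nonneg fun x => sq_nonneg _) ?_ h3
  filter_upwards [hb] with i hi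
  have i1 : Integrable fun x => b i x ^ 2 := hi.1.integrable_sq
  have i2 : Integrable fun x => b₀ x ^ 2 := hb₀.integrable_sq
  have i3 : Integrable fun x => b i x * b₀ x := hi.1.integrable_mul hb₀
  have e : ∫ x, (b i x - b₀ x) ^ 2 =
      (∫ x, b i x ^ 2) - 2 * (∫ x, b i x * b₀ x) + ∫ x, b₀ x ^ 2 := by
    have i4 : Integrable fun x => b i x ^ 2 - 2 * (b i x * b₀ x) := i1.sub (i3.const_mul 2)
    rw [← integral_const_mul, ← integral_sub i1 (i3.const_mul 2), ← integral_add i4 i2]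
    congr 1; ext x; ring
  have e2 : ∫ x, b₀ x * b₀ x = ∫ x, b₀ x ^ 2 := by congr 1; ext x; ring
  rw [e, e2]
  linarith [hi.2]

end WeakConvergence

/-! ### Boundary values of the Cauchy transform -/

section BoundaryValues

theorem cauchyTransform_add {ρ σ : ℝ → ℝ} (hρ : Integrable ρ) (hσ : Integrable σ) {z : ℂ}
    (hz : 0 < z.im) :
    cauchyTransform (fun s => ρ s + σ s) z = cauchyTransform ρ z + cauchyTransform σ z := by
  rw [cauchyTransform, cauchyTransform, cauchyTransform, ← mul_add,
    ← integral_add (integrable_cauchy hρ hz) (integrable_cauchy hσ hz)]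
  congr 2; ext s; push_cast; ring

theorem cauchyTransform_const_mul (c : ℝ) (ρ : ℝ → ℝ) (z : ℂ) :
    cauchyTransform (fun s => c * ρ s) z = c * cauchyTransform ρ z := by
  rw [cauchyTransform, cauchyTransform, mul_left_comm,
    ← integral_const_mul (c : ℂ) fun s : ℝ => (ρ s : ℂ) / (z - s)]
  simp_rw [Complex.ofReal_mul, mul_div_assoc]

theorem integrable_lorentz (x : ℝ) : Integrable fun s : ℝ => (1 + (s - x) ^ 2)⁻¹ :=
  integrable_inv_one_add_sq.comp_sub_right x

theorem cauchyTransform_lorentz (x : ℝ) {z : ℂ} (hz : 0 < z.im) :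
    cauchyTransform (fun s => (1 + (s - x) ^ 2)⁻¹) z = (z - (x - Complex.I))⁻¹ := by
  have him : ∀ s : ℝ, (((s : ℂ) - (x - Complex.I))⁻¹).im = -(1 + (s - x) ^ 2)⁻¹ := by
    intro s
    rw [Complex.inv_im, Complex.normSq_apply]
    simp
    field_simp
    ring
  have h1 := eq_cauchyTransform_of_analytic (F := fun w => (w - (x - Complex.I))⁻¹) ?_
    ((tendsto_inv_sub_cobounded _).mono_left inf_le_left) ?_ hz
  · rw [h1]
    congr 1
    ext s
    rw [him, neg_neg]
  · intro w hw
    refine (analyticAt_id.sub analyticAt_const).inv ?_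
    intro h
    have := congrArg Complex.im h
    have hw' : 0 ≤ w.im := hw
    simp at this
    linarith
  · simp_rw [him]
    exact (integrable_lorentz x).neg

/-- The boundary values of the Cauchy transform. -/
theorem tendsto_cauchyTransform_boundary {ρ u : ℝ → ℝ} (hρ : Integrable ρ)
    (hd : Differentiable ℝ ρ) (hu : IsHilbertTransform ρ u) (x : ℝ) :
    Tendsto (fun y : ℝ => cauchyTransform ρ (x + Complex.I * y)) (𝓝[>] 0)
      (𝓝 (u x - Complex.I * ρ x)) := by
  set χ : ℝ → ℝ := fun s => (1 + (s - x) ^ 2)⁻¹ with hχ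
  have hχi : Integrable χ := integrable_lorentz x
  have hχd : Differentiable ℝ χ := by
    intro s
    exact DifferentiableAt.inv (by fun_prop) (by positivity)
  -- A multiple of the Lorentzian cancels the value at `x`; differentiability then makes `k/(x - s)`
  -- integrable. The subtracted part is even about `x` and contributes nothing to the principal
  -- value, while its Cauchy transform is explicit and produces `-iρ(x)`.
  set k : ℝ → ℝ := fun s => ρ s + -ρ x * χ s with hk
  have hki : Integrable k := hρ.add (hχi.const_mul _)
  have hkd : Differentiable ℝ k := hd.add (hχd.const_mul _)
  have hkx : k x = 0 := by simp [hk, hχ]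
  set w : ℝ → ℝ := fun s => k s / (x - s) with hw
  have hwi : Integrable w := by
    obtain ⟨c, hc⟩ := (hkd x).hasDerivAt.isBigO_sub.bound
    obtain ⟨δ, hδ, hball⟩ := Metric.eventually_nhds_iff.mp hc
    have hdom : Integrable fun s => (Metric.ball x δ).indicator (fun _ => |c|) s + |k s| / δ :=
      ((integrable_indicator_iff Metric.isOpen_ball.measurableSet).mpr
        (integrableOn_const (by finiteness))).add (hki.abs.div_const δ)
    refine hdom.mono' ?_ (ae_of_all _ fun s => ?_)
    · exact (hkd.continuous.measurable.div (measurable_const.sub measurable_id)).aestronglyMeasurable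
    · simp only [hw]
      rw [norm_div, Real.norm_eq_abs, Real.norm_eq_abs]
      by_cases hs : s ∈ Metric.ball x δ
      · rw [Set.indicator_of_mem hs]
        have h1 := hball hs
        rw [hkx, sub_zero, Real.norm_eq_abs, Real.norm_eq_abs, abs_sub_comm s x] at h1
        have h2 : |k s| / |x - s| ≤ |c| := by
          refine div_le_of_le_mul₀ (abs_nonneg _) (abs_nonneg _) (h1.trans ?_)
          exact mul_le_mul_of_nonneg_right (le_abs_self c) (abs_nonneg _)
        have : 0 ≤ |k s| / δ := by positivity
        linarith
      · rw [Set.indicator_of_notMem hs, zero_add]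
        rw [Metric.mem_ball, not_lt, dist_comm, Real.dist_eq] at hs
        exact div_le_div_of_nonneg_left (abs_nonneg _) hδ hs
  have hux : u x = 1 / Real.pi * ∫ s, w s := by
    have h1 := (tendsto_setIntegral_punctured hwi x).const_mul (1 / Real.pi)
    refine tendsto_nhds_unique (hu x) (h1.congr' ?_)
    filter_upwards [self_mem_nhdsWithin] with ε hε
    have hε' : 0 < ε := hε
    have hms : MeasurableSet {y : ℝ | ε < |x - y|} :=
      (isOpen_lt continuous_const (by fun_prop)).measurableSet
    have hodd : ∫ y in {y : ℝ | ε < |x - y|}, ρ x * χ y / (x - y) = 0 := by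
      refine setIntegral_punctured_odd x ε fun y => ?_
      simp only [hχ]
      rw [show (2 * x - y - x) ^ 2 = (y - x) ^ 2 by ring,
        show x - (2 * x - y) = -(x - y) by ring, div_neg]
    have hint : IntegrableOn (fun y => ρ x * χ y / (x - y)) {y : ℝ | ε < |x - y|} := by
      refine Integrable.mono' (((hχi.const_mul (ρ x)).abs.div_const ε).integrableOn) ?_ ?_
      · exact ((measurable_const.mul hχd.continuous.measurable).div
          (measurable_const.sub measurable_id)).aestronglyMeasurable
      · rw [ae_restrict_iff' hms]
        refine ae_of_all _ fun y hy => ?_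
        rw [norm_div, Real.norm_eq_abs, Real.norm_eq_abs]
        exact div_le_div_of_nonneg_left (abs_nonneg _) hε' (le_of_lt hy)
    congr 1
    rw [← add_zero (∫ y in {y : ℝ | ε < |x - y|}, w y), ← hodd,
      ← integral_add hwi.integrableOn hint]
    congr 1; ext y
    simp only [hw, hk]
    ring
  have hC1 : Tendsto (fun y : ℝ => cauchyTransform k (x + Complex.I * y)) (𝓝[>] 0)
      (𝓝 (u x : ℂ)) := by
    rw [hux]
    push_cast
    rw [← integral_complex_ofReal]
    refine Tendsto.const_mul _ ?_
    refine tendsto_integral_filter_of_dominated_convergence (fun s => |w s|) ?_ ?_ hwi.abs ?_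
    · filter_upwards [self_mem_nhdsWithin] with y hy
      exact (integrable_cauchy hki (z := x + Complex.I * y) (by simpa using hy)).1
    · filter_upwards [self_mem_nhdsWithin] with y hy
      have hy' : 0 < y := hy
      refine ae_of_all _ fun s => ?_
      rw [norm_div, Complex.norm_real, Real.norm_eq_abs]
      simp only [hw]
      rw [abs_div]
      by_cases hs : s = x
      · rw [hs, hkx]; simp
      · have h0 : 0 < |x - s| := abs_pos.mpr (sub_ne_zero.mpr (Ne.symm hs))
        refine div_le_div_of_nonneg_left (abs_nonneg _) h0 ?_
        have : ((x : ℂ) + Complex.I * y - s).re = x - s := by simp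
        rw [← this]
        exact Complex.abs_re_le_norm _
    · have hne : ∀ᵐ s : ℝ, s ≠ x := by simp [ae_iff, measure_singleton]
      filter_upwards [hne] with s hs
      have h0 : (x : ℂ) - s ≠ 0 := by
        rw [← Complex.ofReal_sub]
        exact_mod_cast sub_ne_zero.mpr (Ne.symm hs)
      have hc : ContinuousAt (fun y : ℝ => (k s : ℂ) / (x + Complex.I * y - s)) 0 := by
        refine ContinuousAt.div continuousAt_const (by fun_prop) ?_
        simpa using h0
      have h1 := hc.tendsto
      simp only [Complex.ofReal_zero, mul_zero, add_zero] at h1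
      simp only [hw]
      push_cast
      exact h1.mono_left nhdsWithin_le_nhds
  have hC2 : Tendsto (fun y : ℝ => (ρ x : ℂ) * (x + Complex.I * y - (x - Complex.I))⁻¹) (𝓝[>] 0)
      (𝓝 (-(Complex.I * ρ x))) := by
    have hc : ContinuousAt
        (fun y : ℝ => (ρ x : ℂ) * (x + Complex.I * y - (x - Complex.I))⁻¹) 0 := by
      refine continuousAt_const.mul (ContinuousAt.inv₀ (by fun_prop) ?_)
      simp
    have h1 := hc.tendsto.mono_left (nhdsWithin_le_nhds (s := Set.Ioi 0))
    simp only [Complex.ofReal_zero, mul_zero, add_zero, sub_sub_cancel, Complex.inv_I] at h1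
    rwa [mul_neg, mul_comm] at h1
  have := hC1.add hC2
  rw [← sub_eq_add_neg] at this
  refine this.congr' ?_
  filter_upwards [self_mem_nhdsWithin] with y hy
  have hz : 0 < ((x : ℂ) + Complex.I * y).im := by simpa using hy
  rw [hk, cauchyTransform_add hρ (hχi.const_mul _) hz, cauchyTransform_const_mul,
    hχ, cauchyTransform_lorentz x hz]
  push_cast
  ring

end BoundaryValues

/-! ### `L²` bounds on horizontal lines -/

section Lines

theorem norm_halfExp_le {z : ℂ} (hz : 0 < z.im) (ξ : ℝ) : ‖halfExp z ξ‖ ≤ 2 * Real.pi := by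
  unfold halfExp
  by_cases h : ξ ∈ Set.Ioi (0 : ℝ)
  · rw [Set.indicator_of_mem h, norm_mul, norm_neg]
    have h1 : ‖(2 * Real.pi * Complex.I : ℂ)‖ = 2 * Real.pi := by
      simp [abs_of_pos Real.pi_pos]
    have h2 : ‖Complex.exp (2 * Real.pi * Complex.I * z * ξ)‖ ≤ 1 := by
      rw [Complex.norm_exp, Real.exp_le_one_iff, Complex.re_mul_ofReal, re_two_pi_I_mul]
      have : 0 < ξ := h
      have := mul_pos (mul_pos Real.two_pi_pos hz) this
      linarith
    rw [h1]
    exact mul_le_of_le_one_right Real.two_pi_pos.le h2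
  · rw [Set.indicator_of_notMem h, norm_zero]
    exact Real.two_pi_pos.le

theorem halfExp_add (x : ℝ) (z : ℂ) (ξ : ℝ) :
    halfExp (x + z) ξ = Complex.exp (2 * Real.pi * Complex.I * x * ξ) * halfExp z ξ := by
  unfold halfExp
  by_cases h : ξ ∈ Set.Ioi (0 : ℝ)
  · rw [Set.indicator_of_mem h, Set.indicator_of_mem h, mul_left_comm, ← Complex.exp_add]
    congr 2; ring
  · rw [Set.indicator_of_notMem h, Set.indicator_of_notMem h, mul_zero]

theorem tendsto_halfExp (ξ : ℝ) :
    Tendsto (fun y : ℝ => halfExp (Complex.I * y) ξ) (𝓝[>] 0)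
      (𝓝 ((Set.Ioi (0 : ℝ)).indicator (fun _ => -(2 * Real.pi * Complex.I)) ξ)) := by
  unfold halfExp
  by_cases h : ξ ∈ Set.Ioi (0 : ℝ)
  · simp_rw [Set.indicator_of_mem h]
    have : Continuous fun y : ℝ => -(2 * Real.pi * Complex.I) *
        Complex.exp (2 * Real.pi * Complex.I * (Complex.I * y) * ξ) := by fun_prop
    have h1 := (this.tendsto 0).mono_left (nhdsWithin_le_nhds (s := Set.Ioi 0))
    simpa using h1
  · simp_rw [Set.indicator_of_notMem h]
    exact tendsto_const_nhds

variable {ρ : ℝ → ℝ} (hρ : Integrable ρ)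

include hρ

theorem integrable_fourier_mul_halfExp {z : ℂ} (hz : 0 < z.im) :
    Integrable fun ξ => 𝓕 (fun x => (ρ x : ℂ)) ξ * halfExp z ξ :=
  (integrable_halfExp hz).bdd_mul
    (continuous_fourier (integrable_ofReal_complex hρ)).aestronglyMeasurable
    (ae_of_all _ fun ξ => norm_fourier_le _ ξ)

theorem cauchyTransform_line_eq {y : ℝ} (hy : 0 < y) (x : ℝ) :
    cauchyTransform ρ (x + Complex.I * y) = 1 / (Real.pi : ℂ) *
      𝓕⁻ (fun ξ => 𝓕 (fun x => (ρ x : ℂ)) ξ * halfExp (Complex.I * y) ξ) x := by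
  rw [cauchyTransform_eq_fourier hρ (by simpa using hy), fourierInv_eq_fourier_neg',
    Real.fourier_real_eq_integral_exp_smul]
  congr 2; ext ξ
  rw [halfExp_add, smul_eq_mul, mul_left_comm]
  congr 2
  push_cast; ring

theorem continuous_cauchyTransform_line {y : ℝ} (hy : 0 < y) :
    Continuous fun x : ℝ => cauchyTransform ρ (x + Complex.I * y) := by
  refine continuous_iff_continuousAt.mpr fun x => ?_
  have h1 : ContinuousAt (cauchyTransform ρ) (x + Complex.I * y) :=
    (hasDerivAt_cauchyTransform hρ (by simpa using hy)).continuousAt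
  exact ContinuousAt.comp (f := fun x : ℝ => (x : ℂ) + Complex.I * y) h1
    (by fun_prop)

/-- Plancherel twice: on a line the Cauchy transform is `1/π` times the inverse Fourier transform of
`ρ̂` multiplied by a function of modulus at most `2π`, whence the factor `2`, independent of the
height. -/
theorem eLpNorm_cauchyTransform_line_le {C : NNReal} (hC : eLpNorm ρ 2 volume ≤ C) {y : ℝ}
    (hy : 0 < y) :
    eLpNorm (fun x : ℝ => cauchyTransform ρ (x + Complex.I * y)) 2 volume ≤ (2 * C : NNReal) := by
  have hyi : 0 < (Complex.I * (y : ℂ)).im := by simpa using hy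
  set r : ℝ → ℂ := 𝓕 fun x => (ρ x : ℂ) with hr
  set A : ℝ → ℂ := fun ξ => r ξ * halfExp (Complex.I * y) ξ with hA
  have hAi : Integrable A := integrable_fourier_mul_halfExp hρ hyi
  have hρ2 : MemLp ρ 2 := ⟨hρ.1, hC.trans_lt ENNReal.coe_lt_top⟩
  have hρc : MemLp (fun x => (ρ x : ℂ)) 2 := hρ2.ofReal
  obtain ⟨hr2, hrn⟩ := memLp_fourier (integrable_ofReal_complex hρ) hρc
  have hrC : eLpNorm r 2 volume ≤ C := by
    rw [hr, hrn]
    refine le_trans (le_of_eq (eLpNorm_congr_norm_ae (ae_of_all _ fun x => ?_))) hC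
    rw [Complex.norm_real]
  have hAle : eLpNorm A 2 volume ≤ ENNReal.ofReal (2 * Real.pi) * C := by
    refine (eLpNorm_le_mul_eLpNorm_of_ae_le_mul (g := r) (c := 2 * Real.pi)
      (ae_of_all _ fun ξ => ?_) 2).trans (by gcongr)
    rw [hA]
    simp only [norm_mul]
    rw [mul_comm]
    exact mul_le_mul_of_nonneg_right (norm_halfExp_le hyi ξ) (norm_nonneg _)
  have hA2 : MemLp A 2 := ⟨hAi.1, hAle.trans_lt (by finiteness)⟩
  obtain ⟨hFA, hFAn⟩ := memLp_fourier hAi hA2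
  have e : (fun x : ℝ => cauchyTransform ρ (x + Complex.I * y)) =
      (1 / (Real.pi : ℂ)) • ((𝓕 A) ∘ Neg.neg) := by
    ext x
    rw [cauchyTransform_line_eq hρ hy, fourierInv_eq_fourier_neg']
    rfl
  rw [e, eLpNorm_const_smul,
    eLpNorm_comp_measurePreserving hFA.1 (Measure.measurePreserving_neg volume), hFAn]
  have hpi : ‖(1 / (Real.pi : ℂ))‖ₑ = ENNReal.ofReal (1 / Real.pi) := by
    rw [← ofReal_norm, norm_div, norm_one, Complex.norm_real, Real.norm_of_nonneg Real.pi_pos.le]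
  rw [hpi]
  calc ENNReal.ofReal (1 / Real.pi) * eLpNorm A 2 volume
      ≤ ENNReal.ofReal (1 / Real.pi) * (ENNReal.ofReal (2 * Real.pi) * C) := by gcongr
    _ = (2 * C : NNReal) := by
      rw [← mul_assoc, ← ENNReal.ofReal_mul (by positivity)]
      have : 1 / Real.pi * (2 * Real.pi) = 2 := by have := Real.pi_pos; field_simp
      rw [this]
      push_cast
      norm_num

/-- The constant must be `1`: with the pointwise convergence as `y → 0` it yields strong convergence
in `L²`. -/
theorem integral_im_line_sq_le (hρ2 : MemLp ρ 2) {y : ℝ} (hy : 0 < y) :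
    ∫ x : ℝ, (-(cauchyTransform ρ (x + Complex.I * y)).im) ^ 2 ≤ ∫ s, ρ s ^ 2 := by
  obtain ⟨h1, h2⟩ := memLp_poissonConv hy hρ hρ2
  have hle : ∀ x : ℝ, (-(cauchyTransform ρ (x + Complex.I * y)).im) ^ 2 ≤
      (1 / Real.pi) ^ 2 * poissonConv y (fun s => |ρ s|) x ^ 2 := by
    intro x
    rw [im_cauchyTransform hρ (by simpa using hy), neg_neg, mul_pow]
    refine mul_le_mul_of_nonneg_left ?_ (by positivity)
    refine sq_le_sq.mpr (le_trans ?_ (le_abs_self _))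
    rw [poissonConv, ← Real.norm_eq_abs]
    refine (norm_integral_le_integral_norm _).trans (le_of_eq ?_)
    congr 1; ext s
    rw [norm_sub_ofReal_sq, norm_mul, Real.norm_eq_abs]
    simp only [Complex.add_im, Complex.ofReal_im, Complex.I_mul_im, Complex.ofReal_re, zero_add,
      Complex.add_re, Complex.I_mul_re, neg_zero, add_zero]
    rw [Real.norm_of_nonneg (by positivity)]
  refine (integral_mono_of_nonneg (ae_of_all _ fun x => sq_nonneg _)
    (h1.integrable_sq.const_mul _) (ae_of_all _ hle)).trans ?_
  rw [integral_const_mul]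
  have h3 := mul_le_mul_of_nonneg_left h2 (show 0 ≤ (1 / Real.pi) ^ 2 by positivity)
  refine h3.trans (le_of_eq ?_)
  have := Real.pi_pos
  generalize ∫ s, ρ s ^ 2 = I
  field_simp

end Lines

/-! ### Identities for `ρ` and its Hilbert transform -/

section Trace

variable {ρ u : ℝ → ℝ} {C : NNReal} (hρ : Integrable ρ) (hC : eLpNorm ρ 2 volume ≤ C)
  (hd : Differentiable ℝ ρ) (hu : IsHilbertTransform ρ u)

include hρ hC in
theorem eventually_line : ∀ᶠ y : ℝ in 𝓝[>] 0,
    AEStronglyMeasurable (fun x : ℝ => cauchyTransform ρ (x + Complex.I * y)) volume ∧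
    eLpNorm (fun x : ℝ => cauchyTransform ρ (x + Complex.I * y)) 2 volume ≤ (2 * C : NNReal) := by
  filter_upwards [self_mem_nhdsWithin] with y hy
  exact ⟨(continuous_cauchyTransform_line hρ hy).aestronglyMeasurable,
    eLpNorm_cauchyTransform_line_le hρ hC hy⟩

include hρ hC hd hu

/-- `u` is given only by pointwise principal values. It is the real part of the pointwise limit of
Cauchy transforms on lines, which are bounded in `L²`. -/
theorem eLpNorm_hilbertTransform_le :
    AEStronglyMeasurable u volume ∧ eLpNorm u 2 volume ≤ (2 * C : NNReal) := by
  obtain ⟨h1, h2⟩ := eLpNorm_le_of_ae_tendsto_of_eventually (eventually_line hρ hC)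
    (ae_of_all _ (tendsto_cauchyTransform_boundary hρ hd hu))
  have e : (fun x : ℝ => (((u x : ℂ) - Complex.I * ρ x)).re) = u := by
    ext x; simp
  refine ⟨?_, le_trans (eLpNorm_mono fun x => ?_) h2⟩
  · rw [← e]; exact Complex.continuous_re.comp_aestronglyMeasurable h1
  · have h3 := Complex.abs_re_le_norm ((u x : ℂ) - Complex.I * ρ x)
    rwa [congrFun e x] at h3

theorem memLp_hilbertTransform : MemLp u 2 :=
  have h := eLpNorm_hilbertTransform_le hρ hC hd hu
  ⟨h.1, h.2.trans_lt ENNReal.coe_lt_top⟩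

theorem tendsto_integral_line {g : ℝ → ℂ} (hg : MemLp g 2) :
    Tendsto (fun y : ℝ => ∫ x : ℝ, cauchyTransform ρ (x + Complex.I * y) * g x) (𝓝[>] 0)
      (𝓝 (∫ x : ℝ, (u x - Complex.I * ρ x) * g x)) :=
  tendsto_integral_mul_of_ae_tendsto (eventually_line hρ hC)
    (ae_of_all _ (tendsto_cauchyTransform_boundary hρ hd hu)) hg

/-- Tricomi's identity. -/
theorem cauchyTransform_hilbert_mul {z : ℂ} (hz : 0 < z.im) :
    cauchyTransform (fun x => u x * ρ x) z = cauchyTransform ρ z ^ 2 / 2 := by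
  have hρ2 : MemLp ρ 2 := ⟨hρ.1, hC.trans_lt ENNReal.coe_lt_top⟩
  have hu2 := memLp_hilbertTransform hρ hC hd hu
  set F : ℝ → ℝ → ℂ := fun y x => cauchyTransform ρ (x + Complex.I * y) with hF
  have hF2 : ∀ y, 0 < y → MemLp (F y) 2 := fun y hy =>
    ⟨(continuous_cauchyTransform_line hρ hy).aestronglyMeasurable,
      (eLpNorm_cauchyTransform_line_le hρ hC hy).trans_lt ENNReal.coe_lt_top⟩
  have ha2 : ∀ y, 0 < y → MemLp (fun x => (F y x).re) 2 := fun y hy => (hF2 y hy).re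
  have hb2 : ∀ y, 0 < y → MemLp (fun x => -(F y x).im) 2 := fun y hy => (hF2 y hy).im.neg
  have hFim : ∀ y x, -((F y x) ^ 2).im = 2 * ((F y x).re * (-(F y x).im)) := by
    intro y x; rw [sq, Complex.mul_im]; ring
  have hψb : ∀ s : ℝ, ‖(z - s)⁻¹‖ ≤ z.im⁻¹ := norm_inv_sub_le hz
  -- The square of the Cauchy transform shifted by `iy` is holomorphic on the closed half-plane,
  -- hence the Cauchy transform of minus its imaginary part `2 Re F (-Im F)`. The identity is the
  -- limit `y → 0`.
  have key : ∀ y : ℝ, 0 < y → cauchyTransform ρ (z + Complex.I * y) ^ 2 =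
      2 * (1 / (Real.pi : ℂ) *
        ∫ x : ℝ, (((F y x).re * (-(F y x).im) : ℝ) : ℂ) * (z - x)⁻¹) := by
    intro y hy
    have hmem : ∀ w ∈ closedUpperHalf, 0 < (w + Complex.I * y).im := fun w hw => by
      have : 0 ≤ w.im := hw
      simp; linarith
    have h1 := eq_cauchyTransform_of_analytic
      (F := fun w => cauchyTransform ρ (w + Complex.I * y) ^ 2) ?_ ?_ ?_ hz
    · rw [h1, cauchyTransform]
      have h2 : ∀ x : ℝ, ((-((cauchyTransform ρ ((x : ℂ) + Complex.I * y)) ^ 2).im : ℝ) : ℂ) /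
          (z - x) = 2 * ((((F y x).re * (-(F y x).im) : ℝ) : ℂ) * (z - x)⁻¹) := by
        intro x
        have := hFim y x
        simp only [hF] at this ⊢
        rw [this]; push_cast; ring
      simp_rw [h2]
      rw [integral_const_mul]; ring
    · intro w hw
      have h3 : AnalyticAt ℂ (fun w : ℂ => w + Complex.I * y) w := by fun_prop
      exact (AnalyticAt.fun_comp (g := cauchyTransform ρ) (f := fun w : ℂ => w + Complex.I * y)
        (analyticOnNhd_cauchyTransform hρ _ (hmem w hw)) h3).pow 2
    · have h3 : Tendsto (fun w : ℂ => w + Complex.I * y)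
          (Bornology.cobounded ℂ ⊓ 𝓟 closedUpperHalf)
          (Bornology.cobounded ℂ ⊓ 𝓟 {z | y ≤ z.im}) := by
        refine tendsto_inf.mpr ⟨?_, tendsto_principal.mpr ?_⟩
        · have := tendsto_sub_const_cobounded (-(Complex.I * (y : ℂ)))
          simp only [sub_neg_eq_add] at this
          exact this.mono_left inf_le_left
        · filter_upwards [mem_inf_of_right (mem_principal_self _)] with w hw
          have : 0 ≤ w.im := hw
          simpa using this
      have h4 := ((tendsto_cauchyTransform_zero hρ hy).comp h3).pow 2
      simpa using h4
    · have : Integrable fun x => (F y x).re * (-(F y x).im) := (ha2 y hy).integrable_mul (hb2 y hy)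
      refine (this.const_mul 2).neg.congr (ae_of_all _ fun x => ?_)
      simp only [Pi.neg_apply]
      rw [← hFim, neg_neg]
  have hconv1 : Tendsto (fun y => ∫ x : ℝ, ((F y x).re : ℂ) * ((ρ x : ℂ) * (z - x)⁻¹)) (𝓝[>] 0)
      (𝓝 (∫ x : ℝ, (u x : ℂ) * ((ρ x : ℂ) * (z - x)⁻¹))) := by
    refine tendsto_integral_mul_of_ae_tendsto (C := 2 * C) ?_ (ae_of_all _ fun x => ?_) ?_
    · filter_upwards [self_mem_nhdsWithin] with y hy
      have hm : MemLp (fun x => ((F y x).re : ℂ)) 2 := (ha2 y hy).ofReal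
      refine ⟨hm.1, le_trans (eLpNorm_mono fun x => ?_) (eLpNorm_cauchyTransform_line_le hρ hC hy)⟩
      rw [Complex.norm_real]
      exact Complex.abs_re_le_norm _
    · have h1 := (Complex.continuous_re.tendsto _).comp
        (tendsto_cauchyTransform_boundary hρ hd hu x)
      have h2 := (Complex.continuous_ofReal.tendsto _).comp h1
      have h3 : ((u x : ℂ) - Complex.I * ρ x).re = u x := by simp
      rw [h3] at h2
      exact h2
    · refine MemLp.of_le_mul (c := z.im⁻¹) (hρ2.ofReal (K := ℂ)) ?_ (ae_of_all _ fun x => ?_)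
      · exact ((hρ2.ofReal (K := ℂ)).1).mul (continuous_inv_sub hz).aestronglyMeasurable
      · rw [norm_mul, mul_comm]
        exact mul_le_mul_of_nonneg_right (hψb x) (norm_nonneg _)
  -- A product of two weakly convergent factors need not converge to the product; here `-Im F`
  -- converges strongly to `ρ`, and `Re F` is bounded in `L²`.
  have hconv2 : Tendsto (fun y => ∫ x : ℝ, ((F y x).re : ℂ) *
      (((-(F y x).im - ρ x : ℝ) : ℂ) * (z - x)⁻¹)) (𝓝[>] 0) (𝓝 0) := by
    have hs : Tendsto (fun y => ∫ x : ℝ, (-(F y x).im - ρ x) ^ 2) (𝓝[>] 0) (𝓝 0) := by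
      refine tendsto_integral_sub_sq hρ2 ?_ (ae_of_all _ fun x => ?_)
      · filter_upwards [self_mem_nhdsWithin] with y hy
        exact ⟨hb2 y hy, integral_im_line_sq_le hρ hρ2 hy⟩
      · have h1 := ((Complex.continuous_im.tendsto _).comp
          (tendsto_cauchyTransform_boundary hρ hd hu x)).neg
        simpa using h1
    have hs2 : Tendsto (fun y => z.im⁻¹ * √(((2 * C : NNReal) : ℝ) ^ 2 *
        ∫ x : ℝ, (-(F y x).im - ρ x) ^ 2)) (𝓝[>] 0) (𝓝 0) := by
      have := ((Real.continuous_sqrt.tendsto _).comp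
        (hs.const_mul (((2 * C : NNReal) : ℝ) ^ 2))).const_mul z.im⁻¹
      simpa using this
    refine squeeze_zero_norm' ?_ hs2
    filter_upwards [self_mem_nhdsWithin] with y hy
    have hm1 := ha2 y hy
    have hm2 : MemLp (fun x => -(F y x).im - ρ x) 2 := (hb2 y hy).sub hρ2
    have hcs := integral_mul_sq_le hm1 hm2
    have hint : Integrable fun x => ‖(F y x).re‖ * ‖-(F y x).im - ρ x‖ :=
      hm1.norm.integrable_mul hm2.norm
    have hle : ∫ x, (F y x).re ^ 2 ≤ ((2 * C : NNReal) : ℝ) ^ 2 := by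
      have h3 := (integral_norm_sq_le_of_eLpNorm_le (hF2 y hy).1
        (eLpNorm_cauchyTransform_line_le hρ hC hy)).2
      refine (integral_mono hm1.integrable_sq ((hF2 y hy).integrable_norm_pow (by norm_num))
        fun x => ?_).trans h3
      simp only
      rw [← sq_abs]
      exact pow_le_pow_left₀ (abs_nonneg _) (Complex.abs_re_le_norm _) 2
    calc ‖∫ x : ℝ, ((F y x).re : ℂ) * (((-(F y x).im - ρ x : ℝ) : ℂ) * (z - x)⁻¹)‖
        ≤ ∫ x, z.im⁻¹ * (‖(F y x).re‖ * ‖-(F y x).im - ρ x‖) := by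
          refine norm_integral_le_of_norm_le (hint.const_mul _) (ae_of_all _ fun x => ?_)
          rw [norm_mul, norm_mul, Complex.norm_real, Complex.norm_real]
          calc _ = (‖(F y x).re‖ * ‖-(F y x).im - ρ x‖) * ‖(z - (x : ℂ))⁻¹‖ := by ring
            _ ≤ (‖(F y x).re‖ * ‖-(F y x).im - ρ x‖) * z.im⁻¹ :=
              mul_le_mul_of_nonneg_left (hψb x) (by positivity)
            _ = _ := mul_comm _ _
      _ = z.im⁻¹ * ∫ x, ‖(F y x).re‖ * ‖-(F y x).im - ρ x‖ := integral_const_mul _ _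
      _ ≤ _ := by
          refine mul_le_mul_of_nonneg_left ?_ (inv_nonneg.mpr hz.le)
          refine Real.le_sqrt_of_sq_le (hcs.trans ?_)
          exact mul_le_mul_of_nonneg_right hle (integral_nonneg fun x => sq_nonneg _)
  have hsum := hconv1.add hconv2
  rw [add_zero] at hsum
  have hlim2 := ((hsum.const_mul (1 / (Real.pi : ℂ))).const_mul 2)
  have hlim1 : Tendsto (fun y : ℝ => cauchyTransform ρ (z + Complex.I * y) ^ 2) (𝓝[>] 0)
      (𝓝 (cauchyTransform ρ z ^ 2)) := by
    have h1 : ContinuousAt (cauchyTransform ρ) (z + Complex.I * (0 : ℝ)) := by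
      simpa using (hasDerivAt_cauchyTransform hρ hz).continuousAt
    have h2 : ContinuousAt (fun y : ℝ => cauchyTransform ρ (z + Complex.I * y)) 0 :=
      ContinuousAt.comp (f := fun y : ℝ => z + Complex.I * y) h1 (by fun_prop)
    have h3 := (h2.tendsto.mono_left (nhdsWithin_le_nhds (s := Set.Ioi 0))).pow 2
    simpa using h3
  have heq := tendsto_nhds_unique hlim1 (hlim2.congr' ?_)
  · rw [heq, cauchyTransform]
    have : ∀ x : ℝ, ((u x * ρ x : ℝ) : ℂ) / (z - x) = (u x : ℂ) * ((ρ x : ℂ) * (z - x)⁻¹) := by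
      intro x; push_cast; ring
    simp_rw [this]
    ring
  · filter_upwards [self_mem_nhdsWithin] with y hy
    rw [key y hy]
    congr 2
    have hi1 : Integrable fun x : ℝ => ((F y x).re : ℂ) * ((ρ x : ℂ) * (z - x)⁻¹) := by
      have h0 : Integrable fun x => (F y x).re * ρ x := (ha2 y hy).integrable_mul hρ2
      refine (integrable_mul_bounded h0 (continuous_inv_sub hz) hψb).congr
        (ae_of_all _ fun x => ?_)
      push_cast; ring
    have hi2 : Integrable fun x : ℝ => ((F y x).re : ℂ) *
        (((-(F y x).im - ρ x : ℝ) : ℂ) * (z - x)⁻¹) := by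
      have h0 : Integrable fun x => (F y x).re * (-(F y x).im - ρ x) :=
        (ha2 y hy).integrable_mul ((hb2 y hy).sub hρ2)
      refine (integrable_mul_bounded h0 (continuous_inv_sub hz) hψb).congr
        (ae_of_all _ fun x => ?_)
      push_cast; ring
    rw [← integral_add hi1 hi2]
    congr 1; ext x
    push_cast; ring

/-- `u - iρ` is the boundary value of a function holomorphic above the axis, hence orthogonal to
`1/(z̄ - x)²`, also holomorphic there. Conjugating turns this into a relation between the integrals
of `u` and of `ρ` against `1/(z - x)²`. -/
theorem integral_hilbert_mul_inv_sq {z : ℂ} (hz : 0 < z.im) :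
    ∫ x : ℝ, (u x : ℂ) * ((z - x)⁻¹ * (z - x)⁻¹) =
      Complex.I * Real.pi * cauchyDeriv ρ z := by
  have hρ2 : MemLp ρ 2 := ⟨hρ.1, hC.trans_lt ENNReal.coe_lt_top⟩
  have hu2 := memLp_hilbertTransform hρ hC hd hu
  set g : ℝ → ℂ := fun x => (starRingEnd ℂ z - x)⁻¹ * (starRingEnd ℂ z - x)⁻¹ with hg
  have hconj : ∀ x : ℝ, (starRingEnd ℂ) ((z - x)⁻¹ * (z - x)⁻¹) = g x := by
    intro x; simp [hg]
  have hψ2 : MemLp (fun x : ℝ => (z - x)⁻¹ * (z - x)⁻¹) 2 := by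
    refine MemLp.of_le_mul (c := z.im⁻¹) (memLp_two_inv_sub hz)
      ((continuous_inv_sub hz).mul (continuous_inv_sub hz)).aestronglyMeasurable
      (ae_of_all _ fun x => ?_)
    rw [norm_mul]
    exact mul_le_mul_of_nonneg_right (norm_inv_sub_le hz x) (norm_nonneg _)
  have hgn : ∀ x : ℝ, ‖g x‖ = ‖(z - x)⁻¹ * (z - (x : ℂ))⁻¹‖ := by
    intro x; rw [← hconj, RCLike.norm_conj]
  have hgc : Continuous g := by
    have : g = fun x : ℝ => (starRingEnd ℂ) ((z - x)⁻¹ * (z - x)⁻¹) := funext fun x => (hconj x).symm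
    rw [this]
    exact Complex.continuous_conj.comp ((continuous_inv_sub hz).mul (continuous_inv_sub hz))
  have hg2 : MemLp g 2 := hψ2.of_le hgc.aestronglyMeasurable (ae_of_all _ fun x => (hgn x).le)
  have hzero : ∀ y : ℝ, 0 < y → ∫ x : ℝ, cauchyTransform ρ (x + Complex.I * y) * g x = 0 := by
    intro y hy
    have hmem : ∀ w ∈ closedUpperHalf, y ≤ (w + Complex.I * y).im := fun w hw => by
      have : 0 ≤ w.im := hw
      simpa using this
    have hne : ∀ w ∈ closedUpperHalf, z.im ≤ ‖starRingEnd ℂ z - w‖ := by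
      intro w hw
      have hw' : 0 ≤ w.im := hw
      have h1 := Complex.abs_im_le_norm (starRingEnd ℂ z - w)
      rw [Complex.sub_im, Complex.conj_im, abs_of_nonpos (by linarith)] at h1
      linarith
    refine integral_eq_zero_of_bounded (h := fun w => cauchyTransform ρ (w + Complex.I * y) *
      ((starRingEnd ℂ z - w)⁻¹ * (starRingEnd ℂ z - w)⁻¹))
      (B := 1 / Real.pi * (∫ s, |ρ s|) / y * (z.im⁻¹ * z.im⁻¹)) ?_ ?_ ?_
    · intro w hw
      have h1 : DifferentiableAt ℂ (fun w => cauchyTransform ρ (w + Complex.I * y)) w :=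
        DifferentiableAt.fun_comp' (f := fun w : ℂ => w + Complex.I * y) w
          (hasDerivAt_cauchyTransform hρ (hy.trans_le (hmem w hw))).differentiableAt
          (by fun_prop)
      have h2 : starRingEnd ℂ z - w ≠ 0 := norm_pos_iff.mp (hz.trans_le (hne w hw))
      have h3 : DifferentiableAt ℂ (fun w => (starRingEnd ℂ z - w)⁻¹) w :=
        DifferentiableAt.inv (by fun_prop) h2
      exact (h1.mul (h3.mul h3)).differentiableWithinAt
    · intro w hw
      rw [norm_mul, norm_mul, norm_inv]
      have h1 : ‖starRingEnd ℂ z - w‖⁻¹ ≤ z.im⁻¹ := inv_anti₀ hz (hne w hw)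
      have h2 : ‖cauchyTransform ρ (w + Complex.I * y)‖ ≤ 1 / Real.pi * (∫ s, |ρ s|) / y := by
        refine (norm_cauchyTransform_le hρ (hy.trans_le (hmem w hw))).trans ?_
        exact div_le_div_of_nonneg_left
          (mul_nonneg (by positivity) (integral_nonneg fun s => abs_nonneg _)) hy (hmem w hw)
      exact mul_le_mul h2 (mul_le_mul h1 h1 (by positivity) (by positivity)) (by positivity)
        ((norm_nonneg _).trans h2)
    · have h1 : MemLp (fun x : ℝ => cauchyTransform ρ (x + Complex.I * y)) 2 :=
        ⟨(continuous_cauchyTransform_line hρ hy).aestronglyMeasurable,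
          (eLpNorm_cauchyTransform_line_le hρ hC hy).trans_lt ENNReal.coe_lt_top⟩
      exact h1.integrable_mul hg2
  have h0 : ∫ x : ℝ, ((u x : ℂ) - Complex.I * ρ x) * g x = 0 := by
    refine tendsto_nhds_unique (tendsto_integral_line hρ hC hd hu hg2)
      (tendsto_const_nhds.congr' ?_)
    filter_upwards [self_mem_nhdsWithin] with y hy
    exact (hzero y hy).symm
  have h1 := congrArg (starRingEnd ℂ) h0
  rw [map_zero, ← integral_conj] at h1
  have h2 : ∀ x : ℝ, (starRingEnd ℂ) (((u x : ℂ) - Complex.I * ρ x) * g x) =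
      (u x : ℂ) * ((z - x)⁻¹ * (z - x)⁻¹) + Complex.I * ((ρ x : ℂ) * ((z - x)⁻¹ * (z - x)⁻¹)) := by
    intro x
    rw [← hconj, map_mul, Complex.conj_conj, map_sub, map_mul, Complex.conj_ofReal,
      Complex.conj_ofReal, Complex.conj_I]
    ring
  have i1 : Integrable fun x : ℝ => (u x : ℂ) * ((z - x)⁻¹ * (z - x)⁻¹) :=
    MemLp.integrable_mul (hu2.ofReal (K := ℂ)) hψ2
  have i2 : Integrable fun x : ℝ => (ρ x : ℂ) * ((z - x)⁻¹ * (z - x)⁻¹) :=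
    integrable_mul_inv_mul_inv hρ hz hz
  simp_rw [h2] at h1
  rw [integral_add i1 (i2.const_mul _), integral_const_mul] at h1
  rw [cauchyDeriv]
  have hpi : (Real.pi : ℂ) ≠ 0 := by exact_mod_cast Real.pi_pos.ne'
  generalize ∫ x : ℝ, (u x : ℂ) * ((z - x)⁻¹ * (z - x)⁻¹) = A at *
  generalize ∫ x : ℝ, (ρ x : ℂ) * ((z - x)⁻¹ * (z - x)⁻¹) = B at *
  field_simp
  linear_combination h1

/-- The weak form of `Λ = ∂ₓH`. On the Fourier side `u - iρ` equals `-2i ρ̂` on positive frequencies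
and zero elsewhere, so `u` has multiplier `-i` for `ξ > 0` and `i` for `ξ < 0`; with the derivative
this gives `|2πξ|`. -/
theorem integral_fracLaplacian_mul {v : ℝ → ℝ} (hv : IsFracLaplacian 1 ρ v) (η : 𝓢(ℝ, ℂ)) :
    ∫ x : ℝ, (v x : ℂ) * η x = -∫ x : ℝ, (u x : ℂ) * deriv η x := by
  have hρ2 : MemLp ρ 2 := ⟨hρ.1, hC.trans_lt ENNReal.coe_lt_top⟩
  have hu2 := memLp_hilbertTransform hρ hC hd hu
  set r : ℝ → ℂ := 𝓕 fun x => (ρ x : ℂ) with hr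
  set φ : 𝓢(ℝ, ℂ) := 𝓕⁻ η with hφ
  set η' : 𝓢(ℝ, ℂ) := SchwartzMap.derivCLM ℂ ℂ η with hη'
  have hη'x : ∀ x, η' x = deriv η x := fun x => rfl
  have hFφ : ∀ x, 𝓕 (φ : ℝ → ℂ) x = η x := by
    intro x
    rw [← SchwartzMap.fourier_coe, hφ, FourierTransform.fourier_fourierInv_eq]
  have hφx : ∀ ξ, φ ξ = 𝓕⁻ (η : ℝ → ℂ) ξ := fun ξ => by rw [hφ, SchwartzMap.fourierInv_coe]
  set θ : 𝓢(ℝ, ℂ) := 𝓕⁻ η' with hθ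
  have hθx : ∀ ξ, θ ξ = 𝓕⁻ (η' : ℝ → ℂ) ξ := fun ξ => by rw [hθ, SchwartzMap.fourierInv_coe]
  have hFθ : ∀ x, 𝓕 (θ : ℝ → ℂ) x = η' x := by
    intro x
    rw [← SchwartzMap.fourier_coe, hθ, FourierTransform.fourier_fourierInv_eq]
  have hη'c : (η' : ℝ → ℂ) = deriv η := funext hη'x
  have hθφ : ∀ ξ : ℝ, θ ξ = -(2 * Real.pi * Complex.I * ξ) * φ ξ := by
    intro ξ
    rw [hθx, hφx, fourierInv_eq_fourier_neg', fourierInv_eq_fourier_neg', hη'c,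
      Real.fourier_deriv η.integrable η.differentiable (by rw [← hη'c]; exact η'.integrable)]
    simp only [smul_eq_mul]
    push_cast; ring
  have hrb : ∀ ξ, ‖r ξ‖ ≤ ∫ x, ‖(ρ x : ℂ)‖ := fun ξ => norm_fourier_le _ ξ
  have hrc : Continuous r := continuous_fourier (integrable_ofReal_complex hρ)
  have hrθ : Integrable fun ξ => r ξ * θ ξ :=
    θ.integrable.bdd_mul hrc.aestronglyMeasurable (ae_of_all _ hrb)
  set ind : ℝ → ℂ := (Set.Ioi (0 : ℝ)).indicator (fun _ => -(2 * Real.pi * Complex.I)) with hind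
  have hindn : ∀ ξ, ‖ind ξ‖ ≤ 2 * Real.pi := by
    intro ξ
    refine (norm_indicator_le_norm_self _ _).trans (le_of_eq ?_)
    simp [abs_of_pos Real.pi_pos]
  have hindm : AEStronglyMeasurable ind volume :=
    (measurable_const.indicator measurableSet_Ioi).aestronglyMeasurable
  have hindi : Integrable fun ξ => ind ξ * (r ξ * θ ξ) :=
    hrθ.bdd_mul hindm (ae_of_all _ hindn)
  have hrη : ∫ x : ℝ, (ρ x : ℂ) * η' x = ∫ ξ, r ξ * θ ξ := by
    rw [hr, integral_fourier_mul_eq_flip (integrable_ofReal_complex hρ) θ.integrable]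
    simp_rw [hFθ]
  have hF : ∫ x : ℝ, ((u x : ℂ) - Complex.I * ρ x) * η' x =
      1 / (Real.pi : ℂ) * ∫ ξ, ind ξ * (r ξ * θ ξ) := by
    refine tendsto_nhds_unique (tendsto_integral_line hρ hC hd hu (η'.memLp 2)) ?_
    have h1 : Tendsto (fun y : ℝ => 1 / (Real.pi : ℂ) *
        ∫ ξ, halfExp (Complex.I * y) ξ * (r ξ * θ ξ)) (𝓝[>] 0)
        (𝓝 (1 / (Real.pi : ℂ) * ∫ ξ, ind ξ * (r ξ * θ ξ))) := by
      refine Tendsto.const_mul _ (tendsto_integral_filter_of_dominated_convergence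
        (fun ξ => 2 * Real.pi * ‖r ξ * θ ξ‖) ?_ ?_ (hrθ.norm.const_mul _) (ae_of_all _ fun ξ => ?_))
      · filter_upwards [self_mem_nhdsWithin] with y hy
        exact (integrable_halfExp (z := Complex.I * y) (by simpa using hy)).1.mul hrθ.1
      · filter_upwards [self_mem_nhdsWithin] with y hy
        refine ae_of_all _ fun ξ => ?_
        rw [norm_mul]
        exact mul_le_mul_of_nonneg_right (norm_halfExp_le (by simpa using hy) ξ) (norm_nonneg _)
      · exact (tendsto_halfExp ξ).mul_const _
    refine h1.congr' ?_
    filter_upwards [self_mem_nhdsWithin] with y hy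
    have hy' : 0 < y := hy
    simp_rw [cauchyTransform_line_eq hρ hy', mul_assoc]
    rw [integral_const_mul, integral_fourierInv_mul_eq_flip
      (integrable_fourier_mul_halfExp hρ (by simpa using hy')) η'.integrable]
    congr 2; ext ξ
    rw [← hθx]; ring
  have iu : Integrable fun x : ℝ => (u x : ℂ) * η' x :=
    MemLp.integrable_mul (hu2.ofReal (K := ℂ)) (η'.memLp 2)
  have iρ : Integrable fun x : ℝ => (ρ x : ℂ) * η' x :=
    MemLp.integrable_mul (hρ2.ofReal (K := ℂ)) (η'.memLp 2)
  have hsplit : ∫ x : ℝ, ((u x : ℂ) - Complex.I * ρ x) * η' x =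
      (∫ x : ℝ, (u x : ℂ) * η' x) - Complex.I * ∫ x : ℝ, (ρ x : ℂ) * η' x := by
    rw [← integral_const_mul, ← integral_sub iu (iρ.const_mul _)]
    congr 1; ext x; ring
  have hvη : ∫ x : ℝ, (v x : ℂ) * η x = -(Complex.I * (∫ ξ, r ξ * θ ξ) +
      1 / (Real.pi : ℂ) * ∫ ξ, ind ξ * (r ξ * θ ξ)) := by
    have h1 := (hv.2 φ).2
    simp_rw [hFφ] at h1
    rw [h1, ← integral_const_mul, ← integral_const_mul,
      ← integral_add (hrθ.const_mul _) (hindi.const_mul _), ← integral_neg]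
    congr 1; ext ξ
    rw [hθφ, Real.rpow_one, ← hr, hind]
    have hpi : (Real.pi : ℂ) ≠ 0 := by exact_mod_cast Real.pi_pos.ne'
    by_cases h : ξ ∈ Set.Ioi (0 : ℝ)
    · have h' : 0 < ξ := h
      rw [Set.indicator_of_mem h, abs_of_pos (mul_pos Real.two_pi_pos h')]
      push_cast
      field_simp
      linear_combination (ξ * r ξ * φ ξ) * Complex.I_sq
    · have h' : ξ ≤ 0 := not_lt.mp h
      rw [Set.indicator_of_notMem h, abs_of_nonpos (mul_nonpos_of_nonneg_of_nonpos
        Real.two_pi_pos.le h')]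
      push_cast
      linear_combination (-2 * Real.pi * ξ * r ξ * φ ξ) * Complex.I_sq
  simp_rw [← hη'x]
  rw [hvη, ← hF, hsplit, hrη]
  ring

end Trace

/-! ### The equation tested against the Cauchy kernel -/

section WeakForm

theorem integral_norm_mul_norm_le {f : ℝ → ℝ} {g : ℝ → ℂ} {C : NNReal}
    (hf : AEStronglyMeasurable f volume) (hC : eLpNorm f 2 volume ≤ C) (hg : MemLp g 2) :
    Integrable (fun x => ‖f x‖ * ‖g x‖) ∧ ∫ x, ‖f x‖ * ‖g x‖ ≤ C * √(∫ x, ‖g x‖ ^ 2) := by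
  obtain ⟨h1, h2⟩ := integral_norm_sq_le_of_eLpNorm_le hf hC
  refine ⟨h1.norm.integrable_mul hg.norm, ?_⟩
  have h3 := integral_mul_sq_le h1 hg.norm
  simp only [norm_norm] at h3
  have e : ∫ x, f x ^ 2 = ∫ x, ‖f x‖ ^ 2 := by simp
  rw [e] at h3
  refine abs_le_of_sq_le_sq' ?_ (by positivity) |>.2
  rw [mul_pow, Real.sq_sqrt (integral_nonneg fun x => by positivity)]
  exact h3.trans (mul_le_mul_of_nonneg_right h2 (integral_nonneg fun x => by positivity))

/-- Smooth compactly supported approximations of `s ↦ (z - s)⁻¹`. -/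
theorem exists_cutoff {z : ℂ} (hz : 0 < z.im) : ∃ (η : ℕ → 𝓢(ℝ, ℂ)) (K : ℝ), 0 ≤ K ∧
    (∀ n, HasCompactSupport (η n)) ∧ (∀ n s, ‖η n s‖ ≤ ‖(z - s)⁻¹‖) ∧
    (∀ n s, ‖deriv (η n) s‖ ≤ K * ‖(z - s)⁻¹‖) ∧
    (∀ n (s : ℝ), ‖(s : ℂ) * deriv (η n) s‖ ≤ K * ‖(z - s)⁻¹‖) ∧
    (∀ s, Tendsto (fun n => η n s) atTop (𝓝 (z - s)⁻¹)) ∧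
    ∀ s : ℝ, Tendsto (fun n => deriv (η n) s) atTop (𝓝 ((z - s)⁻¹ * (z - s)⁻¹)) := by
  let b : ContDiffBump (0 : ℝ) := ⟨1, 2, one_pos, one_lt_two⟩
  have hbc : ContDiff ℝ ∞ b := b.contDiff
  have hbd : ∀ x, HasDerivAt b (deriv b x) x := fun x =>
    (hbc.differentiable (by simp) x).hasDerivAt
  have hb'c : Continuous (deriv b) := hbc.continuous_deriv (by simp)
  have hb's : HasCompactSupport (deriv b) := b.hasCompactSupport.deriv
  obtain ⟨B₁, hB₁⟩ := hb'c.bounded_above_of_compact_support hb's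
  -- The cutoffs are dilates `b(s/N)`, and `s ∂ₛ b(s/N)` is the function `x b'(x)` at `x = s/N`:
  -- bounded uniformly in `N`. This compensates the growth of the drift `γx`.
  obtain ⟨B₂, hB₂⟩ := (continuous_id.mul hb'c).bounded_above_of_compact_support hb's.mul_left
  have hB₁0 : 0 ≤ B₁ := (norm_nonneg _).trans (hB₁ 0)
  have hB₂0 : 0 ≤ B₂ := (norm_nonneg _).trans (hB₂ 0)
  have hψ : ∀ s : ℝ, HasDerivAt (fun s : ℝ => (z - s)⁻¹) ((z - s)⁻¹ * (z - s)⁻¹) s := by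
    intro s
    have h1 : HasDerivAt (fun s : ℝ => z - (s : ℂ)) (-1) s := by
      simpa using (Complex.ofRealCLM.hasDerivAt (x := s)).const_sub z
    refine (h1.inv (sub_ofReal_ne_zero hz s)).congr_deriv ?_
    have := sub_ofReal_ne_zero hz s
    field_simp
  have hψc : ContDiff ℝ ∞ fun s : ℝ => (z - s)⁻¹ := by
    refine ContDiff.inv ?_ fun s => sub_ofReal_ne_zero hz s
    exact contDiff_const.sub Complex.ofRealCLM.contDiff
  set N : ℕ → ℝ := fun n => (n : ℝ) + 1 with hN
  have hN1 : ∀ n, 1 ≤ N n := fun n => by simp [hN]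
  have hN0 : ∀ n, 0 < N n := fun n => by linarith [hN1 n]
  set χ : ℕ → ℝ → ℂ := fun n s => ((b ((N n)⁻¹ * s) : ℝ) : ℂ) with hχ
  have hχd : ∀ n s, HasDerivAt (χ n) (((N n)⁻¹ * deriv b ((N n)⁻¹ * s) : ℝ) : ℂ) s := by
    intro n s
    have h1 : HasDerivAt (fun s : ℝ => (N n)⁻¹ * s) (N n)⁻¹ s := by
      simpa using (hasDerivAt_id s).const_mul (N n)⁻¹
    have h2 := ((hbd ((N n)⁻¹ * s)).comp s h1).ofReal_comp
    refine h2.congr_deriv ?_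
    push_cast; ring
  have hχc : ∀ n, ContDiff ℝ ∞ (χ n) := fun n =>
    Complex.ofRealCLM.contDiff.comp (hbc.comp (contDiff_const.mul contDiff_id))
  have hχs : ∀ n, HasCompactSupport (χ n) := by
    intro n
    have h1 : HasCompactSupport fun s : ℝ => b ((N n)⁻¹ * s) :=
      b.hasCompactSupport.comp_homeomorph
        (Homeomorph.mulLeft₀ (N n)⁻¹ (inv_ne_zero (hN0 n).ne'))
    exact h1.comp_left (g := fun x : ℝ => (x : ℂ)) Complex.ofReal_zero
  have hχ1 : ∀ n s, ‖χ n s‖ ≤ 1 := by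
    intro n s
    simp only [hχ]
    rw [Complex.norm_real, Real.norm_of_nonneg b.nonneg]
    exact b.le_one
  set f : ℕ → ℝ → ℂ := fun n s => χ n s * (z - s)⁻¹ with hf
  have hfs : ∀ n, HasCompactSupport (f n) := fun n => (hχs n).mul_right
  have hfd : ∀ n s, HasDerivAt (f n) ((((N n)⁻¹ * deriv b ((N n)⁻¹ * s) : ℝ) : ℂ) * (z - s)⁻¹ +
      χ n s * ((z - s)⁻¹ * (z - s)⁻¹)) s := fun n s => (hχd n s).mul (hψ s)
  have hev : ∀ s : ℝ, ∀ᶠ n in atTop, f n =ᶠ[𝓝 s] fun s => (z - s)⁻¹ := by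
    intro s
    obtain ⟨m, hm⟩ := exists_nat_ge (|s| + 1)
    filter_upwards [eventually_ge_atTop m] with n hn
    have h1 : ∀ᶠ s' in 𝓝 s, |s'| < |s| + 1 :=
      (continuous_abs.tendsto s).eventually (gt_mem_nhds (by linarith))
    filter_upwards [h1] with s' hs'
    have hmn : (m : ℝ) ≤ n := by exact_mod_cast hn
    have h2 : b ((N n)⁻¹ * s') = 1 := by
      apply b.one_of_mem_closedBall
      rw [mem_closedBall_zero_iff, norm_mul, norm_inv, Real.norm_of_nonneg (hN0 n).le,
        Real.norm_eq_abs, inv_mul_le_iff₀ (hN0 n)]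
      show |s'| ≤ N n * 1
      simp only [hN]
      linarith
    simp only [hf, hχ]
    rw [h2]; simp
  refine ⟨fun n => (hfs n).toSchwartzMap ((hχc n).mul hψc),
    B₁ + z.im⁻¹ + (B₂ + (1 + ‖z‖ / z.im)), by positivity, hfs, fun n s => ?_, fun n s => ?_,
    fun n s => ?_, fun s => ?_, fun s => ?_⟩
  · show ‖f n s‖ ≤ _
    rw [hf]
    simp only [norm_mul]
    exact mul_le_of_le_one_left (norm_nonneg _) (hχ1 n s)
  · show ‖deriv (f n) s‖ ≤ _
    rw [(hfd n s).deriv]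
    refine (norm_add_le _ _).trans ?_
    rw [norm_mul, norm_mul, norm_mul, Complex.norm_real, norm_mul]
    have h1 : ‖(N n)⁻¹‖ ≤ 1 := by
      rw [norm_inv, Real.norm_of_nonneg (hN0 n).le]; exact inv_le_one_of_one_le₀ (hN1 n)
    have h2 : ‖(N n)⁻¹‖ * ‖deriv b ((N n)⁻¹ * s)‖ ≤ 1 * B₁ :=
      mul_le_mul h1 (hB₁ _) (norm_nonneg _) zero_le_one
    have h3 : ‖χ n s‖ * (‖(z - (s : ℂ))⁻¹‖ * ‖(z - (s : ℂ))⁻¹‖) ≤ z.im⁻¹ * ‖(z - (s : ℂ))⁻¹‖ := by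
      refine (mul_le_of_le_one_left (by positivity) (hχ1 n s)).trans ?_
      exact mul_le_mul_of_nonneg_right (norm_inv_sub_le hz s) (norm_nonneg _)
    have h4 := mul_le_mul_of_nonneg_right h2 (norm_nonneg (z - (s : ℂ))⁻¹)
    have h5 : 0 ≤ (B₂ + (1 + ‖z‖ / z.im)) * ‖(z - (s : ℂ))⁻¹‖ := by positivity
    linarith
  · show ‖(s : ℂ) * deriv (f n) s‖ ≤ _
    rw [(hfd n s).deriv, mul_add]
    refine (norm_add_le _ _).trans ?_
    have h1 : ‖(s : ℂ) * ((((N n)⁻¹ * deriv b ((N n)⁻¹ * s) : ℝ) : ℂ) * (z - s)⁻¹)‖ ≤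
        B₂ * ‖(z - (s : ℂ))⁻¹‖ := by
      rw [← mul_assoc, norm_mul]
      refine mul_le_mul_of_nonneg_right ?_ (norm_nonneg _)
      rw [← Complex.ofReal_mul, Complex.norm_real]
      have := hB₂ ((N n)⁻¹ * s)
      simp only [Pi.mul_apply, id] at this
      rwa [show s * ((N n)⁻¹ * deriv b ((N n)⁻¹ * s)) = (N n)⁻¹ * s * deriv b ((N n)⁻¹ * s) by ring]
    have h2 : ‖(s : ℂ) * (z - s)⁻¹‖ ≤ 1 + ‖z‖ / z.im := by
      have e : (s : ℂ) * (z - s)⁻¹ = z * (z - s)⁻¹ - 1 := by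
        have := sub_ofReal_ne_zero hz s
        field_simp
        ring
      rw [e]
      refine (norm_sub_le _ _).trans ?_
      rw [norm_mul, norm_one, add_comm]
      have := mul_le_mul_of_nonneg_left (norm_inv_sub_le hz s) (norm_nonneg z)
      rw [← div_eq_mul_inv] at this
      linarith
    have h3 : ‖(s : ℂ) * (χ n s * ((z - s)⁻¹ * (z - s)⁻¹))‖ ≤
        (1 + ‖z‖ / z.im) * ‖(z - (s : ℂ))⁻¹‖ := by
      rw [show (s : ℂ) * (χ n s * ((z - s)⁻¹ * (z - s)⁻¹)) =
        χ n s * (((s : ℂ) * (z - s)⁻¹) * (z - s)⁻¹) by ring, norm_mul, norm_mul _ (z - (s : ℂ))⁻¹]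
      refine (mul_le_of_le_one_left (by positivity) (hχ1 n s)).trans ?_
      exact mul_le_mul_of_nonneg_right h2 (norm_nonneg _)
    have h5 : 0 ≤ (B₁ + z.im⁻¹) * ‖(z - (s : ℂ))⁻¹‖ := by positivity
    linarith
  · refine tendsto_const_nhds.congr' ?_
    filter_upwards [hev s] with n hn
    exact hn.eq_of_nhds.symm
  · refine tendsto_const_nhds.congr' ?_
    filter_upwards [hev s] with n hn
    show _ = deriv (f n) s
    rw [hn.deriv_eq, (hψ s).deriv]

variable {ρ u : ℝ → ℝ} {C : NNReal} (hρ : Integrable ρ) (hC : eLpNorm ρ 2 volume ≤ C)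
  (hd : Differentiable ℝ ρ) (hu : IsHilbertTransform ρ u) {γ ν : ℝ} {ρt v : ℝ → ℝ}
  (hρt : Continuous ρt) (hv : IsFracLaplacian 1 ρ v)
  (heq : ∀ x : ℝ, DifferentiableAt ℝ (fun y => ρ y * (u y - γ * y)) x ∧
    ρt x + deriv (fun y => ρ y * (u y - γ * y)) x = -ν * v x)

include hρ hC hd hu hρt hv heq

/-- Integration by parts needs compact support of `η`: neither `∂ₜρ` nor the half-Laplacian of `ρ`
is assumed integrable. -/
theorem integral_time_deriv_mul (η : 𝓢(ℝ, ℂ)) (hη : HasCompactSupport η) :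
    ∫ x : ℝ, (ρt x : ℂ) * η x = (∫ x : ℝ, ((ρ x * (u x - γ * x) : ℝ) : ℂ) * deriv η x) +
      ν * ∫ x : ℝ, (u x : ℂ) * deriv η x := by
  set p : ℝ → ℂ := fun x => ((ρ x * (u x - γ * x) : ℝ) : ℂ) with hp
  set p' : ℝ → ℂ := fun x => ((-ν * v x - ρt x : ℝ) : ℂ) with hp'
  have hpd : ∀ x, HasDerivAt p (p' x) x := by
    intro x
    have h1 := (heq x).1.hasDerivAt.ofReal_comp
    have h2 : deriv (fun y => ρ y * (u y - γ * y)) x = -ν * v x - ρt x := by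
      linarith [(heq x).2]
    rw [h2] at h1
    exact h1
  have hpc : Continuous p := continuous_iff_continuousAt.mpr fun x => (hpd x).continuousAt
  have hp'c : Continuous p' := Complex.continuous_ofReal.comp
    ((continuous_const.mul hv.1).sub hρt)
  have hη'c : Continuous (deriv η) := (η.smooth 1).continuous_deriv le_rfl
  have hibp := integral_mul_deriv_eq_deriv_mul_of_integrable (u := p) (v := η) (u' := p')
    (v' := deriv η) (fun x _ => hpd x) (fun x _ => η.differentiable.differentiableAt.hasDerivAt)
    ((hpc.mul hη'c).integrable_of_hasCompactSupport hη.deriv.mul_left)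
    ((hp'c.mul η.continuous).integrable_of_hasCompactSupport hη.mul_left)
    ((hpc.mul η.continuous).integrable_of_hasCompactSupport hη.mul_left)
  have iv : Integrable fun x : ℝ => (v x : ℂ) * η x :=
    ((Complex.continuous_ofReal.comp hv.1).mul η.continuous).integrable_of_hasCompactSupport
      hη.mul_left
  have iρt : Integrable fun x : ℝ => (ρt x : ℂ) * η x :=
    ((Complex.continuous_ofReal.comp hρt).mul η.continuous).integrable_of_hasCompactSupport
      hη.mul_left
  have e : ∫ x, p' x * η x = -ν * (∫ x : ℝ, (v x : ℂ) * η x) - ∫ x : ℝ, (ρt x : ℂ) * η x := by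
    rw [← integral_const_mul, ← integral_sub (iv.const_mul _) iρt]
    congr 1; ext x
    simp only [hp']
    push_cast; ring
  rw [e, integral_fracLaplacian_mul hρ hC hd hu hv η] at hibp
  linear_combination -hibp

/-- As the cutoff is removed, the flux `uρ` is evaluated by Tricomi's identity differentiated in
`z`, the drift by `x/(z - x)² = z/(z - x)² - 1/(z - x)`, and the dissipation by
`integral_hilbert_mul_inv_sq`. The bound is independent of `n` and depends on `ρ` only through `C`,
which permits dominated convergence in time. -/
theorem time_deriv_cutoff (hγ : 0 ≤ γ) (hν : 0 ≤ ν) {z : ℂ} (hz : 0 < z.im) {η : ℕ → 𝓢(ℝ, ℂ)}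
    {K : ℝ} (hK : 0 ≤ K) (hηs : ∀ n, HasCompactSupport (η n))
    (hη₁ : ∀ n s, ‖deriv (η n) s‖ ≤ K * ‖(z - s)⁻¹‖)
    (hη₂ : ∀ n (s : ℝ), ‖(s : ℂ) * deriv (η n) s‖ ≤ K * ‖(z - s)⁻¹‖)
    (hη₃ : ∀ s : ℝ, Tendsto (fun n => deriv (η n) s) atTop (𝓝 ((z - s)⁻¹ * (z - s)⁻¹))) :
    Tendsto (fun n => ∫ x : ℝ, (ρt x : ℂ) * η n x) atTop
      (𝓝 (Real.pi * (γ * cauchyTransform ρ z -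
        (cauchyTransform ρ z - γ * z - Complex.I * ν) * cauchyDeriv ρ z))) ∧
    ∀ n, ‖∫ x : ℝ, (ρt x : ℂ) * η n x‖ ≤ K * z.im⁻¹ * (2 * C * C) +
      (γ * K * C + ν * K * (2 * C)) * √(∫ s : ℝ, ‖(z - s)⁻¹‖ ^ 2) := by
  have hρ2 : MemLp ρ 2 := ⟨hρ.1, hC.trans_lt ENNReal.coe_lt_top⟩
  obtain ⟨hum, huC⟩ := eLpNorm_hilbertTransform_le hρ hC hd hu
  have hu2 := memLp_hilbertTransform hρ hC hd hu
  have huρ : Integrable fun x => u x * ρ x := hu2.integrable_mul hρ2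
  have hψ2 := memLp_two_inv_sub hz
  have hη'c : ∀ n, Continuous (deriv (η n)) := fun n => ((η n).smooth 1).continuous_deriv le_rfl
  have hψb := norm_inv_sub_le hz
  obtain ⟨iρψ, bρψ⟩ := integral_norm_mul_norm_le hρ.1 hC hψ2
  obtain ⟨iuψ, buψ⟩ := integral_norm_mul_norm_le hum huC hψ2
  have bd1 : ∀ n x, ‖((u x * ρ x : ℝ) : ℂ) * deriv (η n) x‖ ≤ K * z.im⁻¹ * ‖u x * ρ x‖ := by
    intro n x
    rw [norm_mul, Complex.norm_real, mul_comm]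
    refine mul_le_mul_of_nonneg_right ((hη₁ n x).trans ?_) (norm_nonneg _)
    exact mul_le_mul_of_nonneg_left (hψb x) hK
  have bd2 : ∀ n (x : ℝ), ‖(ρ x : ℂ) * ((x : ℂ) * deriv (η n) x)‖ ≤
      K * (‖ρ x‖ * ‖(z - (x : ℂ))⁻¹‖) := by
    intro n x
    rw [norm_mul, Complex.norm_real]
    have := mul_le_mul_of_nonneg_left (hη₂ n x) (norm_nonneg (ρ x))
    linarith
  have bd3 : ∀ n (x : ℝ), ‖(u x : ℂ) * deriv (η n) x‖ ≤ K * (‖u x‖ * ‖(z - (x : ℂ))⁻¹‖) := by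
    intro n x
    rw [norm_mul, Complex.norm_real]
    have := mul_le_mul_of_nonneg_left (hη₁ n x) (norm_nonneg (u x))
    linarith
  have m1 : ∀ n, AEStronglyMeasurable (fun x : ℝ => ((u x * ρ x : ℝ) : ℂ) * deriv (η n) x) volume :=
    fun n => (integrable_ofReal_complex huρ).1.mul (hη'c n).aestronglyMeasurable
  have m2 : ∀ n, AEStronglyMeasurable (fun x : ℝ => (ρ x : ℂ) * ((x : ℂ) * deriv (η n) x)) volume :=
    fun n => (integrable_ofReal_complex hρ).1.mul
      (Complex.continuous_ofReal.mul (hη'c n)).aestronglyMeasurable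
  have m3 : ∀ n, AEStronglyMeasurable (fun x : ℝ => (u x : ℂ) * deriv (η n) x) volume :=
    fun n => (hu2.ofReal (K := ℂ)).1.mul (hη'c n).aestronglyMeasurable
  have d1 : Integrable fun x => K * z.im⁻¹ * ‖u x * ρ x‖ := huρ.norm.const_mul _
  have d2 : Integrable fun x : ℝ => K * (‖ρ x‖ * ‖(z - (x : ℂ))⁻¹‖) := iρψ.const_mul _
  have d3 : Integrable fun x : ℝ => K * (‖u x‖ * ‖(z - (x : ℂ))⁻¹‖) := iuψ.const_mul _
  have i1 := fun n => d1.mono' (m1 n) (ae_of_all _ (bd1 n))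
  have i2 := fun n => d2.mono' (m2 n) (ae_of_all _ (bd2 n))
  have hsplit : ∀ n, ∫ x : ℝ, (ρt x : ℂ) * η n x =
      (∫ x : ℝ, ((u x * ρ x : ℝ) : ℂ) * deriv (η n) x) -
      γ * (∫ x : ℝ, (ρ x : ℂ) * ((x : ℂ) * deriv (η n) x)) +
      ν * ∫ x : ℝ, (u x : ℂ) * deriv (η n) x := by
    intro n
    rw [integral_time_deriv_mul hρ hC hd hu hρt hv heq (η n) (hηs n),
      ← integral_const_mul (γ : ℂ), ← integral_sub (i1 n) ((i2 n).const_mul _)]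
    congr 2; ext x
    push_cast; ring
  have l1 : Tendsto (fun n => ∫ x : ℝ, ((u x * ρ x : ℝ) : ℂ) * deriv (η n) x) atTop
      (𝓝 (∫ x : ℝ, ((u x * ρ x : ℝ) : ℂ) * ((z - x)⁻¹ * (z - x)⁻¹))) :=
    tendsto_integral_of_dominated_convergence _ m1 d1 (fun n => ae_of_all _ (bd1 n))
      (ae_of_all _ fun x => (hη₃ x).const_mul _)
  have l2 : Tendsto (fun n => ∫ x : ℝ, (ρ x : ℂ) * ((x : ℂ) * deriv (η n) x)) atTop
      (𝓝 (∫ x : ℝ, (ρ x : ℂ) * ((x : ℂ) * ((z - x)⁻¹ * (z - x)⁻¹)))) :=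
    tendsto_integral_of_dominated_convergence _ m2 d2 (fun n => ae_of_all _ (bd2 n))
      (ae_of_all _ fun x => ((hη₃ x).const_mul _).const_mul _)
  have l3 : Tendsto (fun n => ∫ x : ℝ, (u x : ℂ) * deriv (η n) x) atTop
      (𝓝 (∫ x : ℝ, (u x : ℂ) * ((z - x)⁻¹ * (z - x)⁻¹))) :=
    tendsto_integral_of_dominated_convergence _ m3 d3 (fun n => ae_of_all _ (bd3 n))
      (ae_of_all _ fun x => (hη₃ x).const_mul _)
  have hpi : (Real.pi : ℂ) ≠ 0 := by exact_mod_cast Real.pi_pos.ne'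
  have v1 : ∫ x : ℝ, ((u x * ρ x : ℝ) : ℂ) * ((z - x)⁻¹ * (z - x)⁻¹) =
      -(Real.pi * (cauchyTransform ρ z * cauchyDeriv ρ z)) := by
    have h1 := hasDerivAt_cauchyTransform huρ hz
    have h2 : HasDerivAt (cauchyTransform fun x => u x * ρ x)
        (cauchyTransform ρ z * cauchyDeriv ρ z) z := by
      have h3 := ((hasDerivAt_cauchyTransform hρ hz).pow 2).div_const 2
      refine (h3.congr_of_eventuallyEq ?_).congr_deriv (by simp; ring)
      filter_upwards [isOpen_upperHalf.mem_nhds (show z ∈ upperHalf from hz)] with w hw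
      exact cauchyTransform_hilbert_mul hρ hC hd hu hw
    have h4 := h1.unique h2
    rw [cauchyDeriv] at h4
    rw [← h4]
    field_simp
  have v2 : ∫ x : ℝ, (ρ x : ℂ) * ((x : ℂ) * ((z - x)⁻¹ * (z - x)⁻¹)) =
      -(Real.pi * (z * cauchyDeriv ρ z + cauchyTransform ρ z)) := by
    have e : ∀ x : ℝ, (ρ x : ℂ) * ((x : ℂ) * ((z - x)⁻¹ * (z - x)⁻¹)) =
        z * ((ρ x : ℂ) * ((z - x)⁻¹ * (z - x)⁻¹)) - (ρ x : ℂ) / (z - x) := by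
      intro x
      have := sub_ofReal_ne_zero hz x
      field_simp
      ring
    simp_rw [e]
    rw [integral_sub ((integrable_mul_inv_mul_inv hρ hz hz).const_mul z) (integrable_cauchy hρ hz),
      integral_const_mul, cauchyDeriv, cauchyTransform]
    generalize ∫ x : ℝ, (ρ x : ℂ) * ((z - x)⁻¹ * (z - x)⁻¹) = A
    generalize ∫ x : ℝ, (ρ x : ℂ) / (z - x) = B
    field_simp
    ring
  have v3 := integral_hilbert_mul_inv_sq hρ hC hd hu hz
  constructor
  · simp_rw [hsplit]
    have := (l1.sub (l2.const_mul (γ : ℂ))).add (l3.const_mul (ν : ℂ))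
    rw [v1, v2, v3] at this
    convert this using 2
    ring
  · intro n
    rw [hsplit n]
    have b1 : ‖∫ x : ℝ, ((u x * ρ x : ℝ) : ℂ) * deriv (η n) x‖ ≤ K * z.im⁻¹ * (2 * C * C) := by
      refine (norm_integral_le_of_norm_le d1 (ae_of_all _ (bd1 n))).trans ?_
      rw [integral_const_mul]
      refine mul_le_mul_of_nonneg_left ?_ (by positivity)
      have h1 := (integral_norm_mul_norm_le hum huC (hρ2.ofReal (K := ℂ))).2
      have h2 : √(∫ x : ℝ, ‖(ρ x : ℂ)‖ ^ 2) ≤ C := by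
        rw [Real.sqrt_le_left C.coe_nonneg]
        have := (integral_norm_sq_le_of_eLpNorm_le hρ.1 hC).2
        simpa using this
      have h3 : ∫ x, ‖u x * ρ x‖ = ∫ x, ‖u x‖ * ‖(ρ x : ℂ)‖ := by simp
      rw [h3]
      refine h1.trans ?_
      push_cast
      exact mul_le_mul_of_nonneg_left h2 (by positivity)
    have b2 : ‖∫ x : ℝ, (ρ x : ℂ) * ((x : ℂ) * deriv (η n) x)‖ ≤
        K * (C * √(∫ s : ℝ, ‖(z - s)⁻¹‖ ^ 2)) := by
      refine (norm_integral_le_of_norm_le d2 (ae_of_all _ (bd2 n))).trans ?_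
      rw [integral_const_mul]
      exact mul_le_mul_of_nonneg_left bρψ hK
    have b3 : ‖∫ x : ℝ, (u x : ℂ) * deriv (η n) x‖ ≤
        K * (2 * C * √(∫ s : ℝ, ‖(z - s)⁻¹‖ ^ 2)) := by
      refine (norm_integral_le_of_norm_le d3 (ae_of_all _ (bd3 n))).trans ?_
      rw [integral_const_mul]
      push_cast at buψ
      exact mul_le_mul_of_nonneg_left buψ hK
    refine (norm_add_le _ _).trans ?_
    refine (add_le_add_left (norm_sub_le _ _) _).trans ?_
    rw [norm_mul, norm_mul, Complex.norm_real, Complex.norm_real, Real.norm_of_nonneg hγ,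
      Real.norm_of_nonneg hν]
    have := mul_le_mul_of_nonneg_left b2 hγ
    have := mul_le_mul_of_nonneg_left b3 hν
    linarith

end WeakForm

/-! ### Differentiation in time under the integral -/

section Evolution

variable {ρ : ℝ → ℝ → ℝ} {U : Set ℝ}

theorem hasDerivAt_fst_of_contDiffOn (hU : IsOpen U)
    (hρ : ContDiffOn ℝ 1 (fun p : ℝ × ℝ => ρ p.1 p.2) {p | p.1 ∈ U}) {t : ℝ} (ht : t ∈ U) (x : ℝ) :
    HasDerivAt (fun τ => ρ τ x) (fderiv ℝ (fun p : ℝ × ℝ => ρ p.1 p.2) (t, x) (1, 0)) t := by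
  have hV : IsOpen {p : ℝ × ℝ | p.1 ∈ U} := hU.preimage continuous_fst
  have h1 := ((hρ.contDiffAt (hV.mem_nhds (show (t, x) ∈ {p : ℝ × ℝ | p.1 ∈ U} from ht))
    ).differentiableAt one_ne_zero).hasFDerivAt
  have h2 : HasDerivAt (fun τ : ℝ => (τ, x)) (1, 0) t :=
    (hasDerivAt_id t).prodMk (hasDerivAt_const t x)
  exact h1.comp_hasDerivAt t h2

theorem continuousOn_deriv_fst (hU : IsOpen U)
    (hρ : ContDiffOn ℝ 1 (fun p : ℝ × ℝ => ρ p.1 p.2) {p | p.1 ∈ U}) :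
    ContinuousOn (fun p : ℝ × ℝ => deriv (fun τ => ρ τ p.2) p.1) {p | p.1 ∈ U} := by
  have hV : IsOpen {p : ℝ × ℝ | p.1 ∈ U} := hU.preimage continuous_fst
  have h1 := hρ.continuousOn_fderiv_of_isOpen hV le_rfl
  refine (h1.clm_apply (continuousOn_const (c := ((1, 0) : ℝ × ℝ)))).congr fun p hp => ?_
  exact (hasDerivAt_fst_of_contDiffOn hU hρ hp p.2).deriv

theorem hasDerivAt_integral_mul (hU : IsOpen U)
    (hρ : ContDiffOn ℝ 1 (fun p : ℝ × ℝ => ρ p.1 p.2) {p | p.1 ∈ U}) {η : ℝ → ℂ}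
    (hη : Continuous η) (hηc : HasCompactSupport η) {t : ℝ} (ht : t ∈ U) :
    HasDerivAt (fun τ => ∫ x, (ρ τ x : ℂ) * η x)
      (∫ x, ((deriv (fun τ => ρ τ x) t : ℝ) : ℂ) * η x) t := by
  obtain ⟨ε, hε, hball⟩ := Metric.isOpen_iff.mp hU t ht
  have hsub : Metric.closedBall t (ε / 2) ⊆ U :=
    (Metric.closedBall_subset_ball (by linarith)).trans hball
  have hcD := continuousOn_deriv_fst hU hρ
  have hcont : ∀ τ ∈ U, Continuous (ρ τ) := fun τ hτ => by
    have := hρ.continuousOn.comp (f := fun x : ℝ => (τ, x)) (s := Set.univ)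
      (by fun_prop) (fun x _ => hτ)
    exact continuousOn_univ.mp this
  have hcontD : ∀ τ ∈ U, Continuous fun x => deriv (fun τ => ρ τ x) τ := fun τ hτ => by
    have := hcD.comp (f := fun x : ℝ => (τ, x)) (s := Set.univ)
      (by fun_prop) (fun x _ => hτ)
    exact continuousOn_univ.mp this
  obtain ⟨B, hB⟩ := ((isCompact_closedBall t (ε / 2)).prod hηc.isCompact).exists_bound_of_continuousOn
    (hcD.mono fun p hp => hsub hp.1)
  have hnhds : Metric.ball t (ε / 2) ∈ 𝓝 t := Metric.ball_mem_nhds _ (by positivity)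
  refine (hasDerivAt_integral_of_dominated_loc_of_deriv_le (F := fun τ x => (ρ τ x : ℂ) * η x)
    (F' := fun τ x => ((deriv (fun τ => ρ τ x) τ : ℝ) : ℂ) * η x) (bound := fun x => B * ‖η x‖)
    hnhds ?_ ?_ ?_ ?_ ?_ ?_).2
  · filter_upwards [hU.mem_nhds ht] with τ hτ
    exact ((Complex.continuous_ofReal.comp (hcont τ hτ)).mul hη).aestronglyMeasurable
  · exact ((Complex.continuous_ofReal.comp (hcont t ht)).mul hη).integrable_of_hasCompactSupport
      hηc.mul_left
  · exact ((Complex.continuous_ofReal.comp (hcontD t ht)).mul hη).aestronglyMeasurable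
  · refine ae_of_all _ fun x τ hτ => ?_
    by_cases hx : x ∈ tsupport η
    · rw [norm_mul, Complex.norm_real]
      exact mul_le_mul_of_nonneg_right
        (hB (τ, x) ⟨Metric.ball_subset_closedBall hτ, hx⟩) (norm_nonneg _)
    · rw [image_eq_zero_of_notMem_tsupport hx]; simp
  · exact (hη.norm.integrable_of_hasCompactSupport hηc.norm).const_mul B
  · refine ae_of_all _ fun x τ hτ => ?_
    have h1 := hasDerivAt_fst_of_contDiffOn hU hρ (hsub (Metric.ball_subset_closedBall hτ)) x
    have h2 := h1.differentiableAt.hasDerivAt.ofReal_comp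
    exact h2.mul_const (η x)

end Evolution

/-- `1/(z - x)` and its square belong to `L²`, so bounded almost everywhere convergence, which is
weak `L²` convergence, suffices; no `L¹` bound is needed. -/
theorem tendsto_cauchyTransform_of_ae_tendsto {ι : Type*} {l : Filter ι} [l.IsCountablyGenerated]
    [l.NeBot] {σ : ι → ℝ → ℝ} {σ₀ : ℝ → ℝ} {C : NNReal}
    (hσ : ∀ᶠ i in l, AEStronglyMeasurable (σ i) volume ∧ eLpNorm (σ i) 2 volume ≤ C)
    (hlim : ∀ᵐ x, Tendsto (fun i => σ i x) l (𝓝 (σ₀ x))) {z : ℂ} (hz : 0 < z.im) :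
    Tendsto (fun i => cauchyTransform (σ i) z) l (𝓝 (cauchyTransform σ₀ z)) ∧
    Tendsto (fun i => cauchyDeriv (σ i) z) l (𝓝 (cauchyDeriv σ₀ z)) := by
  have hσ' : ∀ᶠ i in l, AEStronglyMeasurable (fun x => (σ i x : ℂ)) volume ∧
      eLpNorm (fun x => (σ i x : ℂ)) 2 volume ≤ C := by
    filter_upwards [hσ] with i hi
    refine ⟨Complex.continuous_ofReal.comp_aestronglyMeasurable hi.1, le_trans (le_of_eq ?_) hi.2⟩
    exact eLpNorm_congr_norm_ae (ae_of_all _ fun x => Complex.norm_real _)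
  have hlim' : ∀ᵐ x, Tendsto (fun i => (σ i x : ℂ)) l (𝓝 (σ₀ x : ℂ)) := by
    filter_upwards [hlim] with x hx using (Complex.continuous_ofReal.tendsto _).comp hx
  have hψ2 := memLp_two_inv_sub hz
  have hψψ : MemLp (fun x : ℝ => (z - x)⁻¹ * (z - x)⁻¹) 2 := by
    refine MemLp.of_le_mul (c := z.im⁻¹) hψ2
      ((continuous_inv_sub hz).mul (continuous_inv_sub hz)).aestronglyMeasurable
      (ae_of_all _ fun x => ?_)
    rw [norm_mul]
    exact mul_le_mul_of_nonneg_right (norm_inv_sub_le hz x) (norm_nonneg _)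
  constructor
  · have := (tendsto_integral_mul_of_ae_tendsto hσ' hlim' hψ2).const_mul (1 / (Real.pi : ℂ))
    simpa only [cauchyTransform, div_eq_mul_inv] using this
  · exact ((tendsto_integral_mul_of_ae_tendsto hσ' hlim' hψψ).const_mul (1 / (Real.pi : ℂ))).neg

/-! ### Uniqueness of the spatially analytic solution -/

section Uniqueness

variable {γ ν : ℝ} {T : EReal} {ρ₀ : ℝ → ℝ} {ρ : ℝ → ℝ → ℝ}

theorem IsAnalyticSolution.continuous (h : IsAnalyticSolution 1 γ ν T ρ₀ ρ) {t : ℝ}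
    (ht : t ∈ times T) : Continuous (ρ t) :=
  continuous_iff_continuousAt.mpr fun x => (h.analytic t ht x trivial).continuousAt

theorem IsAnalyticSolution.continuousAt_fst (h : IsAnalyticSolution 1 γ ν T ρ₀ ρ) {t : ℝ}
    (ht : t ∈ times T) (x : ℝ) : ContinuousAt (fun τ => ρ τ x) t :=
  (hasDerivAt_fst_of_contDiffOn (isOpen_times T) h.contDiff ht x).continuousAt

/-- The right-hand side of the equation of the Cauchy transform. -/
noncomputable def cauchyFlux (γ ν : ℝ) (σ : ℝ → ℝ) (z : ℂ) : ℂ :=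
  γ * cauchyTransform σ z - (cauchyTransform σ z - γ * z - Complex.I * ν) * cauchyDeriv σ z

/-- The cutoff is removed in the time-integrated identity, where pointwise convergence and the
uniform bound of `time_deriv_cutoff` are enough. Continuity of the flux afterwards gives the
derivative itself. -/
theorem IsAnalyticSolution.cauchyTransform_sub_eq (h : IsAnalyticSolution 1 γ ν T ρ₀ ρ)
    (hγ : 0 ≤ γ) (hν : 0 ≤ ν) {t₁ t₂ : ℝ} (ht₁ : 0 < t₁) (ht : t₁ ≤ t₂) (ht₂ : t₂ ∈ times T)
    {z : ℂ} (hz : 0 < z.im) :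
    cauchyTransform (ρ t₂) z - cauchyTransform (ρ t₁) z =
      ∫ τ in t₁..t₂, cauchyFlux γ ν (ρ τ) z := by
  obtain ⟨C, hC⟩ := h.locally_bounded t₂ ht₂
  obtain ⟨η, K, hK, hηs, hη₀, hη₁, hη₂, hη₄, hη₃⟩ := exists_cutoff hz
  have hmem : ∀ τ ∈ Set.uIcc t₁ t₂, τ ∈ times T := by
    intro τ hτ
    rw [Set.uIcc_of_le ht] at hτ
    exact mem_times_of_le ht₂ (ht₁.trans_le hτ.1) hτ.2
  set J : ℕ → ℝ → ℂ := fun n τ => ∫ x, ((deriv (fun τ => ρ τ x) τ : ℝ) : ℂ) * η n x with hJ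
  set I : ℕ → ℝ → ℂ := fun n τ => ∫ x, (ρ τ x : ℂ) * η n x with hI
  have hder : ∀ n, ∀ τ ∈ Set.uIcc t₁ t₂, HasDerivAt (I n) (J n τ) τ := fun n τ hτ =>
    hasDerivAt_integral_mul (isOpen_times T) h.contDiff (η n).continuous (hηs n) (hmem τ hτ)
  set B : ℝ := K * z.im⁻¹ * (2 * C * C) +
      (γ * K * C + ν * K * (2 * C)) * √(∫ s : ℝ, ‖(z - s)⁻¹‖ ^ 2) with hB
  have hcut : ∀ τ ∈ Set.uIcc t₁ t₂,
      Tendsto (fun n => J n τ) atTop (𝓝 (Real.pi * cauchyFlux γ ν (ρ τ) z)) ∧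
      ∀ n, ‖J n τ‖ ≤ B := by
    intro τ hτ
    have hτm := hmem τ hτ
    have hτle : τ ≤ t₂ := by rw [Set.uIcc_of_le ht] at hτ; exact hτ.2
    obtain ⟨u, v, hu, hv, heq⟩ := h.equation τ hτm
    have hρtc : Continuous fun x => deriv (fun τ => ρ τ x) τ := by
      have := (continuousOn_deriv_fst (isOpen_times T) h.contDiff).comp
        (f := fun x : ℝ => (τ, x)) (s := Set.univ) (by fun_prop) (fun x _ => hτm)
      exact continuousOn_univ.mp this
    exact time_deriv_cutoff (h.integrable τ hτm) (hC τ hτm.1 hτle)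
      (fun x => (h.analytic τ hτm x trivial).differentiableAt) hu hρtc hv heq hγ hν hz hK hηs
      hη₁ hη₂ hη₃
  have hmeas : ∀ n, AEStronglyMeasurable (J n) (volume.restrict (Set.uIoc t₁ t₂)) := by
    intro n
    refine (aestronglyMeasurable_deriv (I n) _).congr ?_
    rw [EventuallyEq, ae_restrict_iff' measurableSet_uIoc]
    exact ae_of_all _ fun τ hτ => (hder n τ (Set.uIoc_subset_uIcc hτ)).deriv
  have hbnd : ∀ n, ∀ᵐ τ, τ ∈ Set.uIoc t₁ t₂ → ‖J n τ‖ ≤ B := fun n =>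
    ae_of_all _ fun τ hτ => (hcut τ (Set.uIoc_subset_uIcc hτ)).2 n
  have hint : ∀ n, IntervalIntegrable (J n) volume t₁ t₂ := by
    intro n
    refine (intervalIntegrable_const (c := B)).mono_fun' (hmeas n) ?_
    rw [EventuallyLE, ae_restrict_iff' measurableSet_uIoc]
    exact hbnd n
  have hftc : ∀ n, ∫ τ in t₁..t₂, J n τ = I n t₂ - I n t₁ := fun n =>
    intervalIntegral.integral_eq_sub_of_hasDerivAt (hder n) (hint n)
  have hlim1 : Tendsto (fun n => ∫ τ in t₁..t₂, J n τ) atTop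
      (𝓝 (∫ τ in t₁..t₂, Real.pi * cauchyFlux γ ν (ρ τ) z)) :=
    intervalIntegral.tendsto_integral_filter_of_dominated_convergence (fun _ => B)
      (Eventually.of_forall hmeas) (Eventually.of_forall hbnd) intervalIntegrable_const
      (ae_of_all _ fun τ hτ => (hcut τ (Set.uIoc_subset_uIcc hτ)).1)
  have hlim2 : ∀ τ ∈ times T, Tendsto (fun n => I n τ) atTop
      (𝓝 (Real.pi * cauchyTransform (ρ τ) z)) := by
    intro τ hτ
    have hpi : (Real.pi : ℂ) ≠ 0 := by exact_mod_cast Real.pi_pos.ne'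
    have e : (Real.pi : ℂ) * cauchyTransform (ρ τ) z = ∫ x : ℝ, (ρ τ x : ℂ) * (z - x)⁻¹ := by
      rw [cauchyTransform, ← mul_assoc, mul_one_div_cancel hpi, one_mul]
      simp_rw [div_eq_mul_inv]
    rw [e]
    have hi := integrable_mul_bounded (h.integrable τ hτ) (continuous_inv_sub hz)
      (norm_inv_sub_le hz)
    refine tendsto_integral_of_dominated_convergence (fun x => ‖(ρ τ x : ℂ) * (z - x)⁻¹‖)
      (fun n => ?_) hi.norm (fun n => ae_of_all _ fun x => ?_)
      (ae_of_all _ fun x => (hη₄ x).const_mul _)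
    · exact ((Complex.continuous_ofReal.comp (h.continuous hτ)).mul
        (η n).continuous).aestronglyMeasurable
    · rw [norm_mul, norm_mul]
      exact mul_le_mul_of_nonneg_left (hη₀ n x) (norm_nonneg _)
  have hlim3 := (hlim2 t₂ ht₂).sub (hlim2 t₁ (mem_times_of_le ht₂ ht₁ ht))
  simp_rw [hftc] at hlim1
  have := tendsto_nhds_unique hlim3 hlim1
  rw [intervalIntegral.integral_const_mul, ← mul_sub] at this
  have hpi : (Real.pi : ℂ) ≠ 0 := by exact_mod_cast Real.pi_pos.ne'
  exact mul_left_cancel₀ hpi this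

theorem exists_mem_times_gt {t : ℝ} (ht : 0 ≤ t) (htT : (t : EReal) < T) :
    ∃ t₁ ∈ times T, t < t₁ := by
  obtain ⟨t₁, h1, h2⟩ := EReal.lt_iff_exists_real_btwn.mp htT
  have h3 : t < t₁ := by exact_mod_cast h1
  exact ⟨t₁, ⟨ht.trans_lt h3, h2⟩, h3⟩

theorem IsAnalyticSolution.eventually_bounded (h : IsAnalyticSolution 1 γ ν T ρ₀ ρ) {t : ℝ}
    (ht : t ∈ times T) : ∃ C : NNReal, ∀ᶠ τ in 𝓝 t,
      AEStronglyMeasurable (ρ τ) volume ∧ eLpNorm (ρ τ) 2 volume ≤ C := by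
  obtain ⟨t₁, ht₁, hlt⟩ := exists_mem_times_gt ht.1.le ht.2
  obtain ⟨C, hC⟩ := h.locally_bounded t₁ ht₁
  refine ⟨C, ?_⟩
  filter_upwards [Ioo_mem_nhds ht.1 hlt] with τ hτ
  exact ⟨(h.integrable τ (mem_times_of_le ht₁ hτ.1 hτ.2.le)).1, hC τ hτ.1 hτ.2.le⟩

theorem IsAnalyticSolution.continuousAt_cauchyFlux (h : IsAnalyticSolution 1 γ ν T ρ₀ ρ) {t : ℝ}
    (ht : t ∈ times T) {z : ℂ} (hz : 0 < z.im) :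
    ContinuousAt (fun τ => cauchyFlux γ ν (ρ τ) z) t := by
  obtain ⟨C, hC⟩ := h.eventually_bounded ht
  obtain ⟨h1, h2⟩ := tendsto_cauchyTransform_of_ae_tendsto hC
    (ae_of_all _ fun x => (h.continuousAt_fst ht x).tendsto) hz
  exact (h1.const_mul _).sub (((h1.sub_const _).sub_const _).mul h2)

theorem IsAnalyticSolution.hasDerivAt_cauchyTransform (h : IsAnalyticSolution 1 γ ν T ρ₀ ρ)
    (hγ : 0 ≤ γ) (hν : 0 ≤ ν) {t : ℝ} (ht : t ∈ times T) {z : ℂ} (hz : 0 < z.im) :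
    HasDerivAt (fun τ => cauchyTransform (ρ τ) z) (cauchyFlux γ ν (ρ t) z) t := by
  obtain ⟨t₂, ht₂, hlt⟩ := exists_mem_times_gt ht.1.le ht.2
  set t₁ := t / 2 with ht₁
  have ht₁0 : 0 < t₁ := half_pos ht.1
  have ht₁t : t₁ < t := half_lt_self ht.1
  have hcont : ContinuousOn (fun τ => cauchyFlux γ ν (ρ τ) z) (times T) := fun τ hτ =>
    (h.continuousAt_cauchyFlux hτ hz).continuousWithinAt
  have hsub : Set.uIcc t₁ t ⊆ times T := by
    intro τ hτ
    rw [Set.uIcc_of_le ht₁t.le] at hτ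
    exact mem_times_of_le ht (ht₁0.trans_le hτ.1) hτ.2
  have hd := intervalIntegral.integral_hasDerivAt_right
    ((hcont.mono hsub).intervalIntegrable)
    (hcont.stronglyMeasurableAtFilter (isOpen_times T) t ht) (h.continuousAt_cauchyFlux ht hz)
  refine (hd.const_add (cauchyTransform (ρ t₁) z)).congr_of_eventuallyEq ?_
  filter_upwards [Ioo_mem_nhds ht₁t hlt] with τ hτ
  rw [← h.cauchyTransform_sub_eq hγ hν ht₁0 hτ.1.le
    (mem_times_of_le ht₂ (ht₁0.trans hτ.1) hτ.2.le) hz]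
  ring

/-- The solution, extended by its initial datum. -/
noncomputable def extendZero (ρ₀ : ℝ → ℝ) (ρ : ℝ → ℝ → ℝ) (t : ℝ) : ℝ → ℝ :=
  if t = 0 then ρ₀ else ρ t

theorem extendZero_of_pos {t : ℝ} (ht : 0 < t) : extendZero ρ₀ ρ t = ρ t := if_neg ht.ne'

/-- At time zero only almost everywhere convergence to `ρ₀` is given. The `L²` bound near zero
passes to `ρ₀` by Fatou and upgrades this to weak convergence; that is the role of
`locally_bounded`. -/
theorem IsAnalyticSolution.continuousWithinAt_cauchyTransform
    (h : IsAnalyticSolution 1 γ ν T ρ₀ ρ) (hρ₀ : Integrable ρ₀) {t : ℝ} (ht : 0 ≤ t)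
    (htT : (t : EReal) < T) :
    (∃ C : NNReal, ∀ᶠ τ in 𝓝[Set.Ici 0] t, Integrable (extendZero ρ₀ ρ τ) ∧
      eLpNorm (extendZero ρ₀ ρ τ) 2 volume ≤ C) ∧
    ∀ z : ℂ, 0 < z.im →
      ContinuousWithinAt (fun τ => cauchyTransform (extendZero ρ₀ ρ τ) z) (Set.Ici 0) t := by
  obtain ⟨t₁, ht₁, hlt⟩ := exists_mem_times_gt ht htT
  obtain ⟨C, hC⟩ := h.locally_bounded t₁ ht₁
  have hlt' : ∀ᶠ τ in 𝓝[Set.Ici 0] t, τ < t₁ :=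
    mem_nhdsWithin_of_mem_nhds (Iio_mem_nhds hlt)
  have hρ₀C : eLpNorm ρ₀ 2 volume ≤ C := by
    refine (eLpNorm_le_of_ae_tendsto_of_eventually (l := 𝓝[>] (0 : ℝ)) (f := ρ) ?_ h.initial).2
    filter_upwards [Ioo_mem_nhdsGT ht₁.1] with τ hτ
    exact ⟨(h.integrable τ (mem_times_of_le ht₁ hτ.1 hτ.2.le)).1, hC τ hτ.1 hτ.2.le⟩
  have hbd : ∀ᶠ τ in 𝓝[Set.Ici 0] t, Integrable (extendZero ρ₀ ρ τ) ∧
      eLpNorm (extendZero ρ₀ ρ τ) 2 volume ≤ C := by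
    filter_upwards [hlt', self_mem_nhdsWithin] with τ h1 h2
    rcases (show 0 ≤ τ from h2).eq_or_lt with rfl | hτ
    · rw [extendZero, if_pos rfl]; exact ⟨hρ₀, hρ₀C⟩
    · rw [extendZero_of_pos hτ]
      exact ⟨h.integrable τ (mem_times_of_le ht₁ hτ h1.le), hC τ hτ h1.le⟩
  refine ⟨⟨C, hbd⟩, fun z hz => ?_⟩
  have hlim : ∀ᵐ x, Tendsto (fun τ => extendZero ρ₀ ρ τ x) (𝓝[Set.Ici 0] t)
      (𝓝 (extendZero ρ₀ ρ t x)) := by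
    rcases ht.eq_or_lt with rfl | ht0
    · filter_upwards [h.initial] with x hx
      have h1 : ContinuousWithinAt (fun τ => extendZero ρ₀ ρ τ x) (Set.Ioi 0) 0 := by
        rw [ContinuousWithinAt, extendZero, if_pos rfl]
        refine hx.congr' ?_
        filter_upwards [self_mem_nhdsWithin] with τ hτ
        rw [extendZero_of_pos hτ]
      exact continuousWithinAt_Ioi_iff_Ici.mp h1
    · refine ae_of_all _ fun x => ?_
      have h1 := (h.continuousAt_fst ⟨ht0, htT⟩ x).tendsto
      rw [extendZero_of_pos ht0]
      refine (h1.mono_left nhdsWithin_le_nhds).congr' ?_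
      filter_upwards [mem_nhdsWithin_of_mem_nhds (Ioi_mem_nhds ht0)] with τ hτ
      rw [extendZero_of_pos hτ]
  have : (𝓝[Set.Ici 0] t).NeBot := mem_closure_iff_nhdsWithin_neBot.mp (subset_closure ht)
  exact (tendsto_cauchyTransform_of_ae_tendsto
    (hbd.mono fun τ hτ => ⟨hτ.1.1, hτ.2⟩) hlim hz).1

/-- Continuity in time at fixed `z`, together with a Lipschitz bound in `z` that is locally uniform
in time by Cauchy-Schwarz, gives joint continuity. -/
theorem IsAnalyticSolution.continuousOn_cauchyTransform
    (h : IsAnalyticSolution 1 γ ν T ρ₀ ρ) (hρ₀ : Integrable ρ₀) :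
    ContinuousOn (fun p : ℝ × ℂ => cauchyTransform (extendZero ρ₀ ρ p.1) p.2)
      {p | 0 ≤ p.1 ∧ (p.1 : EReal) < T ∧ p.2 ∈ upperHalf} := by
  rintro ⟨t, z⟩ ⟨ht, htT, hz⟩
  have hz0 : 0 < z.im := hz
  obtain ⟨⟨C, hC⟩, hcont⟩ := h.continuousWithinAt_cauchyTransform hρ₀ ht htT
  set S : Set (ℝ × ℂ) := {p | 0 ≤ p.1 ∧ (p.1 : EReal) < T ∧ p.2 ∈ upperHalf}
  have hfst : Tendsto (fun p : ℝ × ℂ => p.1) (𝓝[S] (t, z)) (𝓝[Set.Ici 0] t) :=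
    tendsto_nhdsWithin_iff.mpr ⟨(continuous_fst.tendsto (t, z)).mono_left nhdsWithin_le_nhds,
      eventually_mem_nhdsWithin.mono fun p hp => hp.1⟩
  have hsnd : Tendsto (fun p : ℝ × ℂ => p.2) (𝓝[S] (t, z)) (𝓝 z) :=
    (continuous_snd.tendsto (t, z)).mono_left nhdsWithin_le_nhds
  have h1 : Tendsto (fun p : ℝ × ℂ => cauchyTransform (extendZero ρ₀ ρ p.1) z) (𝓝[S] (t, z))
      (𝓝 (cauchyTransform (extendZero ρ₀ ρ t) z)) := (hcont z hz0).tendsto.comp hfst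
  set N := √(∫ s : ℝ, ‖(z - s)⁻¹‖ ^ 2) with hN
  have h2 : Tendsto (fun p : ℝ × ℂ => cauchyTransform (extendZero ρ₀ ρ p.1) p.2 -
      cauchyTransform (extendZero ρ₀ ρ p.1) z) (𝓝[S] (t, z)) (𝓝 0) := by
    have h3 : Tendsto (fun p : ℝ × ℂ => ‖p.2 - z‖ * (1 / Real.pi * ((z.im / 2)⁻¹ * (C * N))))
        (𝓝[S] (t, z)) (𝓝 0) := by
      have := ((hsnd.sub_const z).norm).mul_const (1 / Real.pi * ((z.im / 2)⁻¹ * (C * N)))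
      simpa using this
    refine squeeze_zero_norm' ?_ h3
    have him : ∀ᶠ w : ℂ in 𝓝 z, z.im / 2 < w.im :=
      (Complex.continuous_im.tendsto z).eventually (lt_mem_nhds (half_lt_self hz0))
    filter_upwards [hfst.eventually hC, hsnd.eventually him] with p hp hw
    have hw0 : 0 < p.2.im := (half_pos hz0).trans hw
    rw [cauchyTransform_sub hp.1 hw0 hz0, norm_mul, norm_neg, norm_mul]
    refine mul_le_mul_of_nonneg_left ?_ (norm_nonneg _)
    have hpi : ‖(1 / (Real.pi : ℂ))‖ = 1 / Real.pi := by
      rw [norm_div, norm_one, Complex.norm_real, Real.norm_of_nonneg Real.pi_pos.le]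
    rw [hpi]
    refine mul_le_mul_of_nonneg_left ?_ (by positivity)
    obtain ⟨i1, b1⟩ := integral_norm_mul_norm_le hp.1.1 hp.2 (memLp_two_inv_sub hz0)
    refine (norm_integral_le_of_norm_le (i1.const_mul (z.im / 2)⁻¹) (ae_of_all _ fun s => ?_)).trans
      ?_
    · rw [norm_mul, norm_mul, Complex.norm_real]
      have h4 : ‖(p.2 - (s : ℂ))⁻¹‖ ≤ (z.im / 2)⁻¹ :=
        (norm_inv_sub_le hw0 s).trans (inv_anti₀ (half_pos hz0) hw.le)
      calc _ = ‖(p.2 - (s : ℂ))⁻¹‖ * (‖extendZero ρ₀ ρ p.1 s‖ * ‖(z - (s : ℂ))⁻¹‖) := by ring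
        _ ≤ _ := mul_le_mul_of_nonneg_right h4 (by positivity)
    · rw [integral_const_mul]
      exact mul_le_mul_of_nonneg_left b1 (inv_nonneg.mpr (half_pos hz0).le)
  have := h2.add h1
  simpa [ContinuousWithinAt] using this

/-- The Cauchy transform minus `γz` solves the Burgers problem in the open half-plane with the same
datum, so `eqOn_solg` applies. -/
theorem IsAnalyticSolution.cauchyTransform_eq_solf {μ : ℝ} (hγ : 0 < γ) (hμ : 0 ≤ μ) (hμν : μ < ν)
    (hρ₀ : Integrable ρ₀) (hlow : ∀ᵐ x, -μ ≤ ρ₀ x)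
    (h : IsAnalyticSolution 1 γ ν (lifespan γ ν μ) ρ₀ ρ) {t : ℝ}
    (ht : t ∈ times (lifespan γ ν μ)) {z : ℂ} (hz : 0 < z.im) :
    cauchyTransform (ρ t) z = solf γ ν ρ₀ t z := by
  have hν : 0 ≤ ν := hμ.trans hμν.le
  set g : ℝ → ℂ → ℂ := fun t z => cauchyTransform (extendZero ρ₀ ρ t) z - γ * z with hg
  have hderiv : ∀ τ ∈ times (lifespan γ ν μ), ∀ w : ℂ, 0 < w.im →
      HasDerivAt (g τ) (cauchyDeriv (ρ τ) w - γ) w := by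
    intro τ hτ w hw
    have h1 := CriticalHilbert.hasDerivAt_cauchyTransform (h.integrable τ hτ) hw
    have h2 : HasDerivAt (fun w : ℂ => (γ : ℂ) * w) γ w := by
      simpa using (hasDerivAt_id w).const_mul (γ : ℂ)
    have e : g τ = fun w => cauchyTransform (ρ τ) w - γ * w := by
      ext w; simp only [hg, extendZero_of_pos hτ.1]
    rw [e]
    exact h1.sub h2
  have key := eqOn_solg hγ hμ hμν hρ₀ hlow (h := g)
    (fun τ hτ w hw => (hderiv τ hτ w hw).differentiableAt.differentiableWithinAt)
    ((h.continuousOn_cauchyTransform hρ₀).sub (by fun_prop))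
    (fun τ hτ w hw => by
      rw [(hderiv τ hτ w hw).deriv]
      have h1 := (h.hasDerivAt_cauchyTransform hγ.le hν hτ hw).sub_const ((γ : ℂ) * w)
      refine (h1.congr_of_eventuallyEq ?_).congr_deriv ?_
      · filter_upwards [Ioi_mem_nhds hτ.1] with τ' hτ'
        simp only [hg, extendZero_of_pos hτ']
      · simp only [hg, extendZero_of_pos hτ.1, cauchyFlux]
        ring)
    (fun w _ => by simp [hg, extendZero]) ht (show z ∈ upperHalf from hz)
  simp only [hg, extendZero_of_pos ht.1, solg] at key
  linear_combination key

/-- Both sides of the equality of Cauchy transforms have vertical limits at the real point `x`;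
their imaginary parts are the two densities, up to sign. -/
theorem IsAnalyticSolution.eq_traceDensity {μ : ℝ} (hγ : 0 < γ) (hμ : 0 ≤ μ) (hμν : μ < ν)
    (hρ₀ : Integrable ρ₀) (hlow : ∀ᵐ x, -μ ≤ ρ₀ x)
    (h : IsAnalyticSolution 1 γ ν (lifespan γ ν μ) ρ₀ ρ) {t : ℝ}
    (ht : t ∈ times (lifespan γ ν μ)) (x : ℝ) :
    ρ t x = traceDensity γ (solg γ ν ρ₀) t x := by
  obtain ⟨u, -, hu, -, -⟩ := h.equation t ht
  have h1 := tendsto_cauchyTransform_boundary (h.integrable t ht)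
    (fun x => (h.analytic t ht x trivial).differentiableAt) hu x
  have h2 : Tendsto (fun y : ℝ => solf γ ν ρ₀ t (x + Complex.I * y)) (𝓝[>] 0)
      (𝓝 (solf γ ν ρ₀ t x)) := by
    have hc : ContinuousAt (solf γ ν ρ₀ t) (x + Complex.I * (0 : ℝ)) := by
      simpa using (analyticOnNhd_solf hγ hμ hμν hρ₀ hlow ht x
        (by simp [closedUpperHalf])).continuousAt
    have h3 : ContinuousAt (fun y : ℝ => solf γ ν ρ₀ t (x + Complex.I * y)) 0 :=
      ContinuousAt.comp (f := fun y : ℝ => (x : ℂ) + Complex.I * y) hc (by fun_prop)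
    have h4 := h3.tendsto.mono_left (nhdsWithin_le_nhds (s := Set.Ioi 0))
    simpa using h4
  have h5 := tendsto_nhds_unique h1 (h2.congr' (by
    filter_upwards [self_mem_nhdsWithin] with y hy
    exact (h.cauchyTransform_eq_solf hγ hμ hμν hρ₀ hlow ht (by simpa using hy)).symm))
  rw [traceDensity_solg, ← h5]
  simp

end Uniqueness

end CriticalHilbert

/-! ### The main theorem -/

theorem theorem1p3 (γ ν μ s : ℝ) (hγ : 0 < γ) (hμ : 0 ≤ μ) (hμν : μ < ν) (hs : 1 / 2 < s)
    (ρ₀ : ℝ → ℝ) (hρ₀ : Integrable ρ₀) (hρ₀s : CriticalHilbert.MemHs s ρ₀)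
    (hlower : ∀ᵐ x : ℝ, -μ ≤ ρ₀ x) :
    ∃ g : ℝ → ℂ → ℂ,
      -- (i) the unique holomorphic solution of the complex Burgers equation
      (CriticalHilbert.IsBurgersSolution γ ν (CriticalHilbert.lifespan γ ν μ) ρ₀ g ∧
        (∀ g' : ℝ → ℂ → ℂ,
          CriticalHilbert.IsBurgersSolution γ ν (CriticalHilbert.lifespan γ ν μ) ρ₀ g' →
          ∀ t ∈ CriticalHilbert.times (CriticalHilbert.lifespan γ ν μ),
            Set.EqOn (g' t) (g t) CriticalHilbert.closedUpperHalf) ∧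
        (∀ t ∈ CriticalHilbert.times (CriticalHilbert.lifespan γ ν μ),
          (∀ z ∈ CriticalHilbert.closedUpperHalf, ContDiffAt ℝ ∞ (fun τ => g τ z) t) ∧
          ∀ k : ℕ, AnalyticOnNhd ℂ (fun z => iteratedDeriv k (fun τ => g τ z) t)
            CriticalHilbert.closedUpperHalf)) ∧
      -- (ii) its trace on the real line is the unique spatially analytic solution
      (CriticalHilbert.IsAnalyticSolution 1 γ ν (CriticalHilbert.lifespan γ ν μ) ρ₀
          (CriticalHilbert.traceDensity γ g) ∧
        (∀ ρ' : ℝ → ℝ → ℝ,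
          CriticalHilbert.IsAnalyticSolution 1 γ ν (CriticalHilbert.lifespan γ ν μ) ρ₀ ρ' →
          ∀ t ∈ CriticalHilbert.times (CriticalHilbert.lifespan γ ν μ), ∀ x : ℝ,
            ρ' t x = CriticalHilbert.traceDensity γ g t x) ∧
        (∀ t ∈ CriticalHilbert.times (CriticalHilbert.lifespan γ ν μ),
          CriticalHilbert.IsHilbertTransform (CriticalHilbert.traceDensity γ g t)
            (CriticalHilbert.traceVelocity γ g t) ∧
          (∀ x : ℝ, -μ * Real.exp (γ * t) ≤ CriticalHilbert.traceDensity γ g t x) ∧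
          (∀ k : ℕ, AnalyticOnNhd ℝ
            (fun x => iteratedDeriv k (fun τ => CriticalHilbert.traceDensity γ g τ x) t)
            Set.univ) ∧
          ∫ x, CriticalHilbert.traceDensity γ g t x = ∫ x, ρ₀ x ∧
          ((∀ᵐ x : ℝ, 0 ≤ ρ₀ x) →
            ∫ x, |CriticalHilbert.traceDensity γ g t x| = ∫ x, |ρ₀ x|))) ∧
      -- (iii) for `μ = 0` the solution is global and converges to the steady state
      (μ = 0 →
        CriticalHilbert.lifespan γ ν μ = ⊤ ∧
        (∀ z ∈ CriticalHilbert.closedUpperHalf, Tendsto (fun t => g t z) atTop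
          (𝓝 (CriticalHilbert.steadyBurgers γ ν (∫ x, ρ₀ x) z))) ∧
        ∀ x : ℝ, Tendsto (fun t => CriticalHilbert.traceDensity γ g t x) atTop
          (𝓝 (CriticalHilbert.steadyDensity γ ν (∫ x, ρ₀ x) x))) := by
  have hν : 0 < ν := hμ.trans_lt hμν
  obtain ⟨Fc, M, hFc, hFcC, hM, hFcρ⟩ :=
    CriticalHilbert.exists_cauchyTransform_extension hρ₀ (hρ₀s.integrable_fourier hs hρ₀)
  have hext : ∀ t ∈ CriticalHilbert.times (CriticalHilbert.lifespan γ ν μ),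
      ∀ z ∈ CriticalHilbert.closedUpperHalf,
        CriticalHilbert.HasAnalyticExt (CriticalHilbert.solg γ ν ρ₀) t z := fun t ht z hz =>
    CriticalHilbert.hasAnalyticExt_solg hγ hμ hρ₀ hlower ht.1
      (CriticalHilbert.admissible_of_mem hγ hμ hμν ht hz)
  refine ⟨CriticalHilbert.solg γ ν ρ₀, ⟨?_, fun g' hg' t ht => ?_, fun t ht => ⟨fun z hz => ?_,
    fun k z hz => ?_⟩⟩, ⟨?_, fun ρ' h t ht x => ?_, fun t ht => ?_⟩, fun hμ0 => ?_⟩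
  · exact CriticalHilbert.isBurgersSolution_solg hγ hμ hμν hρ₀ hlower
  · exact hg'.eqOn_solg hγ hμ hμν hρ₀ hlower ht
  · exact (hext t ht z hz).contDiffAt_fst ∞
  · exact ((hext t ht z hz).iteratedDeriv k).analyticAt
  · exact CriticalHilbert.isAnalyticSolution_traceDensity hγ hμ hμν hρ₀ hlower hM hρ₀s.memLp
      hFc hFcC hFcρ
  · exact h.eq_traceDensity hγ hμ hμν hρ₀ hlower ht x
  · have hmass : ∫ x, CriticalHilbert.traceDensity γ (CriticalHilbert.solg γ ν ρ₀) t x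
        = ∫ x, ρ₀ x := by
      simp_rw [CriticalHilbert.traceDensity_solg]
      exact CriticalHilbert.integral_neg_im_solf hγ hμ hμν hρ₀ hlower hM ht
    refine ⟨?_, fun x => ?_, CriticalHilbert.analytic_iteratedDeriv_traceDensity hγ hμ hμν hρ₀
      hlower ht, hmass, fun hpos => ?_⟩
    · rw [funext (CriticalHilbert.traceDensity_solg γ ν ρ₀ t),
        funext (CriticalHilbert.traceVelocity_solg γ ν ρ₀ t)]
      exact CriticalHilbert.isHilbertTransform_solf hγ hμ hμν hρ₀ hlower hM ht
    · rw [CriticalHilbert.traceDensity_solg]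
      exact CriticalHilbert.neg_im_solf_ge hγ hμ hμν hρ₀ hlower ht hlower x
    · have hnn : ∀ x, 0 ≤ CriticalHilbert.traceDensity γ (CriticalHilbert.solg γ ν ρ₀) t x := by
        intro x
        rw [CriticalHilbert.traceDensity_solg]
        simpa using CriticalHilbert.neg_im_solf_ge hγ hμ hμν hρ₀ hlower ht (μ' := 0)
          (by simpa using hpos) x
      rw [integral_congr_ae (hpos.mono fun x hx => abs_of_nonneg hx), ← hmass]
      exact integral_congr_ae (ae_of_all _ fun x => abs_of_nonneg (hnn x))
  · subst hμ0
    have hpos : ∀ᵐ x : ℝ, 0 ≤ ρ₀ x := by simpa using hlower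
    exact ⟨if_pos rfl, fun z hz => CriticalHilbert.tendsto_solg_atTop hγ hν hρ₀ hpos hz,
      CriticalHilbert.tendsto_traceDensity_atTop hγ hν hρ₀ hpos⟩
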